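/- Let $\gamma<1/4$ be a fixed real number, let $c=\pi/\sqrt6$, and for $n\ge 1$ put $k=\lfloor n^{\gamma}\rfloor$. Let $\Lambda$ be a uniformly random Young diagram of area $n$ (equivalently, a uniformly random partition of $n$); let $\vec\Lambda=(\Lambda_1,\dots,\Lambda_k)$ be the heights of its $k$ tallest columns and $\vec\Lambda'=(\Lambda'_1,\dots,\Lambda'_k)$ the lengths of its $k$ longest rows, both in weakly decreasing order and padded by zeros if necessary. Let $E_1,\dots,E_k,E'_1,\dots,E'_k$ be independent exponential random variables with parameter $1$, let $S_j=\sum_{i=1}^jE_i$, $S'_j=\sum_{i=1}^jE'_i$, and define, for $1\le j\le k$, $$\mathit{\Lambda}^*_j=\left\lceil\frac{\sqrt n}{c}\log\frac{\sqrt n/c}{S_j}\right\rceil,\qquad \mathit{\Lambda}^{*\prime}_j=\left\lceil\frac{\sqrt n}{c}\log\frac{\sqrt n/c}{S'_j}\right\rceil .$$ Let $\mu_n$ be the law of $(\vec\Lambda,\vec\Lambda')$ and $\mu^*_n$ the law of $\bigl((\mathit{\Lambda}^*_j)_{j\le k},(\mathit{\Lambda}^{*\prime}_j)_{j\le k}\bigr)$,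 both on $\mathbb Z^k\times\mathbb Z^k$, and let $d_{TV}(\mu,\nu)=\sup_A|\mu(A)-\nu(A)|$. Then, as $n\to\infty$, $$d_{TV}(\mu_n,\mu^*_n)=O\bigl(n^{2\gamma-1/2}\log^3n\bigr).$$ Consequently, uniformly over all sets $B_1,B_2\subseteq\mathbb Z^k$, $$P(\vec\Lambda\in B_1,\ \vec\Lambda'\in B_2)=P(\vec\Lambda\in B_1)\,P(\vec\Lambda'\in B_2)+O\bigl(n^{2\gamma-1/2}\log^3n\bigr).$$ The constants implied by $O$ depend only on $\gamma$. -/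

import Mathlib

open MeasureTheory ProbabilityTheory Filter

/-- Young diagrams of area `n`, equivalently partitions of `n`. -/
def DiagramOfArea (n : ℕ) : Type := {D : YoungDiagram // D.card = n}

instance (n : ℕ) : Finite (DiagramOfArea n) := by
  refine Finite.of_injective
    (β := {s : Finset (ℕ × ℕ) // s ∈ (Finset.range n ×ˢ Finset.range n).powerset})
    (fun D => ⟨D.1.cells, ?_⟩) ?_
  · rw [Finset.mem_powerset]
    rintro ⟨i, j⟩ h
    have hD : D.1.cells.card = n := D.2
    have hij : (i, j) ∈ D.1 := h
    have hcol : (D.1.col j).card ≤ n := (Finset.card_filter_le _ _).trans hD.le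
    have hrow : (D.1.row i).card ≤ n := (Finset.card_filter_le _ _).trans hD.le
    rw [← YoungDiagram.colLen_eq_card] at hcol
    rw [← YoungDiagram.rowLen_eq_card] at hrow
    have h1 := YoungDiagram.mem_iff_lt_colLen.1 hij
    have h2 := YoungDiagram.mem_iff_lt_rowLen.1 hij
    simp only [Finset.mem_product, Finset.mem_range]
    omega
  · intro D D' h
    exact Subtype.ext (YoungDiagram.ext (congrArg Subtype.val h))

instance (n : ℕ) : Nonempty (DiagramOfArea n) := by
  refine ⟨⟨⟨{0} ×ˢ Finset.range n, ?_⟩, ?_⟩⟩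
  · rintro ⟨a, b⟩ ⟨a', b'⟩ ⟨h1, h2⟩ h
    simp only [Finset.coe_product, Finset.coe_singleton, Finset.coe_range, Set.mem_prod,
      Set.mem_singleton_iff, Set.mem_Iio] at h ⊢
    simp only at h1 h2
    omega
  · simp [YoungDiagram.card]

instance (n : ℕ) : MeasurableSpace (DiagramOfArea n) := ⊤

/-- The uniform distribution on the Young diagrams of area `n`
(`ProbabilityTheory.uniformOn` is normalized counting measure). -/
noncomputable def uniformDiagram (n : ℕ) : Measure (DiagramOfArea n) :=
  uniformOn Set.univ

instance (n : ℕ) : IsProbabilityMeasure (uniformDiagram n) := by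
  have : MeasurableSingletonClass (DiagramOfArea n) := ⟨fun _ => trivial⟩
  exact isProbabilityMeasure_uniformOn Set.finite_univ Set.univ_nonempty

/-- `(Λ₁, …, Λ_k)`: the heights of the `k` tallest columns (index `j : Fin k` is the `(j+1)`-st
column; missing columns have height `0`). -/
def topColumns {n : ℕ} (k : ℕ) (D : DiagramOfArea n) : Fin k → ℤ :=
  fun j => (D.1.colLen j : ℤ)

/-- `(Λ'₁, …, Λ'_k)`: the lengths of the `k` longest rows. -/
def topRows {n : ℕ} (k : ℕ) (D : DiagramOfArea n) : Fin k → ℤ :=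
  fun j => (D.1.rowLen j : ℤ)

/-- The joint law of the `k` tallest columns and the `k` longest rows of a uniformly random
Young diagram of area `n`. -/
noncomputable def diagramLaw (n k : ℕ) : Measure ((Fin k → ℤ) × (Fin k → ℤ)) :=
  (uniformDiagram n).map (fun D => (topColumns k D, topRows k D))

/-- The constant `c = π / √6`. -/
noncomputable def cConst : ℝ := Real.pi / Real.sqrt 6

/-- Partial sums: `partialSum E j = E₁ + ⋯ + E_{j+1}`, with the indices of `E` shifted by one. -/
def partialSum {k : ℕ} (E : Fin k → ℝ) (j : Fin k) : ℝ := ∑ i ∈ Finset.Iic j, E i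

/-- The tuple `⌈(√n / c) log ((√n / c) / S_j)⌉`, `1 ≤ j ≤ k`, as a function of the increments
`E` of the partial sums `S_j`. -/
noncomputable def slantTuple (n : ℕ) {k : ℕ} (E : Fin k → ℝ) : Fin k → ℤ :=
  fun j => ⌈Real.sqrt n / cConst * Real.log (Real.sqrt n / cConst / partialSum E j)⌉

/-- The map producing both approximating tuples is measurable. -/
theorem measurable_slantTuple_pair (n k : ℕ) :
    Measurable (fun x : (Fin k → ℝ) × (Fin k → ℝ) => (slantTuple n x.1, slantTuple n x.2)) := by
  have h : Measurable (fun E : Fin k → ℝ => slantTuple n E) := by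
    unfold slantTuple partialSum
    refine measurable_pi_lambda _ fun j => Int.measurable_ceil.comp ?_
    fun_prop
  exact (h.comp measurable_fst).prodMk (h.comp measurable_snd)

/-- The joint law of the two approximating tuples when all `2k` increments
`E₁, …, E_k, E'₁, …, E'_k` are independent exponential variables with parameter `1`. -/
noncomputable def slantLaw (n k : ℕ) : Measure ((Fin k → ℤ) × (Fin k → ℤ)) :=
  ((Measure.pi fun _ : Fin k => expMeasure 1).prod
    (Measure.pi fun _ : Fin k => expMeasure 1)).map
    (fun x => (slantTuple n x.1, slantTuple n x.2))

/-- Total variation distance of two probability measures: the supremum of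
`|μ(A) - ν(A)|` over measurable sets `A`. -/
noncomputable def tvDist {α : Type*} [MeasurableSpace α] (μ ν : Measure α) : ℝ :=
  ⨆ A : {A : Set α // MeasurableSet A}, |μ.real A.1 - ν.real A.1|

/-! ### Young diagrams in a box -/

theorem YoungDiagram.ext_mem {D E : YoungDiagram} (h : ∀ c, c ∈ D ↔ c ∈ E) : D = E :=
  YoungDiagram.ext (Finset.ext fun c => by simpa using h c)

/-- Young diagrams of area `N` with at most `a` rows and at most `b` columns. -/
def boxDiagrams (a b N : ℕ) : Set YoungDiagram :=
  {E | E.card = N ∧ E.colLen 0 ≤ a ∧ E.rowLen 0 ≤ b}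

theorem rowLen_le_card (D : YoungDiagram) (i : ℕ) : D.rowLen i ≤ D.card := by
  rw [YoungDiagram.rowLen_eq_card]; exact Finset.card_filter_le _ _

theorem colLen_le_card (D : YoungDiagram) (j : ℕ) : D.colLen j ≤ D.card := by
  rw [YoungDiagram.colLen_eq_card]; exact Finset.card_filter_le _ _

theorem finite_card_eq (n : ℕ) : {D : YoungDiagram | D.card = n}.Finite := by
  have : Finite {D : YoungDiagram | D.card = n} := inferInstanceAs (Finite (DiagramOfArea n))
  exact Set.toFinite _

theorem finite_boxDiagrams (a b N : ℕ) : (boxDiagrams a b N).Finite :=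
  (finite_card_eq N).subset fun _ h => h.1

/-- Remove the first column of a Young diagram. -/
def YoungDiagram.removeCol (E : YoungDiagram) : YoungDiagram where
  cells := (E.cells.filter (fun c => 0 < c.2)).image (fun c => (c.1, c.2 - 1))
  isLowerSet := by
    rintro ⟨i, j⟩ ⟨i', j'⟩ ⟨h1, h2⟩ h
    simp only [Finset.coe_image, Finset.coe_filter, Set.mem_image, Set.mem_ofPred_eq,
      Prod.mk.injEq, Prod.exists, YoungDiagram.mem_cells] at h ⊢
    obtain ⟨x, y, ⟨hE, hy⟩, rfl, rfl⟩ := h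
    simp only at h1 h2
    exact ⟨i', j' + 1, ⟨E.up_left_mem h1 (by omega) hE, by omega⟩, rfl, by omega⟩

theorem YoungDiagram.mem_removeCol {E : YoungDiagram} {i j : ℕ} :
    (i, j) ∈ E.removeCol ↔ (i, j + 1) ∈ E := by
  rw [← YoungDiagram.mem_cells]
  simp only [removeCol, Finset.mem_image, Finset.mem_filter, Prod.mk.injEq, Prod.exists,
    YoungDiagram.mem_cells]
  constructor
  · rintro ⟨x, y, ⟨hE, hy⟩, rfl, rfl⟩
    rwa [Nat.sub_add_cancel hy]
  · intro h
    exact ⟨i, j + 1, ⟨h, by omega⟩, rfl, by omega⟩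

theorem YoungDiagram.card_eq_colLen_add (E : YoungDiagram) :
    E.card = E.colLen 0 + E.removeCol.card := by
  have h : E.cells = E.col 0 ∪ E.removeCol.cells.image (fun c => (c.1, c.2 + 1)) := by
    ext ⟨i, j⟩
    simp only [YoungDiagram.mem_cells, Finset.mem_union, YoungDiagram.mem_col_iff,
      Finset.mem_image, Prod.mk.injEq, Prod.exists, YoungDiagram.mem_removeCol]
    constructor
    · intro h
      rcases j with _ | j
      · exact Or.inl ⟨h, rfl⟩
      · exact Or.inr ⟨i, j, h, rfl, rfl⟩
    · rintro (h | ⟨x, y, h, rfl, rfl⟩)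
      · exact h.1
      · exact h
  rw [YoungDiagram.card, h, Finset.card_union_of_disjoint, ← YoungDiagram.colLen_eq_card,
    Finset.card_image_of_injective]
  · rintro ⟨x, y⟩ ⟨x', y'⟩ h
    simpa using h
  · rw [Finset.disjoint_left]
    rintro ⟨i, j⟩ h1 h2
    simp only [YoungDiagram.mem_col_iff, Finset.mem_image, Prod.mk.injEq, Prod.exists] at h1 h2
    obtain ⟨x, y, -, -, h⟩ := h2
    omega

/-- Put a column of length `h` in front of a Young diagram with at most `h` rows. -/
def YoungDiagram.addCol (E : YoungDiagram) (h : ℕ) (hE : E.colLen 0 ≤ h) : YoungDiagram where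
  cells := (Finset.range h ×ˢ {0}) ∪ E.cells.image (fun c => (c.1, c.2 + 1))
  isLowerSet := by
    rintro ⟨i, j⟩ ⟨i', j'⟩ ⟨h1, h2⟩ hm
    simp only [Finset.coe_union, Finset.coe_product, Finset.coe_range, Finset.coe_singleton,
      Finset.coe_image, Set.mem_union, Set.mem_prod, Set.mem_Iio, Set.mem_singleton_iff,
      Set.mem_image, Prod.mk.injEq, Prod.exists, Finset.mem_coe, YoungDiagram.mem_cells] at hm ⊢
    simp only at h1 h2
    rcases hm with hm | ⟨x, y, hxy, rfl, rfl⟩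
    · left; omega
    · rcases j' with _ | j'
      · left
        have : (x, 0) ∈ E := E.up_left_mem le_rfl (Nat.zero_le _) hxy
        rw [YoungDiagram.mem_iff_lt_colLen] at this
        omega
      · exact Or.inr ⟨i', j', E.up_left_mem h1 (by omega) hxy, rfl, rfl⟩

theorem YoungDiagram.mem_addCol {E : YoungDiagram} {h : ℕ} {hE : E.colLen 0 ≤ h} {i j : ℕ} :
    (i, j) ∈ E.addCol h hE ↔ (j = 0 ∧ i < h) ∨ ∃ y, j = y + 1 ∧ (i, y) ∈ E := by
  rw [← YoungDiagram.mem_cells]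
  simp only [addCol, Finset.mem_union, Finset.mem_product, Finset.mem_range,
    Finset.mem_singleton, Finset.mem_image, Prod.mk.injEq, Prod.exists, YoungDiagram.mem_cells]
  constructor
  · rintro (h | ⟨x, y, h, rfl, rfl⟩)
    · exact Or.inl h.symm
    · exact Or.inr ⟨y, rfl, h⟩
  · rintro (h | ⟨y, rfl, h⟩)
    · exact Or.inl h.symm
    · exact Or.inr ⟨i, y, h, rfl, rfl⟩

theorem nat_eq_of_forall_lt_iff {a b : ℕ} (h : ∀ i, i < a ↔ i < b) : a = b := by
  have h1 := h a
  have h2 := h b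
  omega

theorem YoungDiagram.colLen_addCol {E : YoungDiagram} {h : ℕ} {hE : E.colLen 0 ≤ h} :
    (E.addCol h hE).colLen 0 = h :=
  nat_eq_of_forall_lt_iff fun i => by
    rw [← YoungDiagram.mem_iff_lt_colLen, YoungDiagram.mem_addCol]
    simp

theorem YoungDiagram.removeCol_addCol {E : YoungDiagram} {h : ℕ} {hE : E.colLen 0 ≤ h} :
    (E.addCol h hE).removeCol = E :=
  YoungDiagram.ext_mem fun ⟨i, j⟩ => by
    rw [YoungDiagram.mem_removeCol, YoungDiagram.mem_addCol]
    simp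

theorem YoungDiagram.rowLen_removeCol (E : YoungDiagram) (i : ℕ) :
    E.removeCol.rowLen i = E.rowLen i - 1 :=
  nat_eq_of_forall_lt_iff fun j => by
    rw [← YoungDiagram.mem_iff_lt_rowLen, YoungDiagram.mem_removeCol,
      YoungDiagram.mem_iff_lt_rowLen]
    omega

theorem YoungDiagram.colLen_removeCol (E : YoungDiagram) (j : ℕ) :
    E.removeCol.colLen j = E.colLen (j + 1) :=
  nat_eq_of_forall_lt_iff fun i => by
    rw [← YoungDiagram.mem_iff_lt_colLen, YoungDiagram.mem_removeCol,
      YoungDiagram.mem_iff_lt_colLen]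

theorem YoungDiagram.eq_of_removeCol_eq {D E : YoungDiagram} (h0 : D.colLen 0 = E.colLen 0)
    (h : D.removeCol = E.removeCol) : D = E :=
  YoungDiagram.ext_mem fun ⟨i, j⟩ => by
    rcases j with _ | j
    · rw [YoungDiagram.mem_iff_lt_colLen, YoungDiagram.mem_iff_lt_colLen, h0]
    · rw [← YoungDiagram.mem_removeCol, ← YoungDiagram.mem_removeCol, h]

theorem YoungDiagram.eq_bot_of_colLen {E : YoungDiagram} (h : E.colLen 0 = 0) : E = ⊥ :=
  YoungDiagram.ext_mem fun ⟨i, j⟩ => by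
    simp only [YoungDiagram.notMem_bot, iff_false]
    intro hm
    have : (i, 0) ∈ E := E.up_left_mem le_rfl (Nat.zero_le _) hm
    rw [YoungDiagram.mem_iff_lt_colLen] at this
    omega

theorem YoungDiagram.eq_bot_of_rowLen {E : YoungDiagram} (h : E.rowLen 0 = 0) : E = ⊥ :=
  YoungDiagram.ext_mem fun ⟨i, j⟩ => by
    simp only [YoungDiagram.notMem_bot, iff_false]
    intro hm
    have : (0, j) ∈ E := E.up_left_mem (Nat.zero_le _) le_rfl hm
    rw [YoungDiagram.mem_iff_lt_rowLen] at this
    omega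

theorem YoungDiagram.colLen_bot : (⊥ : YoungDiagram).colLen 0 = 0 :=
  nat_eq_of_forall_lt_iff fun i => by
    rw [← YoungDiagram.mem_iff_lt_colLen]; simp

theorem YoungDiagram.rowLen_bot : (⊥ : YoungDiagram).rowLen 0 = 0 :=
  nat_eq_of_forall_lt_iff fun i => by
    rw [← YoungDiagram.mem_iff_lt_rowLen]; simp

theorem boxDiagrams_degenerate {a b : ℕ} (h : a = 0 ∨ b = 0) (N : ℕ) :
    (boxDiagrams a b N).ncard = if N = 0 then 1 else 0 := by
  have hb : ∀ E ∈ boxDiagrams a b N, E = ⊥ := by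
    rintro E ⟨-, h1, h2⟩
    rcases h with rfl | rfl
    · exact YoungDiagram.eq_bot_of_colLen (by omega)
    · exact YoungDiagram.eq_bot_of_rowLen (by omega)
  split_ifs with hN
  · subst hN
    rw [Set.ncard_eq_one]
    refine ⟨⊥, Set.eq_singleton_iff_unique_mem.2 ⟨⟨by simp [YoungDiagram.card], ?_, ?_⟩, hb⟩⟩
    · rw [YoungDiagram.colLen_bot]; omega
    · rw [YoungDiagram.rowLen_bot]; omega
  · rw [Set.ncard_eq_zero (finite_boxDiagrams a b N), Set.eq_empty_iff_forall_notMem]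
    intro E hE
    have h1 := hE.1
    rw [hb E hE] at h1
    simp [YoungDiagram.card] at h1
    omega

theorem boxDiagrams_succ (a b N : ℕ) :
    (boxDiagrams (a + 1) (b + 1) N).ncard = (boxDiagrams a (b + 1) N).ncard +
      if a + 1 ≤ N then (boxDiagrams (a + 1) b (N - (a + 1))).ncard else 0 := by
  have hsplit : boxDiagrams (a + 1) (b + 1) N = boxDiagrams a (b + 1) N ∪
      {E | E ∈ boxDiagrams (a + 1) (b + 1) N ∧ E.colLen 0 = a + 1} := by
    ext E
    simp only [boxDiagrams, Set.mem_ofPred_eq, Set.mem_union]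
    omega
  have hfin : {E | E ∈ boxDiagrams (a + 1) (b + 1) N ∧ E.colLen 0 = a + 1}.Finite :=
    (finite_boxDiagrams (a + 1) (b + 1) N).subset fun _ h => h.1
  rw [hsplit, Set.ncard_union_eq _ (finite_boxDiagrams _ _ _) hfin]
  · congr 1
    split_ifs with hN
    · refine Set.ncard_congr (fun E _ => E.removeCol) ?_ ?_ ?_
      · rintro E ⟨⟨h1, h2, h3⟩, h4⟩
        refine ⟨?_, ?_, ?_⟩
        · have := E.card_eq_colLen_add
          omega
        · rw [YoungDiagram.colLen_removeCol]
          exact (E.colLen_anti 0 1 zero_le_one).trans h2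
        · rw [YoungDiagram.rowLen_removeCol]
          omega
      · rintro D E ⟨-, hD⟩ ⟨-, hE⟩ h
        exact YoungDiagram.eq_of_removeCol_eq (hD.trans hE.symm) h
      · rintro E ⟨h1, h2, h3⟩
        refine ⟨E.addCol (a + 1) h2, ⟨⟨?_, ?_, ?_⟩, ?_⟩, ?_⟩
        · rw [YoungDiagram.card_eq_colLen_add, YoungDiagram.colLen_addCol,
            YoungDiagram.removeCol_addCol]
          omega
        · exact YoungDiagram.colLen_addCol.le
        · have := YoungDiagram.rowLen_removeCol (E.addCol (a + 1) h2) 0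
          rw [YoungDiagram.removeCol_addCol] at this
          omega
        · exact YoungDiagram.colLen_addCol
        · exact YoungDiagram.removeCol_addCol
    · rw [Set.ncard_eq_zero hfin, Set.eq_empty_iff_forall_notMem]
      rintro E ⟨⟨h1, -⟩, h⟩
      have := colLen_le_card E 0
      omega
  · rw [Set.disjoint_left]
    rintro E ⟨-, h, -⟩ ⟨-, h'⟩
    omega

open Polynomial in
/-- The generating polynomial of the Young diagrams in an `a × b` box, a Gaussian binomial
coefficient. -/
noncomputable def boxGenPoly : ℕ → ℕ → ℕ[X]
  | 0, _ => 1
  | _ + 1, 0 => 1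
  | a + 1, b + 1 => boxGenPoly a (b + 1) + X ^ (a + 1) * boxGenPoly (a + 1) b
termination_by a b => a + b

theorem boxGenPoly_zero_right (a : ℕ) : boxGenPoly a 0 = 1 := by
  cases a <;> simp [boxGenPoly]

theorem boxGenPoly_zero_left (b : ℕ) : boxGenPoly 0 b = 1 := by simp [boxGenPoly]

open Polynomial in
theorem boxGenPoly_succ (a b : ℕ) :
    boxGenPoly (a + 1) (b + 1) = boxGenPoly a (b + 1) + X ^ (a + 1) * boxGenPoly (a + 1) b := by
  rw [boxGenPoly]

theorem coeff_boxGenPoly (a b N : ℕ) : (boxGenPoly a b).coeff N = (boxDiagrams a b N).ncard := by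
  induction a generalizing b N with
  | zero => rw [boxGenPoly_zero_left, boxDiagrams_degenerate (Or.inl rfl), Polynomial.coeff_one]
  | succ a iha =>
    induction b generalizing N with
    | zero => rw [boxGenPoly_zero_right, boxDiagrams_degenerate (Or.inr rfl), Polynomial.coeff_one]
    | succ b ihb =>
      rw [boxGenPoly_succ, boxDiagrams_succ, Polynomial.coeff_add, Polynomial.coeff_X_pow_mul', iha]
      split_ifs with h
      · rw [ihb]
      · rfl

theorem aeval_boxGenPoly_mul {R : Type*} [CommRing R] (z : R) (a b : ℕ) :
    Polynomial.aeval z (boxGenPoly a b) * (∏ i ∈ Finset.range a, (1 - z ^ (i + 1))) *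
      (∏ i ∈ Finset.range b, (1 - z ^ (i + 1))) = ∏ i ∈ Finset.range (a + b), (1 - z ^ (i + 1)) := by
  induction a generalizing b with
  | zero => simp [boxGenPoly_zero_left]
  | succ a iha =>
    induction b with
    | zero => simp [boxGenPoly_zero_right]
    | succ b ihb =>
      have h1 := iha (b + 1)
      rw [boxGenPoly_succ, map_add, map_mul, map_pow, Polynomial.aeval_X,
        Finset.prod_range_succ (n := a), Finset.prod_range_succ (n := b),
        show a + 1 + (b + 1) = (a + b + 1) + 1 by ring, Finset.prod_range_succ]
      rw [Finset.prod_range_succ (n := b), show a + (b + 1) = a + b + 1 by ring] at h1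
      rw [Finset.prod_range_succ (n := a), show a + 1 + b = a + b + 1 by ring] at ihb
      linear_combination (1 - z ^ (a + 1)) * h1 + z ^ (a + 1) * (1 - z ^ (b + 1)) * ihb

/-- The Young diagram with first `k` columns `l`, first `k` rows `m`, and remainder `E`. -/
def frameDiagram (k : ℕ) (l m : ℕ → ℕ) (hl : Antitone l) (hm : Antitone m) (E : YoungDiagram)
    (h1 : ∀ j < k, E.colLen 0 + k ≤ l j) (h2 : ∀ j < k, E.rowLen 0 + k ≤ m j) :
    YoungDiagram where
  cells := (Finset.range k).biUnion (fun j => Finset.range (l j) ×ˢ {j}) ∪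
    ((Finset.range k).biUnion (fun i => {i} ×ˢ Finset.Ico k (m i)) ∪
      E.cells.image (fun c => (c.1 + k, c.2 + k)))
  isLowerSet := by
    rintro ⟨i, j⟩ ⟨i', j'⟩ ⟨hi, hj⟩ h
    simp only at hi hj
    simp only [Finset.coe_union, Set.mem_union, Finset.mem_coe, Finset.mem_biUnion,
      Finset.mem_range, Finset.mem_product, Finset.mem_singleton, Finset.mem_Ico,
      Finset.mem_image, YoungDiagram.mem_cells, Prod.mk.injEq, Prod.exists] at h ⊢
    by_cases hj' : j' < k
    · refine Or.inl ⟨j', hj', ?_, rfl⟩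
      rcases h with ⟨x, hx, h, rfl⟩ | ⟨x, hx, rfl, h⟩ | ⟨x, y, h, rfl, rfl⟩
      · exact lt_of_le_of_lt hi (lt_of_lt_of_le h (hl hj))
      · have := h1 j' hj'; omega
      · have h3 := h1 j' hj'
        have : (x, 0) ∈ E := E.up_left_mem le_rfl (Nat.zero_le _) h
        rw [YoungDiagram.mem_iff_lt_colLen] at this
        omega
    · right
      by_cases hi' : i' < k
      · refine Or.inl ⟨i', hi', rfl, by omega, ?_⟩
        rcases h with ⟨x, hx, h, rfl⟩ | ⟨x, hx, rfl, h⟩ | ⟨x, y, h, rfl, rfl⟩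
        · omega
        · have := hm hi; omega
        · have h3 := h2 i' hi'
          have : (0, y) ∈ E := E.up_left_mem (Nat.zero_le _) le_rfl h
          rw [YoungDiagram.mem_iff_lt_rowLen] at this
          omega
      · right
        rcases h with ⟨x, hx, h, rfl⟩ | ⟨x, hx, rfl, h⟩ | ⟨x, y, h, rfl, rfl⟩
        · omega
        · omega
        · exact ⟨i' - k, j' - k, E.up_left_mem (by omega) (by omega) h, by omega, by omega⟩

section frame

variable {k : ℕ} {l m : ℕ → ℕ} {hl : Antitone l} {hm : Antitone m} {E : YoungDiagram}
    {h1 : ∀ j < k, E.colLen 0 + k ≤ l j} {h2 : ∀ j < k, E.rowLen 0 + k ≤ m j}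

theorem mem_frameDiagram {i j : ℕ} : (i, j) ∈ frameDiagram k l m hl hm E h1 h2 ↔
    (j < k ∧ i < l j) ∨ (i < k ∧ k ≤ j ∧ j < m i) ∨
      (k ≤ i ∧ k ≤ j ∧ (i - k, j - k) ∈ E) := by
  rw [← YoungDiagram.mem_cells]
  simp only [frameDiagram, Finset.mem_union, Finset.mem_biUnion,
      Finset.mem_range, Finset.mem_product, Finset.mem_singleton, Finset.mem_Ico,
      Finset.mem_image, YoungDiagram.mem_cells, Prod.mk.injEq, Prod.exists]
  refine or_congr ?_ (or_congr ?_ ?_)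
  · constructor
    · rintro ⟨x, hx, h, rfl⟩; exact ⟨hx, h⟩
    · rintro ⟨hx, h⟩; exact ⟨j, hx, h, rfl⟩
  · constructor
    · rintro ⟨x, hx, rfl, h⟩; exact ⟨hx, h⟩
    · rintro ⟨hx, h⟩; exact ⟨i, hx, rfl, h⟩
  · constructor
    · rintro ⟨x, y, h, rfl, rfl⟩; simpa using h
    · rintro ⟨hi, hj, h⟩; exact ⟨i - k, j - k, h, by omega, by omega⟩

theorem colLen_frameDiagram {j : ℕ} (hj : j < k) :
    (frameDiagram k l m hl hm E h1 h2).colLen j = l j :=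
  nat_eq_of_forall_lt_iff fun i => by
    rw [← YoungDiagram.mem_iff_lt_colLen, mem_frameDiagram]
    omega

theorem rowLen_frameDiagram {i : ℕ} (hi : i < k) :
    (frameDiagram k l m hl hm E h1 h2).rowLen i = m i :=
  nat_eq_of_forall_lt_iff fun j => by
    rw [← YoungDiagram.mem_iff_lt_rowLen, mem_frameDiagram]
    have h3 := h2 i hi
    by_cases hj : j < k
    · have h4 := h1 j hj
      omega
    · omega

theorem card_frameDiagram :
    (frameDiagram k l m hl hm E h1 h2).card + k * k =
      ∑ j ∈ Finset.range k, l j + ∑ j ∈ Finset.range k, m j + E.card := by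
  have e1 : ((Finset.range k).biUnion (fun j => Finset.range (l j) ×ˢ {j})).card =
      ∑ j ∈ Finset.range k, l j := by
    rw [Finset.card_biUnion]
    · simp
    · intro x _ y _ hxy
      simp only [Function.onFun, Finset.disjoint_left, Finset.mem_product, Finset.mem_singleton]
      rintro ⟨i, j⟩ h h'
      exact hxy (h.2.symm.trans h'.2)
  have e2 : ((Finset.range k).biUnion (fun i => {i} ×ˢ Finset.Ico k (m i))).card + k * k =
      ∑ j ∈ Finset.range k, m j := by
    rw [Finset.card_biUnion]
    · simp only [Finset.card_product, Finset.card_singleton, one_mul, Nat.card_Ico]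
      conv_lhs => rw [← Finset.card_range k, ← smul_eq_mul, Finset.card_range]
      have : k • k = ∑ j ∈ Finset.range k, k := by simp
      rw [this, ← Finset.sum_add_distrib]
      refine Finset.sum_congr rfl fun i hi => ?_
      have := h2 i (Finset.mem_range.1 hi)
      omega
    · intro x _ y _ hxy
      simp only [Function.onFun, Finset.disjoint_left, Finset.mem_product, Finset.mem_singleton]
      rintro ⟨i, j⟩ h h'
      exact hxy (h.1.symm.trans h'.1)
  have e3 : (E.cells.image (fun c => (c.1 + k, c.2 + k))).card = E.card := by
    rw [Finset.card_image_of_injective]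
    rintro ⟨x, y⟩ ⟨x', y'⟩ h
    simpa using h
  rw [YoungDiagram.card, frameDiagram, Finset.card_union_of_disjoint,
    Finset.card_union_of_disjoint, e1, e3]
  · omega
  · simp only [Finset.disjoint_left, Finset.mem_biUnion, Finset.mem_product,
      Finset.mem_singleton, Finset.mem_image, Finset.mem_range]
    rintro ⟨i, j⟩ ⟨x, hx, h, h'⟩ ⟨c, -, hc⟩
    simp only [Prod.mk.injEq] at hc h h'
    omega
  · simp only [Finset.disjoint_left, Finset.mem_biUnion, Finset.mem_product, Finset.mem_union,
      Finset.mem_singleton, Finset.mem_image, Finset.mem_range, Finset.mem_Ico]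
    rintro ⟨i, j⟩ ⟨x, hx, h, h'⟩ (⟨y, hy, h3, h4⟩ | ⟨c, -, hc⟩)
    · simp only at h3 h4 h h'
      omega
    · simp only [Prod.mk.injEq] at hc h h'
      omega

end frame

/-- Diagrams in a box give diagrams with prescribed first columns and rows. -/
theorem ncard_boxDiagrams_le {n k N a b : ℕ} {l m : ℕ → ℕ} (hl : Antitone l) (hm : Antitone m)
    (ha : ∀ j < k, a + k ≤ l j) (hb : ∀ j < k, b + k ≤ m j)
    (hn : n + k * k = ∑ j ∈ Finset.range k, l j + ∑ j ∈ Finset.range k, m j + N) :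
    (boxDiagrams a b N).ncard ≤
      {D : DiagramOfArea n | ∀ j < k, D.1.colLen j = l j ∧ D.1.rowLen j = m j}.ncard := by
  have hc : ∀ E : boxDiagrams a b N, ∀ j < k, E.1.colLen 0 + k ≤ l j := fun E j hj =>
    (Nat.add_le_add_right E.2.2.1 k).trans (ha j hj)
  have hr : ∀ E : boxDiagrams a b N, ∀ j < k, E.1.rowLen 0 + k ≤ m j := fun E j hj =>
    (Nat.add_le_add_right E.2.2.2 k).trans (hb j hj)
  let f : boxDiagrams a b N →
      {D : DiagramOfArea n | ∀ j < k, D.1.colLen j = l j ∧ D.1.rowLen j = m j} := fun E =>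
    ⟨⟨frameDiagram k l m hl hm E.1 (hc E) (hr E), by
      have h := card_frameDiagram (hl := hl) (hm := hm) (h1 := hc E) (h2 := hr E)
      have h' := E.2.1
      omega⟩, fun j hj =>
      ⟨colLen_frameDiagram (hl := hl) (hm := hm) (h1 := hc E) (h2 := hr E) hj,
        rowLen_frameDiagram (hl := hl) (hm := hm) (h1 := hc E) (h2 := hr E) hj⟩⟩
  rw [← Nat.card_coe_set_eq, ← Nat.card_coe_set_eq]
  refine Nat.card_le_card_of_injective f ?_
  intro E E' h
  have h3 : frameDiagram k l m hl hm E.1 (hc E) (hr E) =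
      frameDiagram k l m hl hm E'.1 (hc E') (hr E') := congrArg (fun x => x.1.1) h
  refine Subtype.ext (YoungDiagram.ext_mem fun ⟨i, j⟩ => ?_)
  have h4 : (i + k, j + k) ∈ frameDiagram k l m hl hm E.1 (hc E) (hr E) ↔
      (i + k, j + k) ∈ frameDiagram k l m hl hm E'.1 (hc E') (hr E') := by rw [h3]
  rw [mem_frameDiagram, mem_frameDiagram] at h4
  simpa using h4

theorem card_diagramOfArea (n : ℕ) : Nat.card (DiagramOfArea n) = (boxDiagrams n n n).ncard := by
  have : boxDiagrams n n n = {D : YoungDiagram | D.card = n} := by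
    ext D
    simp only [boxDiagrams, Set.mem_ofPred_eq, and_iff_left_iff_imp]
    intro h
    have h1 := colLen_le_card D 0
    have h2 := rowLen_le_card D 0
    omega
  rw [this, ← Nat.card_coe_set_eq]
  rfl

/-! ### The exponent of a geometric characteristic function -/

theorem norm_exp_mul_I_sub_one_le (u : ℝ) : ‖Complex.exp (u * Complex.I) - 1‖ ≤ |u| := by
  rw [mul_comm]
  exact Real.norm_exp_I_mul_ofReal_sub_one_le

theorem norm_image_le_of_norm_deriv_le_segment {f f' : ℝ → ℂ} {C u : ℝ} (h0 : f 0 = 0)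
    (hf : ∀ x, HasDerivAt f (f' x) x) (hC : ∀ x, |x| ≤ |u| → ‖f' x‖ ≤ C) : ‖f u‖ ≤ C * |u| := by
  have h := (convex_uIcc (0 : ℝ) u).norm_image_sub_le_of_norm_hasDerivWithin_le (f := f)
    (f' := f') (C := C) (x := 0) (y := u) (fun x _ => (hf x).hasDerivWithinAt) (fun x hx => hC x ?_)
    Set.left_mem_uIcc Set.right_mem_uIcc
  · simpa [h0] using h
  · have := Set.abs_sub_left_of_mem_uIcc hx
    simpa using this

theorem norm_exp_mul_I_sub_one_sub_le (u : ℝ) :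
    ‖Complex.exp (u * Complex.I) - 1 - u * Complex.I‖ ≤ |u| ^ 2 := by
  have h := norm_image_le_of_norm_deriv_le_segment (C := |u|) (u := u)
    (f := fun u : ℝ => Complex.exp (u * Complex.I) - 1 - u * Complex.I)
    (f' := fun u => Complex.exp (u * Complex.I) * (1 * Complex.I) - 1 * Complex.I) (by simp) ?_ ?_
  · rw [pow_two]; exact h
  · intro x
    have h1 : HasDerivAt (fun u : ℝ => (u : ℂ) * Complex.I) (1 * Complex.I) x :=
      (Complex.ofRealCLM.hasDerivAt (x := x)).mul_const Complex.I
    exact (h1.cexp.sub_const 1).sub h1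
  · intro x hx
    rw [one_mul, ← sub_one_mul, norm_mul]
    simpa using (norm_exp_mul_I_sub_one_le x).trans hx

theorem norm_exp_mul_I_sub_taylor_two_le (u : ℝ) :
    ‖Complex.exp (u * Complex.I) - 1 - u * Complex.I + u ^ 2 / 2‖ ≤ |u| ^ 3 := by
  have h := norm_image_le_of_norm_deriv_le_segment (C := |u| ^ 2) (u := u)
    (f := fun u : ℝ => Complex.exp (u * Complex.I) - 1 - u * Complex.I + (u : ℂ) ^ 2 / 2)
    (f' := fun u => Complex.exp (u * Complex.I) * (1 * Complex.I) - 1 * Complex.I +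
      (2 * (u : ℂ) ^ (2 - 1) * 1) / 2)
    (by simp) ?_ ?_
  · rw [pow_succ]; exact h
  · intro x
    have h0 : HasDerivAt (fun u : ℝ => (u : ℂ)) 1 x := Complex.ofRealCLM.hasDerivAt (x := x)
    have h1 : HasDerivAt (fun u : ℝ => (u : ℂ) * Complex.I) (1 * Complex.I) x :=
      h0.mul_const Complex.I
    exact ((h1.cexp.sub_const 1).sub h1).add ((h0.pow 2).div_const 2)
  · intro x hx
    have : Complex.exp (x * Complex.I) * (1 * Complex.I) - 1 * Complex.I +
      (2 * (x : ℂ) ^ (2 - 1) * 1) / 2 =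
        (Complex.exp (x * Complex.I) - 1 - x * Complex.I) * Complex.I := by
      have := Complex.I_mul_I
      simp only [Nat.add_one_sub_one, pow_one]
      linear_combination (x : ℂ) * this
    rw [this, norm_mul, Complex.norm_I, mul_one]
    exact (norm_exp_mul_I_sub_one_sub_le x).trans (pow_le_pow_left₀ (abs_nonneg _) hx 2)

theorem hasSum_of_pointwise_eq {α β : Type*} [AddCommMonoid α] [TopologicalSpace α] {f g : β → α}
    {a : α} (hf : HasSum f a) (h : ∀ b, f b = g b) : HasSum g a := by
  rwa [← funext h]

/-- The logarithm of the characteristic function of the geometric law with ratio `x`. -/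
noncomputable def geomExponent (x t : ℝ) : ℂ :=
  ∑' n : ℕ, ((x ^ (n + 1) / (n + 1) : ℝ) : ℂ) * (Complex.exp (((n + 1) * t : ℝ) * Complex.I) - 1)

section geomExponent

variable {x : ℝ}

theorem hasSum_geom_succ (h0 : 0 ≤ x) (h1 : x < 1) :
    HasSum (fun n : ℕ => x ^ (n + 1)) (x / (1 - x)) := by
  simpa [pow_succ, div_eq_mul_inv, mul_comm] using
    (hasSum_geometric_of_lt_one h0 h1).mul_right x

theorem hasSum_succ_mul_geom (h0 : 0 ≤ x) (h1 : x < 1) :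
    HasSum (fun n : ℕ => (n + 1 : ℝ) * x ^ (n + 1)) (x / (1 - x) ^ 2) := by
  have h := hasSum_choose_mul_geometric_of_norm_lt_one 1
    (r := x) (by rwa [Real.norm_of_nonneg h0])
  have h := h.mul_right x
  simp only [Nat.choose_one_right] at h
  rw [show x / (1 - x) ^ 2 = 1 / (1 - x) ^ (1 + 1) * x by norm_num; ring]
  refine hasSum_of_pointwise_eq h fun n => ?_
  push_cast
  ring

theorem hasSum_succ_mul_succ_mul_geom (h0 : 0 ≤ x) (h1 : x < 1) :
    HasSum (fun n : ℕ => ((n + 1) * (n + 2) : ℝ) * x ^ (n + 1)) (2 * x / (1 - x) ^ 3) := by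
  have h := hasSum_choose_mul_geometric_of_norm_lt_one 2
    (r := x) (by rwa [Real.norm_of_nonneg h0])
  have h := h.mul_right (2 * x)
  rw [show 2 * x / (1 - x) ^ 3 = 1 / (1 - x) ^ (2 + 1) * (2 * x) by norm_num; ring]
  refine hasSum_of_pointwise_eq h fun n => ?_
  rw [Nat.cast_choose_two]
  push_cast
  ring

theorem norm_geom_coeff (h0 : 0 ≤ x) (n : ℕ) :
    ‖((x ^ (n + 1) / (n + 1) : ℝ) : ℂ)‖ = x ^ (n + 1) / (n + 1) := by
  rw [Complex.norm_real, Real.norm_of_nonneg (by positivity)]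

theorem norm_exp_mul_I_sub_one_le_two (u : ℝ) : ‖Complex.exp (u * Complex.I) - 1‖ ≤ 2 := by
  refine (norm_sub_le _ _).trans ?_
  rw [Complex.norm_exp_ofReal_mul_I]
  norm_num

theorem norm_geomExponent_term_le_two (h0 : 0 ≤ x) (t : ℝ) (n : ℕ) :
    ‖((x ^ (n + 1) / (n + 1) : ℝ) : ℂ) * (Complex.exp (((n + 1) * t : ℝ) * Complex.I) - 1)‖ ≤
      x ^ (n + 1) * 2 := by
  rw [norm_mul, norm_geom_coeff h0]
  refine mul_le_mul ?_ (norm_exp_mul_I_sub_one_le_two _) (norm_nonneg _) (by positivity)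
  exact div_le_self (by positivity) (by linarith [(Nat.cast_nonneg n : (0 : ℝ) ≤ n)])

theorem summable_geomExponent (h0 : 0 ≤ x) (h1 : x < 1) (t : ℝ) :
    Summable fun n : ℕ =>
      ((x ^ (n + 1) / (n + 1) : ℝ) : ℂ) * (Complex.exp (((n + 1) * t : ℝ) * Complex.I) - 1) :=
  Summable.of_norm_bounded ((hasSum_geom_succ h0 h1).summable.mul_right 2)
    (norm_geomExponent_term_le_two h0 t)

theorem norm_geomExponent_le_two (h0 : 0 ≤ x) (h1 : x < 1) (t : ℝ) :
    ‖geomExponent x t‖ ≤ 2 * (x / (1 - x)) := by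
  rw [mul_comm]
  exact tsum_of_norm_bounded ((hasSum_geom_succ h0 h1).mul_right 2)
    (norm_geomExponent_term_le_two h0 t)

theorem norm_geomExponent_le (h0 : 0 ≤ x) (h1 : x < 1) (t : ℝ) :
    ‖geomExponent x t‖ ≤ |t| * (x / (1 - x)) := by
  rw [mul_comm]
  refine tsum_of_norm_bounded ((hasSum_geom_succ h0 h1).mul_right |t|) fun n => ?_
  rw [norm_mul, norm_geom_coeff h0]
  refine (mul_le_mul_of_nonneg_left (norm_exp_mul_I_sub_one_le _) (by positivity)).trans_eq ?_
  rw [abs_mul, abs_of_nonneg (by positivity : (0 : ℝ) ≤ n + 1)]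
  field_simp

theorem hasSum_geomExponent (h0 : 0 ≤ x) (h1 : x < 1) (t : ℝ) :
    HasSum (fun n : ℕ => ((x ^ (n + 1) / (n + 1) : ℝ) : ℂ) *
      (Complex.exp (((n + 1) * t : ℝ) * Complex.I) - 1)) (geomExponent x t) :=
  (summable_geomExponent h0 h1 t).hasSum

theorem hasSum_geom_linear (h0 : 0 ≤ x) (h1 : x < 1) (t : ℝ) :
    HasSum (fun n : ℕ => ((x ^ (n + 1) / (n + 1) : ℝ) : ℂ) *
      (((n + 1) * t : ℝ) * Complex.I)) ((t * (x / (1 - x)) : ℝ) * Complex.I) := by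
  have h := (Complex.hasSum_ofReal.2 ((hasSum_geom_succ h0 h1).mul_left t)).mul_right Complex.I
  refine hasSum_of_pointwise_eq h fun n => ?_
  rw [← mul_assoc, ← Complex.ofReal_mul]
  congr 2
  field_simp

theorem hasSum_geom_quadratic (h0 : 0 ≤ x) (h1 : x < 1) (t : ℝ) :
    HasSum (fun n : ℕ => ((x ^ (n + 1) / (n + 1) : ℝ) : ℂ) *
      ((((n + 1) * t : ℝ) : ℂ) ^ 2 / 2)) ((t ^ 2 / 2 * (x / (1 - x) ^ 2) : ℝ) : ℂ) := by
  have h := Complex.hasSum_ofReal.2 ((hasSum_succ_mul_geom h0 h1).mul_left (t ^ 2 / 2))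
  refine hasSum_of_pointwise_eq h fun n => ?_
  have : ((n : ℝ) + 1) ≠ 0 := by positivity
  rw [show (((x ^ (n + 1) / (n + 1) : ℝ) : ℂ) * ((((n + 1) * t : ℝ) : ℂ) ^ 2 / 2)) =
    ((x ^ (n + 1) / (n + 1) * (((n + 1) * t) ^ 2 / 2) : ℝ) : ℂ) by push_cast; ring]
  congr 1
  field_simp

theorem norm_geomExponent_sub_linear_le (h0 : 0 ≤ x) (h1 : x < 1) (t : ℝ) :
    ‖geomExponent x t - (t * (x / (1 - x)) : ℝ) * Complex.I‖ ≤ t ^ 2 * (x / (1 - x) ^ 2) := by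
  rw [← ((hasSum_geomExponent h0 h1 t).sub (hasSum_geom_linear h0 h1 t)).tsum_eq]
  refine tsum_of_norm_bounded ((hasSum_succ_mul_geom h0 h1).mul_left (t ^ 2)) fun n => ?_
  rw [← mul_sub, norm_mul, norm_geom_coeff h0]
  refine (mul_le_mul_of_nonneg_left (norm_exp_mul_I_sub_one_sub_le _) (by positivity)).trans_eq ?_
  rw [sq_abs]
  field_simp

theorem norm_geomExponent_sub_quadratic_le (h0 : 0 ≤ x) (h1 : x < 1) (t : ℝ) :
    ‖geomExponent x t - (t * (x / (1 - x)) : ℝ) * Complex.I +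
      ((t ^ 2 / 2 * (x / (1 - x) ^ 2) : ℝ) : ℂ)‖ ≤ |t| ^ 3 * (2 * x / (1 - x) ^ 3) := by
  rw [← (((hasSum_geomExponent h0 h1 t).sub (hasSum_geom_linear h0 h1 t)).add
    (hasSum_geom_quadratic h0 h1 t)).tsum_eq]
  refine tsum_of_norm_bounded ((hasSum_succ_mul_succ_mul_geom h0 h1).mul_left (|t| ^ 3))
    fun n => ?_
  rw [← mul_sub, ← mul_add, norm_mul, norm_geom_coeff h0]
  refine (mul_le_mul_of_nonneg_left (norm_exp_mul_I_sub_taylor_two_le _) (by positivity)).trans ?_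
  rw [abs_mul, abs_of_nonneg (by positivity : (0 : ℝ) ≤ n + 1)]
  rw [show x ^ (n + 1) / (n + 1 : ℝ) * ((n + 1) * |t|) ^ 3 =
    |t| ^ 3 * (((n + 1) * (n + 1)) * x ^ (n + 1)) by field_simp]
  gcongr
  norm_num

theorem re_geomExponent_le (h0 : 0 ≤ x) (h1 : x < 1) (t : ℝ) :
    (geomExponent x t).re ≤ x * (Real.cos t - 1) := by
  have h := Complex.hasSum_re (hasSum_geomExponent h0 h1 t)
  have hre : ∀ n : ℕ, (((x ^ (n + 1) / (n + 1) : ℝ) : ℂ) *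
      (Complex.exp (((n + 1) * t : ℝ) * Complex.I) - 1)).re =
      x ^ (n + 1) / (n + 1) * (Real.cos ((n + 1) * t) - 1) := fun n => by
    rw [Complex.re_ofReal_mul, Complex.sub_re, Complex.exp_ofReal_mul_I_re, Complex.one_re]
  simp only [hre] at h
  have h2 := hasSum_le (g := fun n : ℕ => if n = 0 then x * (Real.cos t - 1) else 0)
    (fun n => ?_) h (hasSum_ite_eq 0 _)
  · exact h2
  · rcases n with _ | n
    · simp
    · simp only [Nat.add_eq_zero_iff, one_ne_zero, and_false, if_false]
      exact mul_nonpos_of_nonneg_of_nonpos (by positivity)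
        (by linarith [Real.cos_le_one (((n + 1 : ℕ) + 1 : ℝ) * t)])

theorem re_geomExponent_nonpos (h0 : 0 ≤ x) (h1 : x < 1) (t : ℝ) :
    (geomExponent x t).re ≤ 0 :=
  (re_geomExponent_le h0 h1 t).trans (mul_nonpos_of_nonneg_of_nonpos h0
    (by linarith [Real.cos_le_one t]))

theorem norm_mul_exp_lt_one (h0 : 0 ≤ x) (h1 : x < 1) (t : ℝ) :
    ‖(x : ℂ) * Complex.exp (t * Complex.I)‖ < 1 := by
  rwa [norm_mul, Complex.norm_exp_ofReal_mul_I, mul_one, Complex.norm_real,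
    Real.norm_of_nonneg h0]

theorem hasSum_neg_log_succ {z : ℂ} (hz : ‖z‖ < 1) :
    HasSum (fun n : ℕ => z ^ (n + 1) / (n + 1)) (-Complex.log (1 - z)) := by
  have h := (hasSum_nat_add_iff' 1).2 (Complex.hasSum_taylorSeries_neg_log hz)
  simpa using h

theorem geomExponent_eq (h0 : 0 ≤ x) (h1 : x < 1) (t : ℝ) :
    geomExponent x t = Complex.log (1 - x) -
      Complex.log (1 - x * Complex.exp (t * Complex.I)) := by
  have hx : ‖(x : ℂ)‖ < 1 := by rwa [Complex.norm_real, Real.norm_of_nonneg h0]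
  have h2 := (hasSum_neg_log_succ (norm_mul_exp_lt_one h0 h1 t)).sub (hasSum_neg_log_succ hx)
  rw [geomExponent, show Complex.log (1 - x) -
      Complex.log (1 - x * Complex.exp (t * Complex.I)) =
      -Complex.log (1 - x * Complex.exp (t * Complex.I)) - -Complex.log (1 - x) by ring,
    ← h2.tsum_eq]
  refine tsum_congr fun n => ?_
  have : Complex.exp (((n + 1) * t : ℝ) * Complex.I) = Complex.exp (t * Complex.I) ^ (n + 1) := by
    rw [← Complex.exp_nat_mul]; push_cast; ring_nf
  rw [this]
  push_cast
  ring

theorem one_sub_ne_zero_of_norm_lt {z : ℂ} (hz : ‖z‖ < 1) : 1 - z ≠ 0 := by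
  intro h
  rw [← sub_eq_zero.1 h] at hz
  simp at hz

theorem exp_geomExponent (h0 : 0 ≤ x) (h1 : x < 1) (t : ℝ) :
    Complex.exp (geomExponent x t) = (1 - x) / (1 - x * Complex.exp (t * Complex.I)) := by
  have hx : ‖(x : ℂ)‖ < 1 := by rwa [Complex.norm_real, Real.norm_of_nonneg h0]
  rw [geomExponent_eq h0 h1, Complex.exp_sub, Complex.exp_log (one_sub_ne_zero_of_norm_lt hx),
    Complex.exp_log (one_sub_ne_zero_of_norm_lt (norm_mul_exp_lt_one h0 h1 t))]

theorem continuous_geomExponent (h0 : 0 ≤ x) (h1 : x < 1) : Continuous (geomExponent x) := by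
  unfold geomExponent
  exact continuous_tsum (fun n => by fun_prop) ((hasSum_geom_succ h0 h1).summable.mul_right 2)
    (fun n t => norm_geomExponent_term_le_two h0 t n)

end geomExponent

/-! ### Moment sums -/

/-- The weights `q ^ i` with `q = exp (-τ)`. -/
noncomputable def expWeight (τ : ℝ) (i : ℕ) : ℝ := Real.exp (-(τ * i))

theorem expWeight_pos (τ : ℝ) (i : ℕ) : 0 < expWeight τ i := Real.exp_pos _

theorem expWeight_nonneg (τ : ℝ) (i : ℕ) : 0 ≤ expWeight τ i := (expWeight_pos τ i).le

theorem expWeight_add (τ : ℝ) (i j : ℕ) :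
    expWeight τ (i + j) = expWeight τ i * expWeight τ j := by
  rw [expWeight, expWeight, expWeight, ← Real.exp_add]; push_cast; ring_nf

theorem expWeight_eq_pow (τ : ℝ) (i : ℕ) : expWeight τ i = Real.exp (-τ) ^ i := by
  rw [expWeight, ← Real.exp_nat_mul]; ring_nf

theorem expWeight_pow (τ : ℝ) (i m : ℕ) : expWeight τ i ^ m = expWeight τ (i * m) := by
  rw [expWeight_eq_pow, expWeight_eq_pow, pow_mul]

theorem expWeight_anti {τ : ℝ} (hτ : 0 ≤ τ) {i j : ℕ} (h : i ≤ j) :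
    expWeight τ j ≤ expWeight τ i := by
  refine Real.exp_le_exp.2 (neg_le_neg (mul_le_mul_of_nonneg_left ?_ hτ))
  exact_mod_cast h

theorem expWeight_lt_one {τ : ℝ} (hτ : 0 < τ) {i : ℕ} (hi : 0 < i) : expWeight τ i < 1 :=
  Real.exp_lt_one_iff.2 (by
    have : (0 : ℝ) < i := by exact_mod_cast hi
    have := mul_pos hτ this
    linarith)

theorem hasSum_expWeight_succ {τ : ℝ} (hτ : 0 < τ) :
    HasSum (fun l : ℕ => expWeight τ (l + 1)) (1 / (Real.exp τ - 1)) := by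
  have h := hasSum_geom_succ (Real.exp_pos (-τ)).le (Real.exp_lt_one_iff.2 (by linarith : -τ < 0))
  have e : Real.exp (-τ) / (1 - Real.exp (-τ)) = 1 / (Real.exp τ - 1) := by
    have h1 : Real.exp τ - 1 ≠ 0 := by
      have := Real.add_one_lt_exp hτ.ne'
      linarith
    rw [Real.exp_neg]
    have h2 := (Real.exp_pos τ).ne'
    field_simp
  rw [← e]
  exact hasSum_of_pointwise_eq h fun l => (expWeight_eq_pow τ (l + 1)).symm

theorem one_div_exp_sub_one_le {τ : ℝ} (hτ : 0 < τ) : 1 / (Real.exp τ - 1) ≤ 1 / τ :=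
  one_div_le_one_div_of_le hτ (by linarith [Real.add_one_le_exp τ])

theorem inv_one_sub_exp_neg_le {y : ℝ} (hy : 0 < y) : 1 / (1 - Real.exp (-y)) ≤ (1 + y) / y := by
  have h1 : Real.exp (-y) < 1 := Real.exp_lt_one_iff.2 (by linarith)
  rw [div_le_div_iff₀ (by linarith) hy]
  have h3 : Real.exp (-y) * (1 + y) ≤ 1 := by
    have h2 := Real.add_one_le_exp y
    calc Real.exp (-y) * (1 + y) ≤ Real.exp (-y) * Real.exp y := by
          gcongr; linarith
      _ = 1 := by rw [← Real.exp_add]; simp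
  linarith

theorem one_add_pow_three_le {y : ℝ} (hy : 0 ≤ y) : (1 + y) ^ 3 ≤ 512 * Real.exp (y / 2) := by
  have h1 : 1 + y ≤ 8 * Real.exp (y / 8) := by
    have := Real.add_one_le_exp (y / 8)
    linarith
  calc (1 + y) ^ 3 ≤ (8 * Real.exp (y / 8)) ^ 3 := pow_le_pow_left₀ (by linarith) h1 3
    _ = 512 * Real.exp (3 * y / 8) := by
      rw [mul_pow, ← Real.exp_nat_mul]; norm_num; ring_nf
    _ ≤ 512 * Real.exp (y / 2) :=
      mul_le_mul_of_nonneg_left (Real.exp_le_exp.2 (by linarith)) (by norm_num)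

/-- Pointwise bound behind all moment estimates. -/
theorem tail_moment_term_le {τ : ℝ} (hτ : 0 < τ) (a l j : ℕ) (hj : j ≤ 3) :
    (a + l + 1 : ℕ) ^ j * (expWeight τ (a + l + 1) / (1 - expWeight τ (a + l + 1)) ^ j) ≤
      512 * (expWeight τ a * (1 + a * τ) ^ j / τ ^ j) * expWeight (τ / 2) (l + 1) := by
  set X := expWeight τ (a + l + 1) with hX
  have hX1 : X < 1 := expWeight_lt_one hτ (by omega)
  have hi : (0 : ℝ) < (a + l + 1 : ℕ) := by positivity
  have h1 : ((a + l + 1 : ℕ) : ℝ) / (1 - X) ≤ (1 + a * τ) * (1 + (l + 1) * τ) / τ := by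
    have h := inv_one_sub_exp_neg_le (mul_pos hτ hi)
    change 1 / (1 - X) ≤ _ at h
    have h2 := mul_le_mul_of_nonneg_left h hi.le
    rw [mul_one_div] at h2
    refine h2.trans ?_
    rw [show ((a + l + 1 : ℕ) : ℝ) * ((1 + τ * (a + l + 1 : ℕ)) / (τ * (a + l + 1 : ℕ))) =
      (1 + τ * (a + l + 1 : ℕ)) / τ by field_simp]
    gcongr
    push_cast
    have : 0 ≤ (a * τ) * ((l + 1) * τ) := by positivity
    nlinarith
  have h2 : (1 + (l + 1) * τ) ^ j ≤ 512 * Real.exp ((l + 1) * τ / 2) :=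
    (pow_le_pow_right₀ (by nlinarith [(Nat.cast_nonneg l : (0 : ℝ) ≤ l)]) hj).trans
      (one_add_pow_three_le (by positivity))
  have h3 : expWeight τ (l + 1) * Real.exp ((l + 1) * τ / 2) = expWeight (τ / 2) (l + 1) := by
    rw [expWeight, expWeight, ← Real.exp_add]; push_cast; ring_nf
  calc ((a + l + 1 : ℕ) : ℝ) ^ j * (X / (1 - X) ^ j)
      = (((a + l + 1 : ℕ) : ℝ) / (1 - X)) ^ j * X := by rw [div_pow]; ring
    _ ≤ ((1 + a * τ) * (1 + (l + 1) * τ) / τ) ^ j * X := by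
        refine mul_le_mul_of_nonneg_right (pow_le_pow_left₀ ?_ h1 j) (expWeight_nonneg _ _)
        exact div_nonneg hi.le (by linarith)
    _ = ((1 + a * τ) ^ j / τ ^ j * expWeight τ a) *
          (expWeight τ (l + 1) * (1 + (l + 1) * τ) ^ j) := by
        rw [hX, add_assoc, expWeight_add, div_pow, mul_pow]; ring
    _ ≤ ((1 + a * τ) ^ j / τ ^ j * expWeight τ a) *
          (expWeight τ (l + 1) * (512 * Real.exp ((l + 1) * τ / 2))) := by
        have := expWeight_nonneg τ a
        have := expWeight_nonneg τ (l + 1)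
        gcongr
    _ = _ := by rw [← h3]; ring

theorem summable_tail_moment {τ : ℝ} (hτ : 0 < τ) (a j : ℕ) (hj : j ≤ 3) :
    Summable fun l : ℕ =>
      ((a + l + 1 : ℕ) : ℝ) ^ j * (expWeight τ (a + l + 1) / (1 - expWeight τ (a + l + 1)) ^ j) :=
  Summable.of_nonneg_of_le (fun l => by
      have := expWeight_nonneg τ (a + l + 1)
      have := expWeight_lt_one hτ (i := a + l + 1) (by omega)
      have : 0 ≤ 1 - expWeight τ (a + l + 1) := by linarith
      positivity)
    (fun l => tail_moment_term_le hτ a l j hj)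
    ((hasSum_expWeight_succ (half_pos hτ)).summable.mul_left _)

/-- The `j`-th moment sum over indices larger than `a`. -/
noncomputable def tailMoment (τ : ℝ) (a j : ℕ) : ℝ :=
  ∑' l : ℕ, ((a + l + 1 : ℕ) : ℝ) ^ j *
    (expWeight τ (a + l + 1) / (1 - expWeight τ (a + l + 1)) ^ j)

theorem hasSum_tailMoment {τ : ℝ} (hτ : 0 < τ) (a j : ℕ) (hj : j ≤ 3) :
    HasSum (fun l : ℕ => ((a + l + 1 : ℕ) : ℝ) ^ j *
      (expWeight τ (a + l + 1) / (1 - expWeight τ (a + l + 1)) ^ j)) (tailMoment τ a j) :=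
  (summable_tail_moment hτ a j hj).hasSum

theorem tailMoment_nonneg {τ : ℝ} (hτ : 0 < τ) (a j : ℕ) : 0 ≤ tailMoment τ a j :=
  tsum_nonneg fun l => by
    have := expWeight_nonneg τ (a + l + 1)
    have := expWeight_lt_one hτ (i := a + l + 1) (by omega)
    have : 0 ≤ 1 - expWeight τ (a + l + 1) := by linarith
    positivity

theorem tailMoment_le {τ : ℝ} (hτ : 0 < τ) (a j : ℕ) (hj : j ≤ 3) :
    tailMoment τ a j ≤ 1024 * (expWeight τ a / τ * (1 + a * τ) ^ j / τ ^ j) := by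
  have h := hasSum_le (fun l => tail_moment_term_le hτ a l j hj) (hasSum_tailMoment hτ a j hj)
    ((hasSum_expWeight_succ (half_pos hτ)).mul_left _)
  refine h.trans ((mul_le_mul_of_nonneg_left (one_div_exp_sub_one_le (half_pos hτ)) ?_).trans_eq ?_)
  · have := expWeight_nonneg τ a
    positivity
  · field_simp
    ring

theorem hasSum_expWeight_tail {τ : ℝ} (hτ : 0 < τ) (a : ℕ) :
    HasSum (fun l : ℕ => expWeight τ (a + l + 1)) (expWeight τ a * (1 / (Real.exp τ - 1))) := by
  refine hasSum_of_pointwise_eq ((hasSum_expWeight_succ hτ).mul_left (expWeight τ a)) fun l => ?_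
  rw [add_assoc, expWeight_add τ a (l + 1)]

theorem tail_ratio_term_le {τ : ℝ} (hτ : 0 < τ) {a : ℕ} (ha : expWeight τ a < 1) (l : ℕ) :
    expWeight τ (a + l + 1) / (1 - expWeight τ (a + l + 1)) ≤
      expWeight τ (a + l + 1) * (1 / (1 - expWeight τ a)) := by
  rw [div_eq_mul_one_div]
  have h := expWeight_anti hτ.le (show a ≤ a + l + 1 by omega)
  refine mul_le_mul_of_nonneg_left ?_ (expWeight_nonneg _ _)
  exact one_div_le_one_div_of_le (by linarith) (by linarith)

theorem summable_ratio {τ : ℝ} (hτ : 0 < τ) (a : ℕ) :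
    Summable fun l : ℕ => expWeight τ (a + l + 1) / (1 - expWeight τ (a + l + 1)) := by
  refine Summable.of_nonneg_of_le (fun l => ?_) (fun l => ?_)
    ((hasSum_expWeight_tail hτ a).summable.mul_right (1 / (1 - expWeight τ 1)))
  · have := expWeight_lt_one hτ (i := a + l + 1) (by omega)
    exact div_nonneg (expWeight_nonneg _ _) (by linarith)
  · rw [div_eq_mul_one_div]
    have h := expWeight_anti hτ.le (show 1 ≤ a + l + 1 by omega)
    have h1 := expWeight_lt_one hτ (i := 1) (by omega)
    refine mul_le_mul_of_nonneg_left ?_ (expWeight_nonneg _ _)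
    exact one_div_le_one_div_of_le (by linarith) (by linarith)

theorem tsum_tail_ratio_le {τ : ℝ} (hτ : 0 < τ) {a : ℕ} (ha : expWeight τ a < 1) :
    ∑' l : ℕ, expWeight τ (a + l + 1) / (1 - expWeight τ (a + l + 1)) ≤
      expWeight τ a / τ * (1 / (1 - expWeight τ a)) := by
  have h := hasSum_le (tail_ratio_term_le hτ ha) (summable_ratio hτ a).hasSum
    ((hasSum_expWeight_tail hτ a).mul_right _)
  refine h.trans (mul_le_mul_of_nonneg_right ?_ (by
    have : 0 < 1 - expWeight τ a := by linarith
    positivity))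
  rw [div_eq_mul_one_div (expWeight τ a) τ]
  exact mul_le_mul_of_nonneg_left (one_div_exp_sub_one_le hτ) (expWeight_nonneg _ _)

/-! ### The mean -/

theorem exp_neg_div_eq (y : ℝ) :
    Real.exp (-y) / (1 - Real.exp (-y)) ^ 2 = 1 / (2 * Real.sinh (y / 2)) ^ 2 := by
  have h1 : 2 * Real.sinh (y / 2) = Real.exp (y / 2) * (1 - Real.exp (-y)) := by
    rw [Real.sinh_eq, mul_sub, ← Real.exp_add]; ring_nf
  have h2 : Real.exp (-y) = (Real.exp (y / 2) ^ 2)⁻¹ := by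
    rw [← Real.exp_nat_mul, ← Real.exp_neg]; push_cast; ring_nf
  rw [h1, mul_pow, div_eq_mul_inv, one_div, mul_inv]
  congr 1

theorem exp_neg_div_le {y : ℝ} (hy : 0 < y) :
    Real.exp (-y) / (1 - Real.exp (-y)) ^ 2 ≤ 1 / y ^ 2 := by
  rw [exp_neg_div_eq y]
  have h := Real.self_le_sinh_iff.2 (half_pos hy).le
  exact one_div_le_one_div_of_le (by positivity) (pow_le_pow_left₀ hy.le (by linarith) 2)

theorem le_exp_neg_div {y : ℝ} (hy : 0 < y) :
    1 / y ^ 2 - 4 / (1 + y) ^ 2 ≤ Real.exp (-y) / (1 - Real.exp (-y)) ^ 2 := by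
  rcases le_or_gt 1 y with h1 | h1
  · have h2 : 1 / y ^ 2 ≤ 4 / (1 + y) ^ 2 := by
      rw [div_le_div_iff₀ (by positivity) (by positivity)]
      nlinarith
    have h3 : 0 ≤ Real.exp (-y) / (1 - Real.exp (-y)) ^ 2 := by positivity
    linarith
  · rw [exp_neg_div_eq y]
    have h4 : 1 ≤ 4 / (1 + y) ^ 2 := by
      rw [one_le_div (by positivity)]
      nlinarith
    have hs : (2 * Real.sinh (y / 2)) ^ 2 = 2 * Real.cosh y - 2 := by
      have h := Real.cosh_two_mul (y / 2)
      have h' := Real.cosh_sq (y / 2)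
      rw [mul_div_cancel₀ y two_ne_zero] at h
      rw [h, h']; ring
    have ht : 0 < 1 - y ^ 2 / 2 := by nlinarith
    have hc : Real.cosh y ≤ 1 / (1 - y ^ 2 / 2) := by
      refine (Real.cosh_le_exp_half_sq y).trans ?_
      rw [le_div_iff₀ ht]
      have := Real.one_sub_le_exp_neg (y ^ 2 / 2)
      calc _ ≤ Real.exp (y ^ 2 / 2) * Real.exp (-(y ^ 2 / 2)) := by gcongr
        _ = 1 := by rw [← Real.exp_add]; simp
    have hu : (2 * Real.sinh (y / 2)) ^ 2 ≤ y ^ 2 / (1 - y ^ 2 / 2) := by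
      rw [hs]
      have : y ^ 2 / (1 - y ^ 2 / 2) = 2 * (1 / (1 - y ^ 2 / 2)) - 2 := by
        have : 2 - y ^ 2 ≠ 0 := by linarith
        field_simp; ring
      linarith
    have hpos : 0 < (2 * Real.sinh (y / 2)) ^ 2 := by
      have := Real.sinh_pos_iff.2 (half_pos hy)
      positivity
    have h5 : (1 - y ^ 2 / 2) / y ^ 2 ≤ 1 / (2 * Real.sinh (y / 2)) ^ 2 := by
      rw [div_le_div_iff₀ (by positivity) hpos]
      rw [le_div_iff₀ ht] at hu
      linarith
    have h6 : (1 - y ^ 2 / 2) / y ^ 2 = 1 / y ^ 2 - 1 / 2 := by field_simp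
    linarith

theorem sum_range_inv_sq_le {τ : ℝ} (hτ : 0 < τ) (N : ℕ) :
    ∑ l ∈ Finset.range N, 4 / (1 + τ * (l + 1 : ℕ)) ^ 2 ≤ 4 / τ * (1 - 1 / (1 + τ * N)) := by
  induction N with
  | zero => simp
  | succ N ih =>
    rw [Finset.sum_range_succ]
    have h : 4 / (1 + τ * (N + 1 : ℕ)) ^ 2 ≤
        4 / τ * (1 / (1 + τ * N) - 1 / (1 + τ * (N + 1 : ℕ))) := by
      have e : 4 / τ * (1 / (1 + τ * N) - 1 / (1 + τ * (N + 1 : ℕ))) =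
          4 / ((1 + τ * N) * (1 + τ * (N + 1 : ℕ))) := by
        push_cast
        field_simp
        ring
      rw [e, pow_two]
      gcongr
      linarith
    linarith

theorem tsum_expWeight_div_bounds {τ : ℝ} (hτ : 0 < τ) :
    Summable (fun l : ℕ => expWeight τ (l + 1) / (1 - expWeight τ (l + 1)) ^ 2) ∧
    |∑' l : ℕ, expWeight τ (l + 1) / (1 - expWeight τ (l + 1)) ^ 2 -
      Real.pi ^ 2 / 6 / τ ^ 2| ≤ 4 / τ := by
  have hz : HasSum (fun l : ℕ => 1 / (τ * (l + 1 : ℕ)) ^ 2) (Real.pi ^ 2 / 6 / τ ^ 2) := by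
    have h := (hasSum_nat_add_iff' 1).2 hasSum_zeta_two
    simp only [Finset.range_one, Finset.sum_singleton, CharP.cast_eq_zero, ne_eq,
      OfNat.ofNat_ne_zero, not_false_eq_true, zero_pow, div_zero, sub_zero] at h
    refine hasSum_of_pointwise_eq (h.div_const (τ ^ 2)) fun l => ?_
    field_simp
  have hpos : ∀ l : ℕ, 0 < τ * (l + 1 : ℕ) := fun l => by positivity
  have hup : ∀ l : ℕ, expWeight τ (l + 1) / (1 - expWeight τ (l + 1)) ^ 2 ≤
      1 / (τ * (l + 1 : ℕ)) ^ 2 := fun l => exp_neg_div_le (hpos l)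
  have hnn : ∀ l : ℕ, 0 ≤ expWeight τ (l + 1) / (1 - expWeight τ (l + 1)) ^ 2 := fun l =>
    div_nonneg (expWeight_nonneg _ _) (sq_nonneg _)
  have hs := Summable.of_nonneg_of_le hnn hup hz.summable
  refine ⟨hs, ?_⟩
  have h1 := hasSum_le hup hs.hasSum hz
  have h2 : Real.pi ^ 2 / 6 / τ ^ 2 -
      ∑' l : ℕ, expWeight τ (l + 1) / (1 - expWeight τ (l + 1)) ^ 2 ≤ 4 / τ := by
    rw [← (hz.sub hs.hasSum).tsum_eq]
    refine Real.tsum_le_of_sum_range_le (fun l => sub_nonneg.2 (hup l)) fun N => ?_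
    refine (Finset.sum_le_sum fun l _ => ?_).trans ((sum_range_inv_sq_le hτ N).trans ?_)
    · have := le_exp_neg_div (hpos l)
      simp only [expWeight]
      linarith
    · refine mul_le_of_le_one_right (by positivity) ?_
      have : 0 ≤ 1 / (1 + τ * N) := by positivity
      linarith
  rw [abs_le]
  have : 0 < 4 / τ := by positivity
  constructor <;> linarith

theorem tailMoment_zero_one_eq {τ : ℝ} (hτ : 0 < τ) :
    tailMoment τ 0 1 = ∑' l : ℕ, expWeight τ (l + 1) / (1 - expWeight τ (l + 1)) ^ 2 := by
  have hi : ∀ i : ℕ, HasSum (fun m : ℕ => ((i + 1 : ℕ) : ℝ) * expWeight τ ((i + 1) * (m + 1)))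
      (((0 + i + 1 : ℕ) : ℝ) ^ 1 *
        (expWeight τ (0 + i + 1) / (1 - expWeight τ (0 + i + 1)) ^ 1)) := fun i => by
    have h := (hasSum_geom_succ (expWeight_nonneg τ (i + 1))
      (expWeight_lt_one hτ (by omega))).mul_left ((i + 1 : ℕ) : ℝ)
    simp only [expWeight_pow] at h
    simpa using h
  have hm : ∀ m : ℕ, HasSum (fun i : ℕ => ((i + 1 : ℕ) : ℝ) * expWeight τ ((i + 1) * (m + 1)))
      (expWeight τ (m + 1) / (1 - expWeight τ (m + 1)) ^ 2) := fun m => by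
    have h := hasSum_succ_mul_geom (expWeight_nonneg τ (m + 1)) (expWeight_lt_one hτ (by omega))
    simp only [expWeight_pow] at h
    refine hasSum_of_pointwise_eq h fun i => ?_
    rw [mul_comm (m + 1)]
    push_cast
    ring
  have hs : Summable (Function.uncurry fun i m : ℕ =>
      ((i + 1 : ℕ) : ℝ) * expWeight τ ((i + 1) * (m + 1))) := by
    rw [summable_prod_of_nonneg]
    · refine ⟨fun i => (hi i).summable, ?_⟩
      simp only [Function.uncurry_apply_pair, (hi _).tsum_eq]
      exact summable_tail_moment hτ 0 1 (by omega)
    · rintro ⟨i, m⟩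
      exact mul_nonneg (Nat.cast_nonneg _) (expWeight_nonneg _ _)
  rw [tailMoment, ← tsum_congr fun i => (hi i).tsum_eq, ← tsum_congr fun m => (hm m).tsum_eq]
  exact hs.tsum_comm.symm

theorem abs_mean_sub_le {τ : ℝ} (hτ : 0 < τ) :
    |tailMoment τ 0 1 - Real.pi ^ 2 / 6 / τ ^ 2| ≤ 4 / τ := by
  rw [tailMoment_zero_one_eq hτ]
  exact (tsum_expWeight_div_bounds hτ).2

/-! ### Decay of the characteristic function -/

theorem sum_range_succ_sq_ge (L : ℕ) :
    (L : ℝ) ^ 3 / 3 ≤ ∑ l ∈ Finset.range L, ((l + 1 : ℕ) : ℝ) ^ 2 := by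
  induction L with
  | zero => simp
  | succ L ih =>
    rw [Finset.sum_range_succ]
    push_cast at ih ⊢
    nlinarith [(Nat.cast_nonneg L : (0 : ℝ) ≤ L)]

theorem one_sub_cos_add_ge (x y : ℝ) :
    (1 - Real.cos (y - x)) / 2 ≤ (1 - Real.cos x) + (1 - Real.cos y) := by
  have e : ∀ u : ℝ, Real.cos u = 1 - 2 * Real.sin (u / 2) ^ 2 := fun u => by
    have h := Real.cos_two_mul (u / 2)
    have h' := Real.sin_sq_add_cos_sq (u / 2)
    rw [mul_div_cancel₀ u two_ne_zero] at h
    linarith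
  rw [e (y - x), e x, e y, sub_div y x, Real.sin_sub]
  have hx := Real.sin_sq_add_cos_sq (x / 2)
  have hy := Real.sin_sq_add_cos_sq (y / 2)
  set a := Real.sin (x / 2)
  set b := Real.cos (x / 2)
  set c := Real.sin (y / 2)
  set d := Real.cos (y / 2)
  have h1 : (c * b - d * a) ^ 2 ≤ 2 * ((c * b) ^ 2 + (d * a) ^ 2) := by
    nlinarith [sq_nonneg (c * b + d * a)]
  have h2 : (c * b) ^ 2 ≤ c ^ 2 := by
    rw [mul_pow]; exact mul_le_of_le_one_right (sq_nonneg _) (by nlinarith [sq_nonneg a])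
  have h3 : (d * a) ^ 2 ≤ a ^ 2 := by
    rw [mul_pow]; exact mul_le_of_le_one_left (sq_nonneg _) (by nlinarith [sq_nonneg c])
  linarith

theorem sum_one_sub_cos_ge {L : ℕ} (hL : 4 ≤ L) {θ : ℝ} (h0 : 0 ≤ θ) (hπ : θ ≤ Real.pi) :
    min (θ ^ 2 * (L : ℝ) ^ 3 / 15) ((L : ℝ) / 16) ≤
      ∑ l ∈ Finset.range L, (1 - Real.cos ((l + 1 : ℕ) * θ)) := by
  have hL0 : (0 : ℝ) < L := by positivity
  have hL4 : (4 : ℝ) ≤ L := by exact_mod_cast hL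
  have hnn : ∀ i : ℕ, 0 ≤ 1 - Real.cos ((i : ℝ) * θ) := fun i => by
    linarith [Real.cos_le_one ((i : ℝ) * θ)]
  rcases le_or_gt (L * θ) Real.pi with h | h
  · refine (min_le_left _ _).trans ?_
    have hp : Real.pi ^ 2 ≤ 10 := by nlinarith [Real.pi_lt_d2, Real.pi_pos]
    calc θ ^ 2 * L ^ 3 / 15 = (θ ^ 2 / 5) * (L ^ 3 / 3) := by ring
      _ ≤ (θ ^ 2 / 5) * ∑ l ∈ Finset.range L, ((l + 1 : ℕ) : ℝ) ^ 2 := by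
          gcongr; exact sum_range_succ_sq_ge L
      _ = ∑ l ∈ Finset.range L, (θ ^ 2 / 5) * ((l + 1 : ℕ) : ℝ) ^ 2 := Finset.mul_sum _ _ _
      _ ≤ _ := Finset.sum_le_sum fun l hl => by
          have hl' : ((l + 1 : ℕ) : ℝ) ≤ L := by exact_mod_cast Finset.mem_range.1 hl
          have hb : |((l + 1 : ℕ) : ℝ) * θ| ≤ Real.pi := by
            rw [abs_of_nonneg (by positivity)]
            exact (mul_le_mul_of_nonneg_right hl' h0).trans h
          have hc := Real.cos_le_one_sub_mul_cos_sq hb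
          have h5 : 1 / 5 ≤ 2 / Real.pi ^ 2 := by
            rw [div_le_div_iff₀ (by norm_num) (by positivity)]
            linarith
          have := mul_le_mul_of_nonneg_right h5 (sq_nonneg (((l + 1 : ℕ) : ℝ) * θ))
          linarith
  · refine (min_le_right _ _).trans ?_
    have hθ : 0 < θ := by
      by_contra hc
      have : θ = 0 := le_antisymm (not_lt.1 hc) h0
      rw [this] at h
      linarith [Real.pi_pos]
    set m := ⌈Real.pi / (2 * θ)⌉₊ with hm
    have hm1 : Real.pi / (2 * θ) ≤ m := Nat.le_ceil _
    have hm2 : (m : ℝ) < Real.pi / (2 * θ) + 1 := Nat.ceil_lt_add_one (by positivity)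
    have hmθ1 : Real.pi / 2 ≤ m * θ := by
      have := mul_le_mul_of_nonneg_right hm1 h0
      have e : Real.pi / (2 * θ) * θ = Real.pi / 2 := by field_simp
      linarith
    have hmθ2 : m * θ ≤ Real.pi + Real.pi / 2 := by
      have := mul_le_mul_of_nonneg_right hm2.le h0
      have e : (Real.pi / (2 * θ) + 1) * θ = Real.pi / 2 + θ := by field_simp
      linarith
    have hcos := Real.cos_nonpos_of_pi_div_two_le_of_le hmθ1 hmθ2
    have hmL : (m : ℝ) < L / 2 + 1 := by
      refine hm2.trans ?_
      have : Real.pi / (2 * θ) < L / 2 := by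
        rw [div_lt_div_iff₀ (by positivity) (by norm_num)]
        linarith
      linarith
    have hmL' : m ≤ L := by
      have : (m : ℝ) ≤ L := by linarith
      exact_mod_cast this
    have hpair : ∀ l ∈ Finset.range (L - m), (1 : ℝ) / 2 ≤
        (1 - Real.cos ((l + 1 : ℕ) * θ)) + (1 - Real.cos ((l + m + 1 : ℕ) * θ)) := fun l _ => by
      have h := one_sub_cos_add_ge (((l + 1 : ℕ) : ℝ) * θ) (((l + m + 1 : ℕ) : ℝ) * θ)
      have e : ((l + m + 1 : ℕ) : ℝ) * θ - ((l + 1 : ℕ) : ℝ) * θ = m * θ := by push_cast; ring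
      rw [e] at h
      linarith
    have h1 := Finset.sum_le_sum hpair
    rw [Finset.sum_add_distrib] at h1
    have h2 : ∑ l ∈ Finset.range (L - m), (1 - Real.cos ((l + 1 : ℕ) * θ)) ≤
        ∑ l ∈ Finset.range L, (1 - Real.cos ((l + 1 : ℕ) * θ)) :=
      Finset.sum_le_sum_of_subset_of_nonneg (Finset.range_mono (Nat.sub_le _ _))
        fun l _ _ => hnn (l + 1)
    have h3 : ∑ l ∈ Finset.range (L - m), (1 - Real.cos ((l + m + 1 : ℕ) * θ)) ≤
        ∑ l ∈ Finset.range L, (1 - Real.cos ((l + 1 : ℕ) * θ)) := by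
      have := Finset.sum_range_add (fun l => 1 - Real.cos ((l + 1 : ℕ) * θ)) m (L - m)
      rw [Nat.add_sub_cancel' hmL'] at this
      rw [this]
      have h4 : 0 ≤ ∑ l ∈ Finset.range m, (1 - Real.cos ((l + 1 : ℕ) * θ)) :=
        Finset.sum_nonneg fun l _ => hnn (l + 1)
      have h5 : ∑ l ∈ Finset.range (L - m), (1 - Real.cos ((l + m + 1 : ℕ) * θ)) =
          ∑ l ∈ Finset.range (L - m), (1 - Real.cos ((m + l + 1 : ℕ) * θ)) :=
        Finset.sum_congr rfl fun l _ => by rw [add_comm l m]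
      linarith
    rw [Finset.sum_const, Finset.card_range, nsmul_eq_mul, Nat.cast_sub hmL'] at h1
    linarith

theorem sum_expWeight_one_sub_cos_ge {τ : ℝ} (hτ : 0 < τ) (hτ' : τ ≤ 1 / 4) {θ : ℝ}
    (hπ : |θ| ≤ Real.pi) :
    1 / 400 * min (θ ^ 2 / τ ^ 3) (1 / τ) ≤
      ∑' l : ℕ, expWeight τ (l + 1) * (1 - Real.cos ((l + 1 : ℕ) * θ)) := by
  set L := ⌊1 / τ⌋₊ with hLdef
  have h4 : 4 ≤ 1 / τ := by rw [le_div_iff₀ hτ]; linarith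
  have hL : 4 ≤ L := Nat.le_floor (by exact_mod_cast h4)
  have hL1 : (L : ℝ) ≤ 1 / τ := Nat.floor_le (by positivity)
  have hL2 : 1 / (2 * τ) ≤ L := by
    have h := Nat.lt_floor_add_one (1 / τ)
    have e : 1 / (2 * τ) = (1 / τ) / 2 := by field_simp
    have h4' : (4 : ℝ) ≤ L := by exact_mod_cast hL
    rw [e]
    linarith
  have hnn : ∀ l : ℕ, 0 ≤ 1 - Real.cos ((l + 1 : ℕ) * θ) := fun l => by
    linarith [Real.cos_le_one ((l + 1 : ℕ) * θ)]
  have hs : Summable fun l : ℕ => expWeight τ (l + 1) * (1 - Real.cos ((l + 1 : ℕ) * θ)) := by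
    refine Summable.of_nonneg_of_le (fun l => mul_nonneg (expWeight_nonneg _ _) (hnn l))
      (fun l => mul_le_mul_of_nonneg_left (b := 1 - Real.cos ((l + 1 : ℕ) * θ)) (c := 2) ?_
        (expWeight_nonneg _ _)) ((hasSum_expWeight_succ hτ).summable.mul_right 2)
    linarith [Real.neg_one_le_cos ((l + 1 : ℕ) * θ)]
  have hsum := hs.sum_le_tsum (Finset.range L)
    fun l _ => mul_nonneg (expWeight_nonneg _ _) (hnn l)
  refine le_trans ?_ hsum
  have hw : ∀ l ∈ Finset.range L, 1 / 3 * (1 - Real.cos ((l + 1 : ℕ) * |θ|)) ≤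
      expWeight τ (l + 1) * (1 - Real.cos ((l + 1 : ℕ) * θ)) := fun l hl => by
    have hc : Real.cos ((l + 1 : ℕ) * |θ|) = Real.cos ((l + 1 : ℕ) * θ) := by
      rw [← Real.cos_abs ((l + 1 : ℕ) * θ), abs_mul, Nat.abs_cast]
    rw [hc]
    refine mul_le_mul_of_nonneg_right ?_ (hnn l)
    have hl' : ((l + 1 : ℕ) : ℝ) ≤ 1 / τ := le_trans (by exact_mod_cast Finset.mem_range.1 hl) hL1
    have h1 : τ * (l + 1 : ℕ) ≤ 1 := by
      have := mul_le_mul_of_nonneg_left hl' hτ.le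
      rwa [mul_one_div_cancel hτ.ne'] at this
    have h2 : Real.exp (-1) ≤ expWeight τ (l + 1) := Real.exp_le_exp.2 (by linarith)
    refine le_trans ?_ h2
    rw [Real.exp_neg, one_div]
    exact inv_anti₀ (Real.exp_pos 1) (by linarith [Real.exp_one_lt_d9])
  refine le_trans ?_ (Finset.sum_le_sum hw)
  rw [← Finset.mul_sum]
  have hmain := sum_one_sub_cos_ge hL (abs_nonneg θ) hπ
  rw [sq_abs] at hmain
  have h5 : 1 / 120 * min (θ ^ 2 / τ ^ 3) (1 / τ) ≤ min (θ ^ 2 * (L : ℝ) ^ 3 / 15) ((L : ℝ) / 16) := by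
    have hmin : (0 : ℝ) ≤ min (θ ^ 2 / τ ^ 3) (1 / τ) := by positivity
    refine le_min ?_ ?_
    · calc 1 / 120 * min (θ ^ 2 / τ ^ 3) (1 / τ) ≤ 1 / 120 * (θ ^ 2 / τ ^ 3) := by
            gcongr; exact min_le_left _ _
        _ = θ ^ 2 * (1 / (2 * τ)) ^ 3 / 15 := by field_simp; ring
        _ ≤ _ := by gcongr
    · calc 1 / 120 * min (θ ^ 2 / τ ^ 3) (1 / τ) ≤ 1 / 120 * (1 / τ) := by
            gcongr; exact min_le_right _ _
        _ ≤ (1 / (2 * τ)) / 16 := by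
            rw [div_div, mul_one_div, div_div, div_le_div_iff₀ (by positivity) (by positivity)]
            nlinarith
        _ ≤ _ := by gcongr
  have hmin : (0 : ℝ) ≤ min (θ ^ 2 / τ ^ 3) (1 / τ) := by positivity
  nlinarith

/-! ### The exponent of the partition generating function -/

/-- The sum of the geometric exponents over the part sizes larger than `a`. -/
noncomputable def tailExponent (τ : ℝ) (a : ℕ) (θ : ℝ) : ℂ :=
  ∑' l : ℕ, geomExponent (expWeight τ (a + l + 1)) ((a + l + 1 : ℕ) * θ)

section tailExponent

variable {τ : ℝ}

theorem norm_tail_term_le (hτ : 0 < τ) (a : ℕ) (θ : ℝ) (l : ℕ) :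
    ‖geomExponent (expWeight τ (a + l + 1)) ((a + l + 1 : ℕ) * θ)‖ ≤
      2 * (expWeight τ (a + l + 1) / (1 - expWeight τ (a + l + 1))) :=
  norm_geomExponent_le_two (expWeight_nonneg _ _) (expWeight_lt_one hτ (by omega)) _

theorem hasSum_tailExponent (hτ : 0 < τ) (a : ℕ) (θ : ℝ) :
    HasSum (fun l : ℕ => geomExponent (expWeight τ (a + l + 1)) ((a + l + 1 : ℕ) * θ))
      (tailExponent τ a θ) :=
  (Summable.of_norm_bounded ((summable_ratio hτ a).mul_left 2)
    (norm_tail_term_le hτ a θ)).hasSum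

theorem continuous_tailExponent (hτ : 0 < τ) (a : ℕ) : Continuous (tailExponent τ a) :=
  continuous_tsum (fun l => (continuous_geomExponent (expWeight_nonneg _ _)
    (expWeight_lt_one hτ (by omega))).comp (by fun_prop)) ((summable_ratio hτ a).mul_left 2)
    fun l θ => norm_tail_term_le hτ a θ l

theorem norm_tailExponent_le_ratio (hτ : 0 < τ) (a : ℕ) (θ : ℝ) :
    ‖tailExponent τ a θ‖ ≤
      2 * ∑' l : ℕ, expWeight τ (a + l + 1) / (1 - expWeight τ (a + l + 1)) :=
  tsum_of_norm_bounded ((summable_ratio hτ a).hasSum.mul_left 2) (norm_tail_term_le hτ a θ)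

theorem norm_tailExponent_le (hτ : 0 < τ) (a : ℕ) (θ : ℝ) :
    ‖tailExponent τ a θ‖ ≤ |θ| * tailMoment τ a 1 := by
  refine tsum_of_norm_bounded ((hasSum_tailMoment hτ a 1 (by omega)).mul_left |θ|) fun l => ?_
  refine (norm_geomExponent_le (expWeight_nonneg _ _)
    (expWeight_lt_one hτ (by omega)) _).trans_eq ?_
  rw [abs_mul, Nat.abs_cast]
  ring

theorem hasSum_tail_linear (hτ : 0 < τ) (a : ℕ) (θ : ℝ) :
    HasSum (fun l : ℕ => ((((a + l + 1 : ℕ) * θ) *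
      (expWeight τ (a + l + 1) / (1 - expWeight τ (a + l + 1))) : ℝ) : ℂ) * Complex.I)
      ((θ * tailMoment τ a 1 : ℝ) * Complex.I) := by
  refine hasSum_of_pointwise_eq ((Complex.hasSum_ofReal.2
    ((hasSum_tailMoment hτ a 1 (by omega)).mul_left θ)).mul_right Complex.I) fun l => ?_
  congr 2
  ring

theorem hasSum_tail_quadratic (hτ : 0 < τ) (a : ℕ) (θ : ℝ) :
    HasSum (fun l : ℕ => ((((a + l + 1 : ℕ) * θ) ^ 2 / 2 *
      (expWeight τ (a + l + 1) / (1 - expWeight τ (a + l + 1)) ^ 2) : ℝ) : ℂ))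
      ((θ ^ 2 / 2 * tailMoment τ a 2 : ℝ) : ℂ) := by
  refine hasSum_of_pointwise_eq (Complex.hasSum_ofReal.2
    ((hasSum_tailMoment hτ a 2 (by omega)).mul_left (θ ^ 2 / 2))) fun l => ?_
  congr 1
  ring

theorem norm_tailExponent_sub_linear_le (hτ : 0 < τ) (a : ℕ) (θ : ℝ) :
    ‖tailExponent τ a θ - (θ * tailMoment τ a 1 : ℝ) * Complex.I‖ ≤
      θ ^ 2 * tailMoment τ a 2 := by
  rw [← ((hasSum_tailExponent hτ a θ).sub (hasSum_tail_linear hτ a θ)).tsum_eq]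
  refine tsum_of_norm_bounded ((hasSum_tailMoment hτ a 2 (by omega)).mul_left (θ ^ 2))
    fun l => ?_
  refine (norm_geomExponent_sub_linear_le (expWeight_nonneg _ _)
    (expWeight_lt_one hτ (by omega)) _).trans_eq ?_
  ring

theorem norm_tailExponent_sub_quadratic_le (hτ : 0 < τ) (a : ℕ) (θ : ℝ) :
    ‖tailExponent τ a θ - (θ * tailMoment τ a 1 : ℝ) * Complex.I +
      ((θ ^ 2 / 2 * tailMoment τ a 2 : ℝ) : ℂ)‖ ≤ 2 * |θ| ^ 3 * tailMoment τ a 3 := by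
  rw [← (((hasSum_tailExponent hτ a θ).sub (hasSum_tail_linear hτ a θ)).add
    (hasSum_tail_quadratic hτ a θ)).tsum_eq]
  refine tsum_of_norm_bounded ((hasSum_tailMoment hτ a 3 le_rfl).mul_left (2 * |θ| ^ 3))
    fun l => ?_
  refine (norm_geomExponent_sub_quadratic_le (expWeight_nonneg _ _)
    (expWeight_lt_one hτ (by omega)) _).trans_eq ?_
  rw [abs_mul, Nat.abs_cast]
  ring

theorem re_tailExponent_nonpos (hτ : 0 < τ) (a : ℕ) (θ : ℝ) : (tailExponent τ a θ).re ≤ 0 := by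
  refine hasSum_le (fun l => ?_) (Complex.hasSum_re (hasSum_tailExponent hτ a θ)) hasSum_zero
  exact re_geomExponent_nonpos (expWeight_nonneg _ _) (expWeight_lt_one hτ (by omega)) _

theorem abs_re_tailExponent_le (hτ : 0 < τ) (a : ℕ) (θ : ℝ) :
    |(tailExponent τ a θ).re| ≤ θ ^ 2 * tailMoment τ a 2 := by
  have h := (Complex.abs_re_le_norm _).trans (norm_tailExponent_sub_linear_le hτ a θ)
  rwa [Complex.sub_re, Complex.re_ofReal_mul, Complex.I_re, mul_zero, sub_zero] at h

theorem summable_expWeight_one_sub_cos (hτ : 0 < τ) (θ : ℝ) :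
    Summable fun l : ℕ => expWeight τ (l + 1) * (1 - Real.cos ((l + 1 : ℕ) * θ)) := by
  refine Summable.of_nonneg_of_le (fun l => mul_nonneg (expWeight_nonneg _ _) ?_)
    (fun l => mul_le_mul_of_nonneg_left (b := 1 - Real.cos ((l + 1 : ℕ) * θ)) (c := 2) ?_
      (expWeight_nonneg _ _)) ((hasSum_expWeight_succ hτ).summable.mul_right 2)
  · linarith [Real.cos_le_one ((l + 1 : ℕ) * θ)]
  · linarith [Real.neg_one_le_cos ((l + 1 : ℕ) * θ)]

theorem re_tailExponent_zero_le (hτ : 0 < τ) (hτ' : τ ≤ 1 / 4) {θ : ℝ} (hπ : |θ| ≤ Real.pi) :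
    (tailExponent τ 0 θ).re ≤ -(1 / 400 * min (θ ^ 2 / τ ^ 3) (1 / τ)) := by
  refine le_trans ?_ (neg_le_neg (sum_expWeight_one_sub_cos_ge hτ hτ' hπ))
  refine hasSum_le (fun l => ?_) (Complex.hasSum_re (hasSum_tailExponent hτ 0 θ))
    (summable_expWeight_one_sub_cos hτ θ).hasSum.neg
  have h := re_geomExponent_le (expWeight_nonneg τ (0 + l + 1))
    (expWeight_lt_one hτ (i := 0 + l + 1) (by omega)) ((0 + l + 1 : ℕ) * θ)
  rw [zero_add] at h ⊢
  linarith

theorem neg_variance_le (hτ : 0 < τ) (hτ' : τ ≤ 1 / 4) {θ : ℝ} (hπ : |θ| ≤ Real.pi) :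
    -(θ ^ 2 / 2 * tailMoment τ 0 2) ≤ -(1 / 400 * min (θ ^ 2 / τ ^ 3) (1 / τ)) := by
  refine neg_le_neg ((sum_expWeight_one_sub_cos_ge hτ hτ' hπ).trans ?_)
  refine hasSum_le (fun l => ?_) (summable_expWeight_one_sub_cos hτ θ).hasSum
    ((hasSum_tailMoment hτ 0 2 (by omega)).mul_left (θ ^ 2 / 2))
  rw [zero_add]
  have h1 := Real.one_sub_sq_div_two_le_cos (x := ((l + 1 : ℕ) : ℝ) * θ)
  have hx0 := expWeight_pos τ (l + 1)
  have hx1 := expWeight_lt_one hτ (i := l + 1) (by omega)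
  have h2 : expWeight τ (l + 1) ≤ expWeight τ (l + 1) / (1 - expWeight τ (l + 1)) ^ 2 := by
    rw [le_div_iff₀ (by have : 0 < 1 - expWeight τ (l + 1) := by linarith
                        positivity)]
    refine mul_le_of_le_one_right hx0.le ?_
    exact pow_le_one₀ (by linarith) (by linarith)
  calc expWeight τ (l + 1) * (1 - Real.cos ((l + 1 : ℕ) * θ))
      ≤ expWeight τ (l + 1) / (1 - expWeight τ (l + 1)) ^ 2 * ((((l + 1 : ℕ) : ℝ) * θ) ^ 2 / 2) :=
        mul_le_mul h2 (by linarith) (by linarith [Real.cos_le_one (((l + 1 : ℕ) : ℝ) * θ)])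
          (hx0.le.trans h2)
    _ = _ := by ring

theorem tailExponent_zero_eq (hτ : 0 < τ) (a : ℕ) (θ : ℝ) :
    tailExponent τ 0 θ = ∑ i ∈ Finset.range a,
      geomExponent (expWeight τ (i + 1)) ((i + 1 : ℕ) * θ) + tailExponent τ a θ := by
  have h := (hasSum_tailExponent hτ 0 θ).summable.sum_add_tsum_nat_add a
  simp only [zero_add] at h
  rw [tailExponent, tailExponent]
  simp only [zero_add]
  rw [← h]
  congr 1
  refine tsum_congr fun l => ?_
  rw [add_comm l a]

end tailExponent

/-! ### The generating polynomial on a circle -/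

/-- The value of the box generating polynomial at `exp (-τ)`. -/
noncomputable def boxValue (τ : ℝ) (a b : ℕ) : ℝ :=
  Polynomial.aeval (Real.exp (-τ)) (boxGenPoly a b)

/-- The partial Euler products. -/
noncomputable def eulerProd (τ : ℝ) (a : ℕ) : ℝ :=
  ∏ i ∈ Finset.range a, (1 - expWeight τ (i + 1))

theorem eulerProd_pos {τ : ℝ} (hτ : 0 < τ) (a : ℕ) : 0 < eulerProd τ a :=
  Finset.prod_pos fun i _ => by
    have := expWeight_lt_one hτ (i := i + 1) (by omega)
    linarith

theorem boxValue_mul (τ : ℝ) (a b : ℕ) :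
    boxValue τ a b * eulerProd τ a * eulerProd τ b = eulerProd τ (a + b) := by
  have h := aeval_boxGenPoly_mul (Real.exp (-τ)) a b
  simpa only [boxValue, eulerProd, expWeight_eq_pow] using h

theorem boxValue_pos {τ : ℝ} (hτ : 0 < τ) (a b : ℕ) : 0 < boxValue τ a b := by
  have h := boxValue_mul τ a b
  have h1 := mul_pos (eulerProd_pos hτ a) (eulerProd_pos hτ b)
  have h2 := eulerProd_pos hτ (a + b)
  rw [← h, mul_assoc] at h2
  exact (pos_iff_pos_of_mul_pos h2).2 h1

theorem prod_one_sub_circle {τ : ℝ} (hτ : 0 < τ) (θ : ℝ) (a : ℕ) :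
    (∏ i ∈ Finset.range a, (1 - (Real.exp (-τ) * Complex.exp (θ * Complex.I)) ^ (i + 1))) *
      Complex.exp (tailExponent τ 0 θ - tailExponent τ a θ) = eulerProd τ a := by
  rw [tailExponent_zero_eq hτ a, add_sub_cancel_right, Complex.exp_sum, ← Finset.prod_mul_distrib,
    eulerProd, Complex.ofReal_prod]
  refine Finset.prod_congr rfl fun i _ => ?_
  have h0 := expWeight_nonneg τ (i + 1)
  have h1 := expWeight_lt_one hτ (i := i + 1) (by omega)
  rw [exp_geomExponent h0 h1]
  have e : ((Real.exp (-τ) : ℂ) * Complex.exp (θ * Complex.I)) ^ (i + 1) =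
      (expWeight τ (i + 1) : ℂ) * Complex.exp (((i + 1 : ℕ) * θ : ℝ) * Complex.I) := by
    rw [mul_pow, expWeight_eq_pow, ← Complex.exp_nat_mul]
    push_cast
    ring_nf
  rw [e, mul_div_cancel₀]
  · push_cast; rfl
  · exact one_sub_ne_zero_of_norm_lt (norm_mul_exp_lt_one h0 h1 _)

theorem aeval_boxGenPoly_circle {τ : ℝ} (hτ : 0 < τ) (θ : ℝ) (a b : ℕ) :
    Polynomial.aeval ((Real.exp (-τ) : ℂ) * Complex.exp (θ * Complex.I)) (boxGenPoly a b) =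
      boxValue τ a b * Complex.exp (tailExponent τ 0 θ - tailExponent τ a θ -
        tailExponent τ b θ + tailExponent τ (a + b) θ) := by
  have h := aeval_boxGenPoly_mul ((Real.exp (-τ) : ℂ) * Complex.exp (θ * Complex.I)) a b
  have ha := prod_one_sub_circle hτ θ a
  have hb := prod_one_sub_circle hτ θ b
  have hab := prod_one_sub_circle hτ θ (a + b)
  have hv : (boxValue τ a b : ℂ) * eulerProd τ a * eulerProd τ b = eulerProd τ (a + b) := by
    exact_mod_cast boxValue_mul τ a b
  have hne : (eulerProd τ a : ℂ) * eulerProd τ b ≠ 0 := by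
    exact_mod_cast (mul_pos (eulerProd_pos hτ a) (eulerProd_pos hτ b)).ne'
  set z := (Real.exp (-τ) : ℂ) * Complex.exp (θ * Complex.I)
  refine mul_right_cancel₀ hne ?_
  have e : Complex.exp (tailExponent τ 0 θ - tailExponent τ a θ -
        tailExponent τ b θ + tailExponent τ (a + b) θ) *
        Complex.exp (tailExponent τ 0 θ - tailExponent τ (a + b) θ) =
      Complex.exp (tailExponent τ 0 θ - tailExponent τ a θ) *
        Complex.exp (tailExponent τ 0 θ - tailExponent τ b θ) := by
    rw [← Complex.exp_add, ← Complex.exp_add]; ring_nf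
  refine mul_right_cancel₀
    (Complex.exp_ne_zero (tailExponent τ 0 θ - tailExponent τ (a + b) θ)) ?_
  set E := Complex.exp (tailExponent τ 0 θ - tailExponent τ a θ -
        tailExponent τ b θ + tailExponent τ (a + b) θ)
  set Ea := Complex.exp (tailExponent τ 0 θ - tailExponent τ a θ)
  set Eb := Complex.exp (tailExponent τ 0 θ - tailExponent τ b θ)
  set Eab := Complex.exp (tailExponent τ 0 θ - tailExponent τ (a + b) θ)
  calc _ = (Polynomial.aeval z (boxGenPoly a b) *
        (∏ i ∈ Finset.range a, (1 - z ^ (i + 1))) *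
        (∏ i ∈ Finset.range b, (1 - z ^ (i + 1)))) * Eab * (Ea * Eb) := by
        rw [← ha, ← hb]; ring
    _ = boxValue τ a b * eulerProd τ a * eulerProd τ b * (E * Eab) := by
        rw [h, hab, ← hv, e]
    _ = _ := by ring

theorem integral_exp_int_mul (m : ℤ) :
    ∫ θ in (-Real.pi)..Real.pi, Complex.exp ((m : ℂ) * θ * Complex.I) =
      if m = 0 then (2 * Real.pi : ℂ) else 0 := by
  split_ifs with h
  · simp [h, two_mul]
  · have hm : (m : ℂ) * Complex.I ≠ 0 := mul_ne_zero (by exact_mod_cast h) Complex.I_ne_zero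
    have e : ∀ θ : ℝ, Complex.exp ((m : ℂ) * θ * Complex.I) =
        Complex.exp ((m : ℂ) * Complex.I * θ) := fun θ => by ring_nf
    simp only [e]
    rw [integral_exp_mul_complex hm, div_eq_zero_iff]
    left
    have h1 : (m : ℂ) * Complex.I * (Real.pi : ℝ) =
        (m : ℂ) * Complex.I * ((-Real.pi : ℝ) : ℂ) + m * (2 * Real.pi * Complex.I) := by
      push_cast; ring
    rw [h1, Complex.exp_add, Complex.exp_int_mul_two_pi_mul_I]
    ring

theorem integral_aeval_circle (p : Polynomial ℕ) (q : ℝ) (N : ℕ) :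
    ∫ θ in (-Real.pi)..Real.pi, Polynomial.aeval ((q : ℂ) * Complex.exp (θ * Complex.I)) p *
      Complex.exp (-(N * θ * Complex.I)) = 2 * Real.pi * (p.coeff N * q ^ N) := by
  have e : ∀ θ : ℝ, Polynomial.aeval ((q : ℂ) * Complex.exp (θ * Complex.I)) p *
      Complex.exp (-(N * θ * Complex.I)) = ∑ j ∈ Finset.range (p.natDegree + 1),
        ((p.coeff j : ℂ) * q ^ j) * Complex.exp ((((j : ℤ) - (N : ℤ) : ℤ) : ℂ) * θ * Complex.I) := by
    intro θ
    rw [Polynomial.aeval_eq_sum_range, Finset.sum_mul]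
    refine Finset.sum_congr rfl fun j _ => ?_
    have e1 : Complex.exp ((((j : ℤ) - (N : ℤ) : ℤ) : ℂ) * θ * Complex.I) =
        Complex.exp (j * (θ * Complex.I)) * Complex.exp (-(N * θ * Complex.I)) := by
      rw [← Complex.exp_add]
      congr 1
      push_cast
      ring
    rw [e1, nsmul_eq_mul, mul_pow, ← Complex.exp_nat_mul]
    ring
  simp only [e]
  rw [intervalIntegral.integral_finsetSum]
  · simp only [intervalIntegral.integral_const_mul, integral_exp_int_mul]
    rw [Finset.sum_eq_single N]
    · simp; ring
    · intro j _ hj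
      rw [if_neg (by omega), mul_zero]
    · intro hN
      rw [Polynomial.coeff_eq_zero_of_natDegree_lt (by simpa using hN)]
      simp
  · intro j _
    exact Continuous.intervalIntegrable (by fun_prop) _ _

/-- The integral representing the number of diagrams in a box. -/
noncomputable def boxIntegral (τ : ℝ) (a b N : ℕ) : ℂ :=
  ∫ θ in (-Real.pi)..Real.pi, Complex.exp (tailExponent τ 0 θ - tailExponent τ a θ -
        tailExponent τ b θ + tailExponent τ (a + b) θ - N * θ * Complex.I)

theorem boxValue_mul_boxIntegral {τ : ℝ} (hτ : 0 < τ) (a b N : ℕ) :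
    (boxValue τ a b : ℂ) * boxIntegral τ a b N =
      ((2 * Real.pi * ((boxDiagrams a b N).ncard * expWeight τ N) : ℝ) : ℂ) := by
  have h := integral_aeval_circle (boxGenPoly a b) (Real.exp (-τ)) N
  simp only [aeval_boxGenPoly_circle hτ, mul_assoc, ← Complex.exp_add] at h
  rw [intervalIntegral.integral_const_mul] at h
  rw [boxIntegral, ← coeff_boxGenPoly, expWeight_eq_pow]
  push_cast
  push_cast at h
  rw [← mul_assoc] at h
  simpa only [sub_eq_add_neg, mul_assoc] using h

/-! ### Elementary estimates for the exponential -/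

theorem norm_cexp_sub_cexp_le {z w : ℂ} {B : ℝ} (hz : z.re ≤ B) (hw : w.re ≤ B) :
    ‖Complex.exp z - Complex.exp w‖ ≤ Real.exp B * ‖z - w‖ := by
  refine (convex_halfSpace_re_le B).norm_image_sub_le_of_norm_hasDerivWithin_le
    (f := Complex.exp) (f' := Complex.exp) (fun x _ => (Complex.hasDerivAt_exp x).hasDerivWithinAt)
    (fun x hx => ?_) hw hz
  rw [Complex.norm_exp]
  exact Real.exp_le_exp.2 hx

theorem norm_cexp_sub_one_le {z : ℂ} {B : ℝ} (hB : 0 ≤ B) (hz : z.re ≤ B) :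
    ‖Complex.exp z - 1‖ ≤ Real.exp B * ‖z‖ := by
  simpa using norm_cexp_sub_cexp_le (w := 0) hz (by simpa using hB)

theorem norm_cexp_sub_one_sub_le {z : ℂ} {B : ℝ} (hB : 0 ≤ B) (hz : z.re ≤ B) :
    ‖Complex.exp z - 1 - z‖ ≤ Real.exp B * ‖z‖ ^ 2 := by
  have hconv : Convex ℝ ({w : ℂ | w.re ≤ B} ∩ Metric.closedBall 0 ‖z‖) :=
    (convex_halfSpace_re_le B).inter (convex_closedBall _ _)
  have h := hconv.norm_image_sub_le_of_norm_hasDerivWithin_le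
    (f := fun w => Complex.exp w - 1 - w) (f' := fun w => Complex.exp w - 1)
    (C := Real.exp B * ‖z‖) (x := 0) (y := z)
    (fun x _ => (((Complex.hasDerivAt_exp x).sub_const 1).sub (hasDerivAt_id x)).hasDerivWithinAt)
    (fun x hx => ?_) ⟨by simpa using hB, by simp⟩ ⟨hz, by simp⟩
  · simpa [pow_two, mul_assoc] using h
  · refine (norm_cexp_sub_one_le hB hx.1).trans ?_
    have := hx.2
    rw [mem_closedBall_zero_iff] at this
    gcongr

theorem exists_exp_neg_mul_le {c : ℝ} (hc : 0 < c) :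
    ∃ C > 0, ∀ u : ℝ, 0 ≤ u → Real.exp (-(c * u)) ≤ C / (1 + u) ^ 9 := by
  refine ⟨Real.exp c * (9 / c) ^ 9, by positivity, fun u hu => ?_⟩
  rw [le_div_iff₀ (by positivity)]
  have h1 : (c * (1 + u) / 9) ^ 9 ≤ Real.exp (c * (1 + u)) := by
    have h := Real.add_one_le_exp (c * (1 + u) / 9)
    calc (c * (1 + u) / 9) ^ 9 ≤ Real.exp (c * (1 + u) / 9) ^ 9 :=
          pow_le_pow_left₀ (by positivity) (by linarith) 9
      _ = _ := by rw [← Real.exp_nat_mul]; push_cast; ring_nf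
  calc Real.exp (-(c * u)) * (1 + u) ^ 9
      = Real.exp (-(c * u)) * (9 / c) ^ 9 * (c * (1 + u) / 9) ^ 9 := by
        rw [mul_assoc, ← mul_pow]
        congr 2
        field_simp
    _ ≤ Real.exp (-(c * u)) * (9 / c) ^ 9 * Real.exp (c * (1 + u)) := by gcongr
    _ = Real.exp c * (9 / c) ^ 9 := by
        rw [mul_right_comm, ← Real.exp_add]; ring_nf

/-- A polynomially decaying kernel at scale `τ ^ (3 / 2)`. -/
noncomputable def decayKernel (τ θ : ℝ) : ℝ := 1 / (1 + θ ^ 2 / τ ^ 3) ^ 3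

theorem decayKernel_nonneg {τ : ℝ} (hτ : 0 < τ) (θ : ℝ) : 0 ≤ decayKernel τ θ := by
  unfold decayKernel; positivity

theorem exists_exp_neg_min_le {c : ℝ} (hc : 0 < c) :
    ∃ C > 0, ∀ τ θ : ℝ, 0 < τ → |θ| ≤ Real.pi →
      Real.exp (-(c * min (θ ^ 2 / τ ^ 3) (1 / τ))) ≤ C * decayKernel τ θ := by
  obtain ⟨C, hC, h⟩ := exists_exp_neg_mul_le hc
  refine ⟨C * 11 ^ 3, by positivity, fun τ θ hτ hθ => ?_⟩
  set u := min (θ ^ 2 / τ ^ 3) (1 / τ) with hu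
  have hu0 : 0 ≤ u := by positivity
  refine (h u hu0).trans ?_
  have h1 : 1 + θ ^ 2 / τ ^ 3 ≤ 11 * (1 + u) ^ 3 := by
    have h3 : 1 + u ≤ (1 + u) ^ 3 := le_self_pow₀ (by linarith) (by norm_num)
    rcases min_choice (θ ^ 2 / τ ^ 3) (1 / τ) with h2 | h2
    · rw [← h2, ← hu]; linarith
    · have h4 : θ ^ 2 ≤ 10 := by
        rw [← sq_abs]
        nlinarith [abs_nonneg θ, Real.pi_lt_d2, Real.pi_pos]
      have h5 : θ ^ 2 / τ ^ 3 ≤ 10 * u ^ 3 := by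
        rw [hu, h2, one_div, inv_pow, div_eq_mul_inv]
        gcongr
      have h6 : u ^ 3 ≤ (1 + u) ^ 3 := pow_le_pow_left₀ hu0 (by linarith) 3
      linarith
  have h2 : (1 + θ ^ 2 / τ ^ 3) ^ 3 ≤ 11 ^ 3 * (1 + u) ^ 9 := by
    calc _ ≤ (11 * (1 + u) ^ 3) ^ 3 := pow_le_pow_left₀ (by positivity) h1 3
      _ = _ := by ring
  rw [decayKernel, mul_one_div, div_le_div_iff₀ (by positivity) (by positivity)]
  nlinarith

/-- The width `τ ^ (3 / 2)` of the characteristic function. -/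
noncomputable def scale (τ : ℝ) : ℝ := τ * Real.sqrt τ

theorem scale_pos {τ : ℝ} (hτ : 0 < τ) : 0 < scale τ := mul_pos hτ (Real.sqrt_pos.2 hτ)

theorem scale_sq {τ : ℝ} (hτ : 0 < τ) : scale τ ^ 2 = τ ^ 3 := by
  rw [scale, mul_pow, Real.sq_sqrt hτ.le]; ring

theorem abs_pow_mul_decayKernel_le {τ : ℝ} (hτ : 0 < τ) (θ : ℝ) {j : ℕ} (hj : j ≤ 4) :
    |θ| ^ j * decayKernel τ θ ≤ scale τ ^ j * (1 / (1 + (θ / scale τ) ^ 2)) := by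
  have hr := scale_pos hτ
  set u := |θ| / scale τ with hu
  have hu0 : 0 ≤ u := by positivity
  have hθ : |θ| = u * scale τ := by rw [hu]; field_simp
  have e : (θ / scale τ) ^ 2 = u ^ 2 := by rw [hu, div_pow, div_pow, sq_abs]
  have e' : θ ^ 2 / τ ^ 3 = u ^ 2 := by rw [← scale_sq hτ, ← div_pow, e]
  have h1 : u ^ j ≤ (1 + u ^ 2) ^ 2 := by
    rcases le_or_gt u 1 with h | h
    · exact (pow_le_one₀ hu0 h).trans (one_le_pow₀ (by nlinarith))
    · exact (pow_le_pow_right₀ h.le hj).trans (by nlinarith [sq_nonneg u])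
  rw [decayKernel, e, e', hθ, mul_pow]
  calc u ^ j * scale τ ^ j * (1 / (1 + u ^ 2) ^ 3)
      ≤ (1 + u ^ 2) ^ 2 * scale τ ^ j * (1 / (1 + u ^ 2) ^ 3) := by gcongr
    _ = _ := by field_simp

theorem integral_lorentz_le {r : ℝ} (hr : 0 < r) :
    ∫ θ in (-Real.pi)..Real.pi, 1 / (1 + (θ / r) ^ 2) ≤ r * Real.pi := by
  rw [intervalIntegral.integral_comp_div (fun u => 1 / (1 + u ^ 2)) hr.ne',
    integral_one_div_one_add_sq, smul_eq_mul]
  have h1 := Real.arctan_lt_pi_div_two (Real.pi / r)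
  have h2 := Real.neg_pi_div_two_lt_arctan (-Real.pi / r)
  exact mul_le_mul_of_nonneg_left (by linarith) hr.le

theorem norm_integral_le_of_decay {τ : ℝ} (hτ : 0 < τ) {f : ℝ → ℂ} {A : ℝ} (hA : 0 ≤ A) {j : ℕ}
    (hj : j ≤ 4) (hf : ∀ θ, |θ| ≤ Real.pi → ‖f θ‖ ≤ A * |θ| ^ j * decayKernel τ θ) :
    ‖∫ θ in (-Real.pi)..Real.pi, f θ‖ ≤ A * Real.pi * scale τ ^ (j + 1) := by
  have hr := scale_pos hτ
  have h := intervalIntegral.norm_integral_le_of_norm_le (μ := volume)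
    (a := -Real.pi) (b := Real.pi) (f := f)
    (g := fun θ => A * scale τ ^ j * (1 / (1 + (θ / scale τ) ^ 2)))
    (by linarith [Real.pi_pos]) (Eventually.of_forall fun θ hθ => ?_) ?_
  · refine h.trans ?_
    rw [intervalIntegral.integral_const_mul]
    calc _ ≤ A * scale τ ^ j * (scale τ * Real.pi) := by
          gcongr; exact integral_lorentz_le hr
      _ = _ := by ring
  · refine (hf θ (abs_le.2 ⟨hθ.1.le, hθ.2⟩)).trans ?_
    rw [mul_assoc, mul_assoc]
    exact mul_le_mul_of_nonneg_left (abs_pow_mul_decayKernel_le hτ θ hj) hA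
  · refine Continuous.intervalIntegrable ?_ _ _
    refine continuous_const.mul (continuous_const.div (by fun_prop) fun θ => ?_)
    positivity

/-! ### The unperturbed integral -/

/-- The unperturbed integrand. -/
noncomputable def baseIntegrand (τ : ℝ) (n : ℕ) (θ : ℝ) : ℂ :=
  Complex.exp (tailExponent τ 0 θ - n * θ * Complex.I)

theorem continuous_baseIntegrand {τ : ℝ} (hτ : 0 < τ) (n : ℕ) :
    Continuous (baseIntegrand τ n) := by
  have := continuous_tailExponent hτ 0
  unfold baseIntegrand
  fun_prop

theorem re_sub_mul_I (z : ℂ) (n : ℕ) (θ : ℝ) : (z - n * θ * Complex.I).re = z.re := by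
  simp

theorem tailMoment_zero_le {τ : ℝ} (hτ : 0 < τ) {j : ℕ} (hj : j ≤ 3) :
    tailMoment τ 0 j ≤ 1024 / τ ^ (j + 1) := by
  refine (tailMoment_le hτ 0 j hj).trans_eq ?_
  simp only [expWeight, CharP.cast_eq_zero, mul_zero, neg_zero, Real.exp_zero, zero_mul, add_zero,
    one_pow, mul_one, pow_succ']
  field_simp

theorem exists_baseIntegrand_sub_le : ∃ C > 0, ∀ (τ : ℝ) (n : ℕ), 0 < τ → τ ≤ 1 / 4 →
    n * τ ^ 2 = Real.pi ^ 2 / 6 → ∀ θ : ℝ, |θ| ≤ Real.pi →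
    ‖baseIntegrand τ n θ - Complex.exp (-(θ ^ 2 / 2 * tailMoment τ 0 2 : ℝ))‖ ≤
      C * (|θ| / τ + |θ| ^ 3 / τ ^ 4) * decayKernel τ θ := by
  obtain ⟨C, hC, hK⟩ := exists_exp_neg_min_le (c := 1 / 400) (by norm_num)
  refine ⟨2048 * C, by positivity, fun τ n hτ hτ' hn θ hθ => ?_⟩
  have hB : ((-(θ ^ 2 / 2 * tailMoment τ 0 2 : ℝ) : ℂ)).re ≤
      -(1 / 400 * min (θ ^ 2 / τ ^ 3) (1 / τ)) := by
    rw [Complex.neg_re, Complex.ofReal_re]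
    exact neg_variance_le hτ hτ' hθ
  have hA : (tailExponent τ 0 θ - n * θ * Complex.I).re ≤
      -(1 / 400 * min (θ ^ 2 / τ ^ 3) (1 / τ)) := by
    rw [re_sub_mul_I]
    exact re_tailExponent_zero_le hτ hτ' hθ
  have h := norm_cexp_sub_cexp_le hA hB
  refine h.trans ?_
  have hdiff : ‖tailExponent τ 0 θ - n * θ * Complex.I - -(θ ^ 2 / 2 * tailMoment τ 0 2 : ℝ)‖ ≤
      2048 * (|θ| / τ + |θ| ^ 3 / τ ^ 4) := by
    have e : tailExponent τ 0 θ - n * θ * Complex.I - -((θ ^ 2 / 2 * tailMoment τ 0 2 : ℝ) : ℂ) =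
        (tailExponent τ 0 θ - (θ * tailMoment τ 0 1 : ℝ) * Complex.I +
          ((θ ^ 2 / 2 * tailMoment τ 0 2 : ℝ) : ℂ)) +
        ((θ * (tailMoment τ 0 1 - n) : ℝ) : ℂ) * Complex.I := by push_cast; ring
    rw [e]
    refine (norm_add_le _ _).trans ?_
    have h1 := norm_tailExponent_sub_quadratic_le hτ 0 θ
    have h3 := tailMoment_zero_le hτ (j := 3) le_rfl
    have hn' : (n : ℝ) = Real.pi ^ 2 / 6 / τ ^ 2 := by
      rw [← hn]; field_simp
    have h2 := abs_mean_sub_le hτ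
    rw [← hn'] at h2
    rw [norm_mul, Complex.norm_I, mul_one, Complex.norm_real, Real.norm_eq_abs, abs_mul]
    have h4 : 2 * |θ| ^ 3 * tailMoment τ 0 3 ≤ 2048 * (|θ| ^ 3 / τ ^ 4) := by
      calc _ ≤ 2 * |θ| ^ 3 * (1024 / τ ^ 4) := by gcongr
        _ = _ := by ring
    have h5 : |θ| * |tailMoment τ 0 1 - n| ≤ 2048 * (|θ| / τ) := by
      calc _ ≤ |θ| * (4 / τ) := by gcongr
        _ = 4 * (|θ| / τ) := by ring
        _ ≤ _ := by
          have : 0 ≤ |θ| / τ := by positivity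
          linarith
    linarith
  have hk := decayKernel_nonneg hτ θ
  calc _ ≤ (C * decayKernel τ θ) * (2048 * (|θ| / τ + |θ| ^ 3 / τ ^ 4)) :=
        mul_le_mul (hK τ θ hτ hθ) hdiff (norm_nonneg _) (by positivity)
    _ = _ := by ring

theorem integral_odd_eq_zero {f : ℝ → ℂ} (hf : ∀ θ, f (-θ) = -f θ) (a : ℝ) :
    ∫ θ in (-a)..a, f θ = 0 := by
  have h := intervalIntegral.integral_comp_neg (a := -a) (b := a) f
  simp only [hf, neg_neg, intervalIntegral.integral_neg] at h
  have h2 : (2 : ℂ) * ∫ θ in (-a)..a, f θ = 0 := by linear_combination -h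
  simpa using h2

theorem gaussian_integral_ge {τ : ℝ} (hτ : 0 < τ) (hτ' : τ ≤ 1 / 4) :
    Real.exp (-512) * scale τ ≤
      ∫ θ in (-Real.pi)..Real.pi, Real.exp (-(θ ^ 2 / 2 * tailMoment τ 0 2)) := by
  have hr := scale_pos hτ
  have hr1 : scale τ ≤ 1 := by
    have h2 := scale_sq hτ
    have : τ ^ 3 ≤ 1 := pow_le_one₀ hτ.le (by linarith)
    nlinarith
  have hπ := Real.pi_gt_three
  have hcont : Continuous fun θ : ℝ => Real.exp (-(θ ^ 2 / 2 * tailMoment τ 0 2)) := by fun_prop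
  have h1 : ∫ θ in (0)..(scale τ), Real.exp (-(θ ^ 2 / 2 * tailMoment τ 0 2)) ≤
      ∫ θ in (-Real.pi)..Real.pi, Real.exp (-(θ ^ 2 / 2 * tailMoment τ 0 2)) :=
    intervalIntegral.integral_mono_interval (by linarith) hr.le (by linarith)
      (Eventually.of_forall fun θ => (Real.exp_pos _).le) (hcont.intervalIntegrable _ _)
  refine le_trans ?_ h1
  have h2 : ∫ θ in (0)..(scale τ), Real.exp (-512) ≤
      ∫ θ in (0)..(scale τ), Real.exp (-(θ ^ 2 / 2 * tailMoment τ 0 2)) := by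
    refine intervalIntegral.integral_mono_on hr.le (by simp) (hcont.intervalIntegrable _ _)
      fun θ hθ => Real.exp_le_exp.2 (neg_le_neg ?_)
    have h3 := tailMoment_zero_le hτ (j := 2) (by norm_num)
    have h4 : θ ^ 2 ≤ τ ^ 3 := by
      rw [← scale_sq hτ]; exact pow_le_pow_left₀ hθ.1 hθ.2 2
    have h5 := tailMoment_nonneg hτ 0 2
    calc θ ^ 2 / 2 * tailMoment τ 0 2 ≤ τ ^ 3 / 2 * (1024 / τ ^ 3) := by gcongr
      _ = 512 := by field_simp; norm_num
  simpa [mul_comm] using h2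

theorem exists_base_bounds : ∃ C > 0, ∀ (τ : ℝ) (n : ℕ), 0 < τ → τ ≤ 1 / 4 →
    n * τ ^ 2 = Real.pi ^ 2 / 6 →
    Real.exp (-512) * scale τ - C * τ ^ 2 ≤
      ‖∫ θ in (-Real.pi)..Real.pi, baseIntegrand τ n θ‖ ∧
    ‖∫ θ in (-Real.pi)..Real.pi, (θ : ℂ) * baseIntegrand τ n θ‖ ≤ C * (τ ^ 2 * scale τ) := by
  obtain ⟨C, hC, h⟩ := exists_baseIntegrand_sub_le
  refine ⟨2 * C * Real.pi, by positivity, fun τ n hτ hτ' hn => ?_⟩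
  set g : ℝ → ℂ := fun θ => Complex.exp (-(θ ^ 2 / 2 * tailMoment τ 0 2 : ℝ)) with hg
  have hgc : Continuous g := by rw [hg]; fun_prop
  have hfc := continuous_baseIntegrand hτ n
  have hr := scale_pos hτ
  have hr2 := scale_sq hτ
  have hbound : ∀ θ, |θ| ≤ Real.pi → ‖baseIntegrand τ n θ - g θ‖ ≤
      C / τ * |θ| ^ 1 * decayKernel τ θ + C / τ ^ 4 * |θ| ^ 3 * decayKernel τ θ := by
    intro θ hθ
    refine (h τ n hτ hτ' hn θ hθ).trans_eq ?_
    ring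
  have key : ∀ (i : ℕ), i ≤ 1 → ∀ f : ℝ → ℂ, (∀ θ, |θ| ≤ Real.pi → ‖f θ‖ ≤
      |θ| ^ i * ‖baseIntegrand τ n θ - g θ‖) → ‖∫ θ in (-Real.pi)..Real.pi, f θ‖ ≤
      2 * C * Real.pi * (τ ^ 2 * scale τ ^ i) := by
    intro i hi f hf
    have hmono := intervalIntegral.norm_integral_le_of_norm_le (μ := volume)
      (a := -Real.pi) (b := Real.pi) (f := f)
      (g := fun θ => (C / τ * scale τ ^ (1 + i) + C / τ ^ 4 * scale τ ^ (3 + i)) *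
        (1 / (1 + (θ / scale τ) ^ 2)))
      (by linarith [Real.pi_pos]) (Eventually.of_forall fun θ hθ => ?_) ?_
    · refine hmono.trans ?_
      rw [intervalIntegral.integral_const_mul]
      calc _ ≤ (C / τ * scale τ ^ (1 + i) + C / τ ^ 4 * scale τ ^ (3 + i)) *
            (scale τ * Real.pi) := by
            gcongr; exact integral_lorentz_le hr
        _ = C * Real.pi * scale τ ^ i * (scale τ ^ 2 / τ + (scale τ ^ 2) ^ 2 / τ ^ 4) := by ring
        _ = _ := by rw [hr2]; field_simp; ring
    · have hθ' := abs_le.2 ⟨hθ.1.le, hθ.2⟩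
      refine (hf θ hθ').trans ?_
      have h1 := abs_pow_mul_decayKernel_le hτ θ (j := 1 + i) (by omega)
      have h3 := abs_pow_mul_decayKernel_le hτ θ (j := 3 + i) (by omega)
      calc |θ| ^ i * ‖baseIntegrand τ n θ - g θ‖ ≤ |θ| ^ i *
            (C / τ * |θ| ^ 1 * decayKernel τ θ + C / τ ^ 4 * |θ| ^ 3 * decayKernel τ θ) := by
            gcongr; exact hbound θ hθ'
        _ = C / τ * (|θ| ^ (1 + i) * decayKernel τ θ) +
            C / τ ^ 4 * (|θ| ^ (3 + i) * decayKernel τ θ) := by ring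
        _ ≤ C / τ * (scale τ ^ (1 + i) * (1 / (1 + (θ / scale τ) ^ 2))) +
            C / τ ^ 4 * (scale τ ^ (3 + i) * (1 / (1 + (θ / scale τ) ^ 2))) := by gcongr
        _ = _ := by ring
    · refine Continuous.intervalIntegrable ?_ _ _
      refine continuous_const.mul (continuous_const.div (by fun_prop) fun θ => ?_)
      positivity
  constructor
  · have h0 := key 0 (by norm_num) (fun θ => baseIntegrand τ n θ - g θ) fun θ _ => by simp
    rw [intervalIntegral.integral_sub (hfc.intervalIntegrable _ _) (hgc.intervalIntegrable _ _)]
      at h0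
    have hgauss := gaussian_integral_ge hτ hτ'
    have hgi : ∫ θ in (-Real.pi)..Real.pi, g θ =
        ((∫ θ in (-Real.pi)..Real.pi, Real.exp (-(θ ^ 2 / 2 * tailMoment τ 0 2)) : ℝ) : ℂ) := by
      rw [← intervalIntegral.integral_ofReal]
      simp [hg]
    have hgn : Real.exp (-512) * scale τ ≤ ‖∫ θ in (-Real.pi)..Real.pi, g θ‖ := by
      rw [hgi, Complex.norm_real]
      exact hgauss.trans (le_abs_self _)
    have := norm_sub_norm_le (∫ θ in (-Real.pi)..Real.pi, g θ)
      (∫ θ in (-Real.pi)..Real.pi, baseIntegrand τ n θ)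
    rw [norm_sub_rev] at this
    rw [pow_zero, mul_one] at h0
    linarith
  · have h1 := key 1 le_rfl (fun θ => (θ : ℂ) * baseIntegrand τ n θ - θ * g θ) fun θ _ => by
      rw [← mul_sub, norm_mul, Complex.norm_real, Real.norm_eq_abs, pow_one]
    rw [intervalIntegral.integral_sub (Continuous.intervalIntegrable (by fun_prop) _ _)
      (Continuous.intervalIntegrable (by fun_prop) _ _),
      integral_odd_eq_zero (f := fun θ : ℝ => (θ : ℂ) * g θ) (fun θ => by simp [hg]), sub_zero,
      pow_one] at h1
    exact h1

/-! ### The perturbed integral -/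

set_option maxHeartbeats 1600000 in
theorem exists_boxIntegral_sub_le : ∃ C > 0, ∃ δ > 0, ∀ (τ : ℝ) (n : ℕ), 0 < τ → τ ≤ 1 / 4 →
    n * τ ^ 2 = Real.pi ^ 2 / 6 → ∀ (a b N : ℕ) (V : ℝ), N ≤ n → 1 ≤ V →
    (n - N) * τ + (expWeight τ a / τ + expWeight τ b / τ) * (1 + (a + b) * τ) ≤ V →
    (expWeight τ a / τ + expWeight τ b / τ) * (1 + (a + b) * τ) ^ 2 ≤ V ^ 2 →
    V ^ 2 * τ ≤ δ →
    ‖boxIntegral τ a b N - ∫ θ in (-Real.pi)..Real.pi, baseIntegrand τ n θ‖ ≤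
      C * (V ^ 2 * τ * scale τ) := by
  obtain ⟨C₁, hC₁, hK⟩ := exists_exp_neg_min_le (c := 1 / 800) (by norm_num)
  obtain ⟨C₂, hC₂, hbase⟩ := exists_base_bounds
  refine ⟨C₁ * 4096 ^ 2 * Real.pi + C₁ * 4096 * Real.pi + 4096 * C₂, by positivity,
    1 / 1638400, by norm_num, fun τ n hτ hτ' hn a b N V hN hV1 hW hZ hδ => ?_⟩
  obtain ⟨-, hlin⟩ := hbase τ n hτ hτ' hn
  have hr := scale_pos hτ
  have hr2 := scale_sq hτ
  set sa := expWeight τ a / τ with hsa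
  set sb := expWeight τ b / τ with hsb
  set Z := 1 + ((a : ℝ) + b) * τ with hZdef
  have hsa0 : 0 ≤ sa := div_nonneg (expWeight_nonneg _ _) hτ.le
  have hsb0 : 0 ≤ sb := div_nonneg (expWeight_nonneg _ _) hτ.le
  have hZ1 : 1 ≤ Z := by
    have : 0 ≤ ((a : ℝ) + b) * τ := by positivity
    linarith
  have hNn : (0 : ℝ) ≤ n - N := by
    have : (N : ℝ) ≤ n := by exact_mod_cast hN
    linarith
  have hD0 : 0 ≤ ((n : ℝ) - N) * τ := mul_nonneg hNn hτ.le
  have hsZ0 : 0 ≤ (sa + sb) * Z := by positivity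
  -- moments
  have mom : ∀ (c : ℕ) (s : ℝ) (j : ℕ), j ≤ 3 → expWeight τ c / τ ≤ s → c ≤ a + b →
      tailMoment τ c j ≤ 1024 * (s * Z ^ j / τ ^ j) := by
    intro c s j hj hs hc
    refine (tailMoment_le hτ c j hj).trans ?_
    have h1 : (1 + c * τ) ≤ Z := by
      have : (c : ℝ) ≤ a + b := by exact_mod_cast hc
      rw [hZdef]; gcongr
    have h0 : 0 ≤ expWeight τ c / τ := div_nonneg (expWeight_nonneg _ _) hτ.le
    have hs0 : 0 ≤ s := h0.trans hs
    gcongr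
  have hab : expWeight τ (a + b) / τ ≤ sa :=
    div_le_div_of_nonneg_right (expWeight_anti hτ.le (Nat.le_add_right a b)) hτ.le
  have a1 := mom a sa 1 (by norm_num) le_rfl (Nat.le_add_right _ _)
  have b1 := mom b sb 1 (by norm_num) le_rfl (Nat.le_add_left _ _)
  have c1 := mom (a + b) sa 1 (by norm_num) hab le_rfl
  have a2 := mom a sa 2 (by norm_num) le_rfl (Nat.le_add_right _ _)
  have b2 := mom b sb 2 (by norm_num) le_rfl (Nat.le_add_left _ _)
  have c2 := mom (a + b) sa 2 (by norm_num) hab le_rfl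
  have na1 := tailMoment_nonneg hτ a 1
  have nb1 := tailMoment_nonneg hτ b 1
  have nc1 := tailMoment_nonneg hτ (a + b) 1
  have hsum1 : (n - N) + tailMoment τ a 1 + tailMoment τ b 1 + tailMoment τ (a + b) 1 ≤
      4096 * V / τ := by
    rw [le_div_iff₀ hτ]
    have e : ∀ s : ℝ, 1024 * (s * Z ^ 1 / τ ^ 1) * τ = 1024 * (s * Z) := fun s => by field_simp
    have a1' := mul_le_mul_of_nonneg_right a1 hτ.le
    have b1' := mul_le_mul_of_nonneg_right b1 hτ.le
    have c1' := mul_le_mul_of_nonneg_right c1 hτ.le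
    rw [e] at a1' b1' c1'
    have hb0 : 0 ≤ sb * Z := by positivity
    have ha0 : 0 ≤ sa * Z := by positivity
    linarith
  have hsum2 : tailMoment τ a 2 + tailMoment τ b 2 + tailMoment τ (a + b) 2 ≤
      4096 * V ^ 2 / τ ^ 2 := by
    rw [le_div_iff₀ (by positivity)]
    have e : ∀ s : ℝ, 1024 * (s * Z ^ 2 / τ ^ 2) * τ ^ 2 = 1024 * (s * Z ^ 2) := fun s => by
      field_simp
    have a2' := mul_le_mul_of_nonneg_right a2 (sq_nonneg τ)
    have b2' := mul_le_mul_of_nonneg_right b2 (sq_nonneg τ)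
    have c2' := mul_le_mul_of_nonneg_right c2 (sq_nonneg τ)
    rw [e] at a2' b2' c2'
    have hb0 : 0 ≤ sb * Z ^ 2 := by positivity
    have ha0 : 0 ≤ sa * Z ^ 2 := by positivity
    linarith
  -- the perturbation
  set h : ℝ → ℂ := fun θ => (((n : ℝ) - N : ℝ) * θ * Complex.I - tailExponent τ a θ -
    tailExponent τ b θ + tailExponent τ (a + b) θ) with hh
  set L : ℝ := (n - N) - tailMoment τ a 1 - tailMoment τ b 1 + tailMoment τ (a + b) 1 with hL
  have hLabs : |L| ≤ 4096 * V / τ := by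
    rw [abs_le]; constructor <;> linarith
  have hnorm : ∀ θ, ‖h θ‖ ≤ |θ| * (4096 * V / τ) := by
    intro θ
    have h1 := norm_tailExponent_le hτ a θ
    have h2 := norm_tailExponent_le hτ b θ
    have h3 := norm_tailExponent_le hτ (a + b) θ
    have h4 : ‖(((n : ℝ) - N : ℝ) : ℂ) * θ * Complex.I‖ = |θ| * (n - N) := by
      rw [norm_mul, norm_mul, Complex.norm_I, Complex.norm_real, Complex.norm_real,
        Real.norm_of_nonneg hNn, Real.norm_eq_abs]
      ring
    calc ‖h θ‖ ≤ ‖(((n : ℝ) - N : ℝ) : ℂ) * θ * Complex.I‖ + ‖tailExponent τ a θ‖ +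
          ‖tailExponent τ b θ‖ + ‖tailExponent τ (a + b) θ‖ :=
          (norm_add_le _ _).trans (add_le_add_left ((norm_sub_le _ _).trans
            (add_le_add_left (norm_sub_le _ _) _)) _)
      _ ≤ |θ| * ((n - N) + tailMoment τ a 1 + tailMoment τ b 1 + tailMoment τ (a + b) 1) := by
          rw [h4]; linarith
      _ ≤ _ := by gcongr
  have hquad : ∀ θ : ℝ, ‖h θ - L * θ * Complex.I‖ ≤ |θ| ^ 2 * (4096 * V ^ 2 / τ ^ 2) := by
    intro θ
    have h1 := norm_tailExponent_sub_linear_le hτ a θ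
    have h2 := norm_tailExponent_sub_linear_le hτ b θ
    have h3 := norm_tailExponent_sub_linear_le hτ (a + b) θ
    have e : h θ - L * θ * Complex.I =
        -(tailExponent τ a θ - (θ * tailMoment τ a 1 : ℝ) * Complex.I) -
        (tailExponent τ b θ - (θ * tailMoment τ b 1 : ℝ) * Complex.I) +
        (tailExponent τ (a + b) θ - (θ * tailMoment τ (a + b) 1 : ℝ) * Complex.I) := by
      rw [hh, hL]; push_cast; ring
    rw [e]
    refine (norm_add_le _ _).trans ?_
    have h4 := norm_sub_le (-(tailExponent τ a θ - (θ * tailMoment τ a 1 : ℝ) * Complex.I))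
      (tailExponent τ b θ - (θ * tailMoment τ b 1 : ℝ) * Complex.I)
    rw [norm_neg] at h4
    have h5 := mul_le_mul_of_nonneg_left hsum2 (sq_nonneg θ)
    rw [sq_abs]
    linarith
  -- control of the real part
  have hqa : ∀ c : ℕ, expWeight τ c / τ ≤ sa + sb → expWeight τ c ≤ 1 / 2 := by
    intro c hc
    have h1 : expWeight τ c / τ ≤ V ^ 2 := by
      refine hc.trans (le_trans ?_ hZ)
      exact le_mul_of_one_le_right (by positivity) (one_le_pow₀ hZ1)
    rw [div_le_iff₀ hτ] at h1
    linarith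
  have hre1 : ∀ (c : ℕ) (θ : ℝ), expWeight τ c / τ ≤ sa + sb →
      -(tailExponent τ c θ).re ≤ 4 * (expWeight τ c / τ) := by
    intro c θ hc
    have hq := hqa c hc
    have h1 := (Complex.abs_re_le_norm _).trans (norm_tailExponent_le_ratio hτ c θ)
    have h2 := tsum_tail_ratio_le hτ (a := c) (by linarith)
    have h3 : 1 / (1 - expWeight τ c) ≤ 2 := by
      rw [div_le_iff₀ (by linarith)]; linarith
    have h4 : 0 ≤ expWeight τ c / τ := div_nonneg (expWeight_nonneg _ _) hτ.le
    have h5 := mul_le_mul_of_nonneg_left h3 h4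
    have h6 := neg_abs_le (tailExponent τ c θ).re
    linarith
  have hre : ∀ θ, (h θ).re ≤ 1 / 800 * min (θ ^ 2 / τ ^ 3) (1 / τ) := by
    intro θ
    have e : (h θ).re = -(tailExponent τ a θ).re - (tailExponent τ b θ).re +
        (tailExponent τ (a + b) θ).re := by
      simp [hh]
    have h0 := re_tailExponent_nonpos hτ (a + b) θ
    rw [e, mul_min_of_nonneg _ _ (by norm_num)]
    refine le_min ?_ ?_
    · have h1 := (neg_le_abs _).trans (abs_re_tailExponent_le hτ a θ)
      have h2 := (neg_le_abs _).trans (abs_re_tailExponent_le hτ b θ)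
      have h3 : tailMoment τ a 2 + tailMoment τ b 2 ≤ 1 / 800 / τ ^ 3 := by
        have hV2 : 1024 * ((sa + sb) * Z ^ 2) ≤ 1024 * V ^ 2 := by linarith
        rw [le_div_iff₀ (by positivity)]
        have e2 : 1024 * (sa * Z ^ 2 / τ ^ 2) * τ ^ 3 + 1024 * (sb * Z ^ 2 / τ ^ 2) * τ ^ 3 =
          1024 * ((sa + sb) * Z ^ 2) * τ := by field_simp
        have := mul_le_mul_of_nonneg_right hV2 hτ.le
        have a2' := mul_le_mul_of_nonneg_right a2 (pow_pos hτ 3).le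
        have b2' := mul_le_mul_of_nonneg_right b2 (pow_pos hτ 3).le
        linarith
      have h4 := mul_le_mul_of_nonneg_left h3 (sq_nonneg θ)
      have e3 : θ ^ 2 * (1 / 800 / τ ^ 3) = 1 / 800 * (θ ^ 2 / τ ^ 3) := by ring
      linarith
    · have h1 := hre1 a θ (by linarith)
      have h2 := hre1 b θ (by linarith)
      have h3 : sa + sb ≤ V ^ 2 :=
        le_trans (le_mul_of_one_le_right (by positivity) (one_le_pow₀ hZ1)) hZ
      have h4 : 4 * V ^ 2 ≤ 1 / 800 * (1 / τ) := by
        rw [mul_one_div, le_div_iff₀ hτ]; linarith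
      linarith
  have hBre : ∀ θ, |θ| ≤ Real.pi → ‖baseIntegrand τ n θ‖ *
      Real.exp (1 / 800 * min (θ ^ 2 / τ ^ 3) (1 / τ)) ≤ C₁ * decayKernel τ θ := by
    intro θ hθ
    refine le_trans ?_ (hK τ θ hτ hθ)
    rw [baseIntegrand, Complex.norm_exp, re_sub_mul_I, ← Real.exp_add]
    have := re_tailExponent_zero_le hτ hτ' hθ
    exact Real.exp_le_exp.2 (by linarith)
  have hmin0 : ∀ θ : ℝ, 0 ≤ 1 / 800 * min (θ ^ 2 / τ ^ 3) (1 / τ) := fun θ => by positivity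
  have hB1 : ∀ θ, |θ| ≤ Real.pi → ‖baseIntegrand τ n θ‖ ≤ C₁ * decayKernel τ θ := fun θ hθ =>
    le_trans (le_mul_of_one_le_right (norm_nonneg _) (Real.one_le_exp (hmin0 θ))) (hBre θ hθ)
  -- splitting the difference
  have hcb := continuous_baseIntegrand hτ n
  have hch : Continuous h := by
    have := continuous_tailExponent hτ a
    have := continuous_tailExponent hτ b
    have := continuous_tailExponent hτ (a + b)
    rw [hh]; fun_prop
  have hbox : boxIntegral τ a b N =
      ∫ θ in (-Real.pi)..Real.pi, baseIntegrand τ n θ * Complex.exp (h θ) := by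
    rw [boxIntegral]
    refine intervalIntegral.integral_congr fun θ _ => ?_
    simp only [baseIntegrand, hh, ← Complex.exp_add]
    congr 1
    push_cast
    ring
  have hdec : boxIntegral τ a b N - ∫ θ in (-Real.pi)..Real.pi, baseIntegrand τ n θ =
      (∫ θ in (-Real.pi)..Real.pi, baseIntegrand τ n θ * (Complex.exp (h θ) - 1 - h θ)) +
      (∫ θ in (-Real.pi)..Real.pi, baseIntegrand τ n θ * (h θ - L * θ * Complex.I)) +
      (L * Complex.I) * ∫ θ in (-Real.pi)..Real.pi, (θ : ℂ) * baseIntegrand τ n θ := by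
    rw [hbox, ← intervalIntegral.integral_const_mul,
      ← intervalIntegral.integral_sub (Continuous.intervalIntegrable (by fun_prop) _ _)
        (Continuous.intervalIntegrable (by fun_prop) _ _),
      ← intervalIntegral.integral_add (Continuous.intervalIntegrable (by fun_prop) _ _)
        (Continuous.intervalIntegrable (by fun_prop) _ _),
      ← intervalIntegral.integral_add (Continuous.intervalIntegrable (by fun_prop) _ _)
        (Continuous.intervalIntegrable (by fun_prop) _ _)]
    refine intervalIntegral.integral_congr fun θ _ => ?_
    ring
  have i1 : ‖∫ θ in (-Real.pi)..Real.pi, baseIntegrand τ n θ * (Complex.exp (h θ) - 1 - h θ)‖ ≤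
      C₁ * (4096 * V / τ) ^ 2 * Real.pi * scale τ ^ (2 + 1) := by
    refine norm_integral_le_of_decay hτ (by positivity) (by norm_num) fun θ hθ => ?_
    rw [norm_mul]
    calc _ ≤ ‖baseIntegrand τ n θ‖ * (Real.exp (1 / 800 * min (θ ^ 2 / τ ^ 3) (1 / τ)) *
            ‖h θ‖ ^ 2) := by
          gcongr; exact norm_cexp_sub_one_sub_le (hmin0 θ) (hre θ)
      _ = (‖baseIntegrand τ n θ‖ * Real.exp (1 / 800 * min (θ ^ 2 / τ ^ 3) (1 / τ))) *
            ‖h θ‖ ^ 2 := by ring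
      _ ≤ (C₁ * decayKernel τ θ) * (|θ| * (4096 * V / τ)) ^ 2 := by
          have := decayKernel_nonneg hτ θ
          exact mul_le_mul (hBre θ hθ) (pow_le_pow_left₀ (norm_nonneg _) (hnorm θ) 2)
            (by positivity) (by positivity)
      _ = _ := by ring
  have i2 : ‖∫ θ in (-Real.pi)..Real.pi, baseIntegrand τ n θ * (h θ - L * θ * Complex.I)‖ ≤
      C₁ * (4096 * V ^ 2 / τ ^ 2) * Real.pi * scale τ ^ (2 + 1) := by
    refine norm_integral_le_of_decay hτ (by positivity) (by norm_num) fun θ hθ => ?_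
    rw [norm_mul]
    calc _ ≤ (C₁ * decayKernel τ θ) * (|θ| ^ 2 * (4096 * V ^ 2 / τ ^ 2)) := by
          have := decayKernel_nonneg hτ θ
          exact mul_le_mul (hB1 θ hθ) (hquad θ) (norm_nonneg _) (by positivity)
      _ = _ := by ring
  have i3 : ‖(L * Complex.I) * ∫ θ in (-Real.pi)..Real.pi, (θ : ℂ) * baseIntegrand τ n θ‖ ≤
      (4096 * V / τ) * (C₂ * (τ ^ 2 * scale τ)) := by
    rw [norm_mul, norm_mul, Complex.norm_I, mul_one, Complex.norm_real, Real.norm_eq_abs]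
    gcongr
  rw [hdec]
  refine (norm_add_le _ _).trans ((add_le_add_left (norm_add_le _ _) _).trans ?_)
  have hr3 : scale τ ^ (2 + 1) = τ ^ 3 * scale τ := by rw [pow_succ, hr2]
  rw [hr3] at i1 i2
  have e1 : C₁ * (4096 * V / τ) ^ 2 * Real.pi * (τ ^ 3 * scale τ) =
      C₁ * 4096 ^ 2 * Real.pi * (V ^ 2 * τ * scale τ) := by field_simp
  have e2 : C₁ * (4096 * V ^ 2 / τ ^ 2) * Real.pi * (τ ^ 3 * scale τ) =
      C₁ * 4096 * Real.pi * (V ^ 2 * τ * scale τ) := by field_simp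
  have e3 : (4096 * V / τ) * (C₂ * (τ ^ 2 * scale τ)) ≤
      4096 * C₂ * (V ^ 2 * τ * scale τ) := by
    calc _ = 4096 * C₂ * (V * τ * scale τ) := by field_simp
      _ ≤ _ := by
        gcongr
        exact le_self_pow₀ hV1 (by norm_num)
  linarith

/-! ### Counting diagrams in a box -/

/-- The tail sum controlling the Euler products. -/
noncomputable def tailRatio (τ : ℝ) (a : ℕ) : ℝ :=
  ∑' l : ℕ, expWeight τ (a + l + 1) / (1 - expWeight τ (a + l + 1))

theorem ratio_nonneg {τ : ℝ} (hτ : 0 < τ) {i : ℕ} (hi : 0 < i) :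
    0 ≤ expWeight τ i / (1 - expWeight τ i) :=
  div_nonneg (expWeight_nonneg _ _) (by linarith [expWeight_lt_one hτ hi])

theorem tailRatio_nonneg {τ : ℝ} (hτ : 0 < τ) (a : ℕ) : 0 ≤ tailRatio τ a :=
  tsum_nonneg fun l => ratio_nonneg hτ (by omega)

theorem eulerProd_anti {τ : ℝ} (hτ : 0 < τ) : Antitone (eulerProd τ) :=
  antitone_nat_of_succ_le fun a => by
    rw [eulerProd, Finset.prod_range_succ]
    refine mul_le_of_le_one_right (eulerProd_pos hτ a).le ?_
    linarith [expWeight_nonneg τ (a + 1)]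

theorem exp_neg_ratio_le {x : ℝ} (h1 : x < 1) : Real.exp (-(x / (1 - x))) ≤ 1 - x := by
  have h2 : 0 < 1 - x := by linarith
  have h := Real.add_one_le_exp (x / (1 - x))
  have e : x / (1 - x) + 1 = (1 - x)⁻¹ := by field_simp; ring
  rw [e] at h
  rw [Real.exp_neg]
  exact inv_le_of_inv_le₀ h2 h

theorem eulerProd_add_ge {τ : ℝ} (hτ : 0 < τ) (b d : ℕ) :
    eulerProd τ b * Real.exp (-tailRatio τ b) ≤ eulerProd τ (b + d) := by
  rw [eulerProd, eulerProd, Finset.prod_range_add]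
  refine mul_le_mul_of_nonneg_left ?_ (eulerProd_pos hτ b).le
  have h1 : ∑ l ∈ Finset.range d, expWeight τ (b + l + 1) / (1 - expWeight τ (b + l + 1)) ≤
      tailRatio τ b :=
    (summable_ratio hτ b).sum_le_tsum _ fun l _ => ratio_nonneg hτ (by omega)
  refine (Real.exp_le_exp.2 (neg_le_neg h1)).trans ?_
  rw [← Finset.sum_neg_distrib, Real.exp_sum]
  exact Finset.prod_le_prod (fun l _ => (Real.exp_pos _).le)
    fun l _ => exp_neg_ratio_le (expWeight_lt_one hτ (by omega))

theorem eulerProd_ge {τ : ℝ} (hτ : 0 < τ) (b c : ℕ) :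
    eulerProd τ b * Real.exp (-tailRatio τ b) ≤ eulerProd τ c := by
  rcases le_total b c with h | h
  · obtain ⟨d, rfl⟩ := Nat.exists_eq_add_of_le h
    exact eulerProd_add_ge hτ b d
  · refine (mul_le_of_le_one_right (eulerProd_pos hτ b).le ?_).trans (eulerProd_anti hτ h)
    exact Real.exp_le_one_iff.2 (by linarith [tailRatio_nonneg hτ b])

theorem boxValue_ge {τ : ℝ} (hτ : 0 < τ) (a b n : ℕ) :
    Real.exp (-(tailRatio τ a + tailRatio τ b)) * boxValue τ n n ≤ boxValue τ a b := by
  have hn := boxValue_mul τ n n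
  have hab := boxValue_mul τ a b
  have pa := eulerProd_pos hτ a
  have pb := eulerProd_pos hτ b
  have pn := eulerProd_pos hτ n
  have h1 : boxValue τ n n * eulerProd τ n ≤ 1 := by
    have : eulerProd τ (n + n) ≤ eulerProd τ n := eulerProd_anti hτ (Nat.le_add_right _ _)
    rw [← hn] at this
    exact le_of_mul_le_mul_right (by linarith) pn
  have h2 := eulerProd_add_ge hτ a b
  have h3 := eulerProd_ge hτ b n
  have ea := Real.exp_pos (-tailRatio τ a)
  have eb := Real.exp_pos (-tailRatio τ b)
  have hv := boxValue_pos hτ n n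
  rw [neg_add, Real.exp_add]
  refine le_of_mul_le_mul_right ?_ (mul_pos pa pb)
  calc Real.exp (-tailRatio τ a) * Real.exp (-tailRatio τ b) * boxValue τ n n *
        (eulerProd τ a * eulerProd τ b)
      = (eulerProd τ a * Real.exp (-tailRatio τ a)) * boxValue τ n n *
        (eulerProd τ b * Real.exp (-tailRatio τ b)) := by ring
    _ ≤ eulerProd τ (a + b) * boxValue τ n n * eulerProd τ n := by
        have := eulerProd_pos hτ (a + b)
        gcongr
    _ = eulerProd τ (a + b) * (boxValue τ n n * eulerProd τ n) := by ring
    _ ≤ eulerProd τ (a + b) * 1 := by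
        have := eulerProd_pos hτ (a + b)
        gcongr
    _ = _ := by rw [← hab]; ring

theorem boxValue_mul_norm_boxIntegral {τ : ℝ} (hτ : 0 < τ) (a b N : ℕ) :
    boxValue τ a b * ‖boxIntegral τ a b N‖ =
      2 * Real.pi * ((boxDiagrams a b N).ncard * expWeight τ N) := by
  have h := congrArg norm (boxValue_mul_boxIntegral hτ a b N)
  rw [norm_mul, Complex.norm_real, Complex.norm_real, Real.norm_of_nonneg (boxValue_pos hτ a b).le,
    Real.norm_of_nonneg] at h
  · exact h
  · have := expWeight_nonneg τ N
    have := Real.pi_pos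
    positivity

theorem exists_square_box_small : ∃ τ₀ > 0, ∀ (τ : ℝ) (n : ℕ), 0 < τ → τ ≤ τ₀ →
    n * τ ^ 2 = Real.pi ^ 2 / 6 →
    (expWeight τ n / τ + expWeight τ n / τ) * (1 + (n + n) * τ) ^ 2 ≤ 1 := by
  obtain ⟨C, hC, h⟩ := exists_exp_neg_mul_le (c := 1) one_pos
  refine ⟨1 / (50 * C), by positivity, fun τ n hτ hτ' hn => ?_⟩
  have hp1 : 1 ≤ Real.pi ^ 2 / 6 := by nlinarith [Real.pi_gt_three]
  have hp2 : Real.pi ^ 2 / 6 ≤ 2 := by nlinarith [Real.pi_lt_d2, Real.pi_pos]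
  have hnτ : n * τ = Real.pi ^ 2 / 6 * (1 / τ) := by rw [← hn]; field_simp
  set u := 1 / τ with hu
  have hu0 : 0 < u := by positivity
  have h1 : expWeight τ n ≤ C / (1 + u) ^ 9 := by
    refine le_trans (Real.exp_le_exp.2 ?_) (h u hu0.le)
    rw [mul_comm τ, hnτ]
    nlinarith
  have h2 : 1 + ((n : ℝ) + n) * τ ≤ 5 * (1 + u) := by
    have : ((n : ℝ) + n) * τ = 2 * (Real.pi ^ 2 / 6 * u) := by rw [← hnτ]; ring
    rw [this]
    nlinarith
  have h20 : 0 ≤ 1 + ((n : ℝ) + n) * τ := by positivity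
  have h3 : expWeight τ n / τ ≤ C / (1 + u) ^ 9 * (1 + u) := by
    rw [div_eq_mul_one_div]
    have := expWeight_nonneg τ n
    gcongr
    linarith
  calc (expWeight τ n / τ + expWeight τ n / τ) * (1 + (n + n) * τ) ^ 2
      ≤ (C / (1 + u) ^ 9 * (1 + u) + C / (1 + u) ^ 9 * (1 + u)) * (5 * (1 + u)) ^ 2 := by
        gcongr
    _ = 50 * C / (1 + u) ^ 6 := by field_simp; ring
    _ ≤ 50 * C / (1 + u) := by
        gcongr
        exact le_self_pow₀ (by linarith) (by norm_num)
    _ ≤ 50 * C / u := by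
        gcongr
        linarith
    _ = 50 * C * τ := by rw [hu]; field_simp
    _ ≤ 50 * C * (1 / (50 * C)) := by gcongr
    _ = 1 := by field_simp

theorem exists_card_boxDiagrams_ge : ∃ C > 0, ∃ δ > 0, ∃ τ₀ > 0, ∀ (τ : ℝ) (n : ℕ), 0 < τ →
    τ ≤ τ₀ → n * τ ^ 2 = Real.pi ^ 2 / 6 → ∀ (a b N : ℕ) (V : ℝ), N ≤ n → 1 ≤ V →
    (n - N) * τ + (expWeight τ a / τ + expWeight τ b / τ) * (1 + (a + b) * τ) ≤ V →
    (expWeight τ a / τ + expWeight τ b / τ) * (1 + (a + b) * τ) ^ 2 ≤ V ^ 2 →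
    V ^ 2 * τ ≤ δ →
    (1 - C * (V ^ 2 * τ)) * Real.exp (-((n - N) * τ + tailRatio τ a + tailRatio τ b)) *
      Nat.card (DiagramOfArea n) ≤ (boxDiagrams a b N).ncard := by
  obtain ⟨C₁, hC₁, δ, hδ, hbox⟩ := exists_boxIntegral_sub_le
  obtain ⟨C₂, hC₂, hbase⟩ := exists_base_bounds
  obtain ⟨τ₁, hτ₁, hsq⟩ := exists_square_box_small
  set c := Real.exp (-512) / 2 with hc
  have hc0 : 0 < c := by positivity
  refine ⟨2 * C₁ / c, by positivity, δ, hδ, min (min (1 / 4) τ₁) (min δ ((c / C₂) ^ 2)),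
    by positivity, fun τ n hτ hτ0 hn a b N V hN hV1 hW hZ hVδ => ?_⟩
  have hτ4 : τ ≤ 1 / 4 := hτ0.trans ((min_le_left _ _).trans (min_le_left _ _))
  have hτ1 : τ ≤ τ₁ := hτ0.trans ((min_le_left _ _).trans (min_le_right _ _))
  have hτδ : τ ≤ δ := hτ0.trans ((min_le_right _ _).trans (min_le_left _ _))
  have hτc : τ ≤ (c / C₂) ^ 2 := hτ0.trans ((min_le_right _ _).trans (min_le_right _ _))
  have hr := scale_pos hτ
  set m := ‖∫ θ in (-Real.pi)..Real.pi, baseIntegrand τ n θ‖ with hm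
  have hmr : c * scale τ ≤ m := by
    have h := (hbase τ n hτ hτ4 hn).1
    have h2 : Real.sqrt τ ≤ c / C₂ := Real.sqrt_le_iff.2 ⟨by positivity, hτc⟩
    have h3 : C₂ * τ ^ 2 ≤ c * scale τ := by
      calc C₂ * τ ^ 2 = C₂ * (Real.sqrt τ * scale τ) := by
            have h5 := Real.mul_self_sqrt hτ.le
            rw [scale]
            linear_combination -(C₂ * τ) * h5
        _ ≤ C₂ * (c / C₂ * scale τ) := by gcongr
        _ = _ := by field_simp
    have h4 : Real.exp (-512) * scale τ = 2 * (c * scale τ) := by rw [hc]; ring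
    linarith
  set ε := C₁ * (V ^ 2 * τ) with hε
  have hε0 : 0 ≤ ε := by positivity
  have hVsq : 1 ≤ V ^ 2 := one_le_pow₀ hV1
  have h1 : m - ε * scale τ ≤ ‖boxIntegral τ a b N‖ := by
    have h := hbox τ n hτ hτ4 hn a b N V hN hV1 hW hZ hVδ
    have h' := norm_sub_norm_le (∫ θ in (-Real.pi)..Real.pi, baseIntegrand τ n θ)
      (boxIntegral τ a b N)
    rw [norm_sub_rev] at h'
    have e : C₁ * (V ^ 2 * τ * scale τ) = ε * scale τ := by rw [hε]; ring
    linarith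
  have h2 : ‖boxIntegral τ n n n‖ ≤ m + ε * scale τ := by
    have hs := hsq τ n hτ hτ1 hn
    have hs0 : 0 ≤ expWeight τ n / τ + expWeight τ n / τ := by
      have := div_nonneg (expWeight_nonneg τ n) hτ.le
      linarith
    have hz1 : 1 ≤ 1 + ((n : ℝ) + n) * τ := by
      have : 0 ≤ ((n : ℝ) + n) * τ := by positivity
      linarith
    have h := hbox τ n hτ hτ4 hn n n n 1 le_rfl le_rfl ?_ (by simpa using hs) (by simpa using hτδ)
    · have h' := norm_sub_norm_le (boxIntegral τ n n n)
        (∫ θ in (-Real.pi)..Real.pi, baseIntegrand τ n θ)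
      have e : C₁ * (1 ^ 2 * τ * scale τ) ≤ ε * scale τ := by
        rw [hε, one_pow, one_mul, ← mul_assoc]
        gcongr
        nlinarith
      linarith
    · rw [sub_self, zero_mul, zero_add]
      refine le_trans ?_ hs
      exact mul_le_mul_of_nonneg_left (le_self_pow₀ hz1 (by norm_num)) hs0
  have hconst : 2 * C₁ / c * (V ^ 2 * τ) = 2 * ε / c := by rw [hε]; ring
  rw [hconst]
  rcases le_or_gt (1 - 2 * ε / c) 0 with hneg | hpos
  · refine le_trans (mul_nonpos_of_nonpos_of_nonneg
      (mul_nonpos_of_nonpos_of_nonneg hneg (Real.exp_pos _).le) (Nat.cast_nonneg _)) ?_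
    positivity
  · have h3 : (1 - 2 * ε / c) * (m + ε * scale τ) ≤ m - ε * scale τ := by
      have e1 : 2 * ε / c * m ≥ 2 * ε * scale τ := by
        have := mul_le_mul_of_nonneg_left hmr (by positivity : 0 ≤ 2 * ε / c)
        have e2 : 2 * ε / c * (c * scale τ) = 2 * ε * scale τ := by field_simp
        linarith
      have e3 : 0 ≤ 2 * ε / c * (ε * scale τ) := by positivity
      linarith
    have hbn := boxValue_mul_norm_boxIntegral hτ n n n
    have hba := boxValue_mul_norm_boxIntegral hτ a b N
    rw [← card_diagramOfArea] at hbn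
    have hge := boxValue_ge hτ a b n
    have pn := boxValue_pos hτ n n
    have pa := boxValue_pos hτ a b
    set E := Real.exp (-(tailRatio τ a + tailRatio τ b)) with hE
    have hE0 : 0 < E := Real.exp_pos _
    have hqN := expWeight_pos τ N
    have hm0 : 0 ≤ m - ε * scale τ := le_trans (mul_nonneg hpos.le (by positivity)) h3
    have hmain : (1 - 2 * ε / c) * E * (Nat.card (DiagramOfArea n) * expWeight τ n) ≤
        (boxDiagrams a b N).ncard * expWeight τ N := by
      have h2π : 0 < 2 * Real.pi := by positivity
      refine le_of_mul_le_mul_left ?_ h2π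
      rw [← hba]
      calc 2 * Real.pi * ((1 - 2 * ε / c) * E * (Nat.card (DiagramOfArea n) * expWeight τ n))
          = (1 - 2 * ε / c) * E * (boxValue τ n n * ‖boxIntegral τ n n n‖) := by rw [hbn]; ring
        _ ≤ (1 - 2 * ε / c) * E * (boxValue τ n n * (m + ε * scale τ)) := by gcongr
        _ = (E * boxValue τ n n) * ((1 - 2 * ε / c) * (m + ε * scale τ)) := by ring
        _ ≤ boxValue τ a b * (m - ε * scale τ) := by gcongr
        _ ≤ _ := by gcongr
    have hexp : Real.exp (-((n - N) * τ + tailRatio τ a + tailRatio τ b)) * expWeight τ N =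
        E * expWeight τ n := by
      rw [hE, expWeight, expWeight, ← Real.exp_add, ← Real.exp_add]
      ring_nf
    refine le_of_mul_le_mul_right ?_ hqN
    calc _ = (1 - 2 * ε / c) * (Real.exp (-((n - N) * τ + tailRatio τ a + tailRatio τ b)) *
          expWeight τ N) * Nat.card (DiagramOfArea n) := by ring
      _ = (1 - 2 * ε / c) * E * (Nat.card (DiagramOfArea n) * expWeight τ n) := by
          rw [hexp]; ring
      _ ≤ _ := hmain

/-! ### Partial sums of exponential variables -/

instance : IsProbabilityMeasure (expMeasure 1) := isProbabilityMeasure_expMeasure one_pos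

theorem expMeasure_one_eq :
    expMeasure 1 = volume.withDensity (fun x => ENNReal.ofReal (exponentialPDFReal 1 x)) := rfl

theorem exponentialPDFReal_one (x : ℝ) :
    exponentialPDFReal 1 x = if 0 ≤ x then Real.exp (-x) else 0 := by
  simp only [exponentialPDFReal, gammaPDFReal]
  simp

theorem integrable_exponentialPDFReal_one : Integrable (exponentialPDFReal 1) := by
  refine (lintegral_ofReal_ne_top_iff_integrable
    (stronglyMeasurable_exponentialPDFReal 1).aestronglyMeasurable
    (Eventually.of_forall fun x => exponentialPDFReal_nonneg one_pos x)).1 ?_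
  have h : expMeasure 1 Set.univ = 1 := measure_univ
  rw [expMeasure_one_eq, withDensity_apply _ MeasurableSet.univ, Measure.restrict_univ] at h
  rw [h]
  exact ENNReal.one_ne_top

theorem pi_expMeasure_eq (k : ℕ) : (Measure.pi fun _ : Fin k => expMeasure 1) =
    volume.withDensity (fun E : Fin k → ℝ =>
      ENNReal.ofReal (∏ i, exponentialPDFReal 1 (E i))) := by
  refine Measure.pi_eq fun s hs => ?_
  have hf0 : ∀ x, 0 ≤ exponentialPDFReal 1 x := fun x => exponentialPDFReal_nonneg one_pos x
  have hind : ∀ i, Integrable ((s i).indicator (exponentialPDFReal 1)) := fun i =>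
    integrable_exponentialPDFReal_one.indicator (hs i)
  have hprod : ∀ E : Fin k → ℝ, (Set.univ.pi s).indicator
      (fun E : Fin k → ℝ => ENNReal.ofReal (∏ i, exponentialPDFReal 1 (E i))) E =
      ENNReal.ofReal (∏ i, (s i).indicator (exponentialPDFReal 1) (E i)) := by
    intro E
    by_cases hE : E ∈ Set.univ.pi s
    · rw [Set.indicator_of_mem hE]
      congr 1
      exact Finset.prod_congr rfl fun i _ => (Set.indicator_of_mem (hE i trivial) _).symm
    · rw [Set.indicator_of_notMem hE]
      simp only [Set.mem_pi, Set.mem_univ, true_implies, not_forall] at hE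
      obtain ⟨i, hi⟩ := hE
      rw [Finset.prod_eq_zero (Finset.mem_univ i) (Set.indicator_of_notMem hi _),
        ENNReal.ofReal_zero]
  rw [withDensity_apply _ (MeasurableSet.univ_pi hs),
    ← lintegral_indicator (MeasurableSet.univ_pi hs)]
  simp only [hprod]
  rw [← ofReal_integral_eq_lintegral_ofReal]
  · rw [volume_pi, integral_fintype_prod_eq_prod, ENNReal.ofReal_prod_of_nonneg]
    · refine Finset.prod_congr rfl fun i _ => ?_
      rw [expMeasure_one_eq, withDensity_apply _ (hs i), ← lintegral_indicator (hs i),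
        ofReal_integral_eq_lintegral_ofReal (hind i)
          (Eventually.of_forall fun x => Set.indicator_nonneg (fun x _ => hf0 x) x)]
      refine lintegral_congr fun x => ?_
      by_cases hx : x ∈ s i
      · simp [hx]
      · simp [hx]
    · exact fun i _ => integral_nonneg fun x => Set.indicator_nonneg (fun x _ => hf0 x) x
  · exact Integrable.fintype_prod hind
  · exact Eventually.of_forall fun E =>
      Finset.prod_nonneg fun i _ => Set.indicator_nonneg (fun x _ => hf0 x) _

/-- Partial summation as a linear map. -/
def partialSumMatrix (k : ℕ) : Matrix (Fin k) (Fin k) ℝ := fun i j => if j ≤ i then 1 else 0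

theorem det_partialSumMatrix (k : ℕ) : (partialSumMatrix k).det = 1 := by
  rw [Matrix.det_of_isLowerTriangular]
  · simp [partialSumMatrix]
  · intro i j hij
    simp only [OrderDual.toDual_lt_toDual] at hij
    simp [partialSumMatrix, hij]

theorem toLin_partialSumMatrix {k : ℕ} (E : Fin k → ℝ) :
    Matrix.toLin' (partialSumMatrix k) E = partialSum E := by
  ext j
  rw [Matrix.toLin'_apply, Matrix.mulVec, dotProduct, partialSum]
  simp only [partialSumMatrix, ite_mul, one_mul, zero_mul]
  rw [← Finset.sum_filter]
  congr 1
  ext i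
  simp

theorem volume_partialSum_box {k : ℕ} (α β : Fin k → ℝ) :
    volume {E : Fin k → ℝ | ∀ j, partialSum E j ∈ Set.Ico (α j) (β j)} =
      ∏ j, ENNReal.ofReal (β j - α j) := by
  have e : {E : Fin k → ℝ | ∀ j, partialSum E j ∈ Set.Ico (α j) (β j)} =
      Matrix.toLin' (partialSumMatrix k) ⁻¹' (Set.univ.pi fun j => Set.Ico (α j) (β j)) := by
    ext E
    rw [Set.mem_preimage, toLin_partialSumMatrix]
    simp
  rw [e, Measure.addHaar_preimage_linearMap] <;>
    simp [LinearMap.det_toLin', det_partialSumMatrix, Real.volume_pi_Ico]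

theorem exponentialPDFReal_one_le (x : ℝ) : exponentialPDFReal 1 x ≤ Real.exp (-x) := by
  rw [exponentialPDFReal_one]
  split_ifs
  · exact le_rfl
  · positivity

theorem measurable_partialSum {k : ℕ} (j : Fin k) :
    Measurable fun E : Fin k → ℝ => partialSum E j := by
  unfold partialSum; fun_prop

theorem partialSum_last {k : ℕ} (E : Fin (k + 1) → ℝ) : partialSum E (Fin.last k) = ∑ i, E i := by
  rw [partialSum]
  congr 1
  ext i
  simp [Fin.le_last]

theorem pi_expMeasure_box_le {k : ℕ} (α β : Fin (k + 1) → ℝ) :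
    (Measure.pi fun _ : Fin (k + 1) => expMeasure 1)
      {E | ∀ j, partialSum E j ∈ Set.Ico (α j) (β j)} ≤
      ENNReal.ofReal (Real.exp (-α (Fin.last k))) * ∏ j, ENNReal.ofReal (β j - α j) := by
  have hm : MeasurableSet {E : Fin (k + 1) → ℝ | ∀ j, partialSum E j ∈ Set.Ico (α j) (β j)} := by
    have : {E : Fin (k + 1) → ℝ | ∀ j, partialSum E j ∈ Set.Ico (α j) (β j)} =
        ⋂ j, (fun E => partialSum E j) ⁻¹' Set.Ico (α j) (β j) := by
      ext E; simp
    rw [this]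
    exact MeasurableSet.iInter fun j => measurable_partialSum j measurableSet_Ico
  rw [pi_expMeasure_eq, withDensity_apply _ hm, ← volume_partialSum_box α β,
    ← setLIntegral_const]
  refine setLIntegral_mono' hm fun E hE => ENNReal.ofReal_le_ofReal ?_
  calc ∏ i, exponentialPDFReal 1 (E i) ≤ ∏ i, Real.exp (-E i) :=
        Finset.prod_le_prod (fun i _ => exponentialPDFReal_nonneg one_pos _)
          fun i _ => exponentialPDFReal_one_le _
    _ = Real.exp (-partialSum E (Fin.last k)) := by
        rw [← Real.exp_sum, Finset.sum_neg_distrib, partialSum_last]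
    _ ≤ _ := Real.exp_le_exp.2 (neg_le_neg (hE (Fin.last k)).1)

theorem ae_pos_expMeasure : ∀ᵐ x ∂(expMeasure 1), 0 < x := by
  rw [ae_iff]
  have : {x : ℝ | ¬0 < x} = Set.Iic 0 := by ext; simp
  rw [this, expMeasure_one_eq, withDensity_apply _ measurableSet_Iic]
  rw [setLIntegral_congr Iio_ae_eq_Iic.symm]
  refine (setLIntegral_congr_fun measurableSet_Iio fun x hx => ?_).trans lintegral_zero
  simp only [exponentialPDFReal_one, if_neg (not_le.2 (Set.mem_Iio.1 hx)), ENNReal.ofReal_zero]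

theorem ae_pos_pi_expMeasure (k : ℕ) :
    ∀ᵐ E ∂(Measure.pi fun _ : Fin k => expMeasure 1), ∀ i, 0 < E i :=
  ae_all_iff.2 fun i => (Measure.quasiMeasurePreserving_eval _ i).ae ae_pos_expMeasure

theorem expMeasure_Iio_le (t : ℝ) : expMeasure 1 (Set.Iio t) ≤ ENNReal.ofReal t := by
  rw [expMeasure_one_eq, withDensity_apply _ measurableSet_Iio,
    ← lintegral_indicator measurableSet_Iio]
  calc _ ≤ ∫⁻ x, (Set.Ico 0 t).indicator (fun _ => 1) x := by
        refine lintegral_mono fun x => ?_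
        by_cases hx : x < t
        · rw [Set.indicator_of_mem (Set.mem_Iio.2 hx), exponentialPDFReal_one]
          split_ifs with h0
          · rw [Set.indicator_of_mem (Set.mem_Ico.2 ⟨h0, hx⟩)]
            simpa using h0
          · simp
        · rw [Set.indicator_of_notMem (by simpa using hx)]
          exact zero_le
    _ = ENNReal.ofReal t := by
        rw [lintegral_indicator_const measurableSet_Ico, Real.volume_Ico, one_mul, sub_zero]

theorem lintegral_sq_expMeasure_le : ∫⁻ x, ENNReal.ofReal (x ^ 2) ∂(expMeasure 1) ≤ 2 := by
  have hint := Real.GammaIntegral_convergent (s := 3) (by norm_num)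
  have hG : ∫ x in Set.Ioi (0 : ℝ), Real.exp (-x) * x ^ ((3 : ℝ) - 1) = 2 := by
    rw [← Real.Gamma_eq_integral (by norm_num), show (3 : ℝ) = (2 : ℕ) + 1 by norm_num,
      Real.Gamma_nat_eq_factorial]
    norm_num
  have h2 := ofReal_integral_eq_lintegral_ofReal hint ((ae_restrict_iff' measurableSet_Ioi).2
    (Eventually.of_forall fun x hx => by
      have : (0 : ℝ) < x := hx
      positivity))
  rw [hG, ← lintegral_indicator measurableSet_Ioi] at h2
  rw [expMeasure_one_eq, lintegral_withDensity_eq_lintegral_mul _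
    (measurable_exponentialPDFReal 1).ennreal_ofReal (by fun_prop)]
  refine (lintegral_mono fun x => ?_).trans (h2.symm.le.trans (by simp))
  simp only [Pi.mul_apply, exponentialPDFReal_one]
  rcases lt_trichotomy x 0 with hx | rfl | hx
  · simp [not_le.2 hx]
  · simp
  · rw [Set.indicator_of_mem (Set.mem_Ioi.2 hx), if_pos hx.le,
      ← ENNReal.ofReal_mul (Real.exp_pos _).le]
    norm_num

/-! ### Total variation on countable spaces -/

theorem measure_le_add_lintegral {α : Type*} [MeasurableSpace α] [Countable α]
    [MeasurableSingletonClass α] {μ ν : Measure α} {η : α → ENNReal}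
    (h : ∀ x, ν {x} ≤ μ {x} + η x * ν {x}) (A : Set α) : ν A ≤ μ A + ∫⁻ x, η x ∂ν := by
  have hA : MeasurableSet A := A.to_countable.measurableSet
  rw [← lintegral_indicator_one hA, ← lintegral_indicator_one hA, lintegral_countable',
    lintegral_countable', lintegral_countable', ← ENNReal.tsum_add]
  refine ENNReal.tsum_le_tsum fun x => ?_
  by_cases hx : x ∈ A
  · simpa [hx] using h x
  · simp [hx]

theorem abs_real_sub_le {α : Type*} [MeasurableSpace α] [Countable α]
    [MeasurableSingletonClass α] {μ ν : Measure α} [IsProbabilityMeasure μ]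
    [IsProbabilityMeasure ν] {η : α → ENNReal} (h : ∀ x, ν {x} ≤ μ {x} + η x * ν {x}) {D : ℝ}
    (hD : 0 ≤ D) (hη : ∫⁻ x, η x ∂ν ≤ ENNReal.ofReal D) (A : Set α) :
    |μ.real A - ν.real A| ≤ D := by
  have key : ∀ B : Set α, ν.real B ≤ μ.real B + D := fun B => by
    have h1 := (measure_le_add_lintegral h B).trans (add_le_add_right hη _)
    rw [Measure.real, Measure.real, ← ENNReal.toReal_ofReal hD,
      ← ENNReal.toReal_add (measure_ne_top _ _) ENNReal.ofReal_ne_top]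
    exact ENNReal.toReal_mono (ENNReal.add_ne_top.2 ⟨measure_ne_top _ _, ENNReal.ofReal_ne_top⟩) h1
  have h1 := key A
  have h2 := key Aᶜ
  have hA : MeasurableSet A := A.to_countable.measurableSet
  rw [probReal_compl_eq_one_sub hA, probReal_compl_eq_one_sub hA] at h2
  rw [abs_le]
  constructor <;> linarith

/-! ### The exponential approximation -/

/-- The exponential rate `c / √n`. -/
noncomputable def rate (n : ℕ) : ℝ := cConst / Real.sqrt n

theorem cConst_pos : 0 < cConst := div_pos Real.pi_pos (Real.sqrt_pos.2 (by norm_num))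

theorem cConst_sq : cConst ^ 2 = Real.pi ^ 2 / 6 := by
  rw [cConst, div_pow, Real.sq_sqrt (by norm_num)]

theorem rate_pos {n : ℕ} (hn : 0 < n) : 0 < rate n :=
  div_pos cConst_pos (Real.sqrt_pos.2 (by exact_mod_cast hn))

theorem natCast_mul_rate_sq {n : ℕ} (hn : 0 < n) : n * rate n ^ 2 = Real.pi ^ 2 / 6 := by
  have : (0 : ℝ) < n := by exact_mod_cast hn
  rw [rate, div_pow, Real.sq_sqrt this.le, cConst_sq]
  field_simp

theorem slantTuple_apply (n : ℕ) {k : ℕ} (E : Fin k → ℝ) (j : Fin k) :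
    slantTuple n E j = ⌈1 / rate n * Real.log (1 / rate n / partialSum E j)⌉ := by
  rw [slantTuple, rate, one_div_div]

theorem partialSum_pos {k : ℕ} {E : Fin k → ℝ} (hE : ∀ i, 0 < E i) (j : Fin k) :
    0 < partialSum E j :=
  Finset.sum_pos (fun i _ => hE i) ⟨j, by simp⟩

theorem partialSum_mono {k : ℕ} {E : Fin k → ℝ} (hE : ∀ i, 0 < E i) :
    Monotone (partialSum E) := fun _ _ hij =>
  Finset.sum_le_sum_of_subset_of_nonneg (Finset.Iic_subset_Iic.2 hij) fun l _ _ => (hE l).le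

theorem slantTuple_antitone {n k : ℕ} (hn : 0 < n) {E : Fin k → ℝ} (hE : ∀ i, 0 < E i) :
    Antitone (slantTuple n E) := by
  intro i j hij
  rw [slantTuple_apply, slantTuple_apply]
  have hr := rate_pos hn
  have hi := partialSum_pos hE i
  have hj := partialSum_pos hE j
  have := partialSum_mono hE hij
  refine Int.ceil_mono ?_
  gcongr

theorem mem_Ico_of_ceil_log_eq {τ S : ℝ} (hτ : 0 < τ) (hS : 0 < S) {x : ℤ}
    (h : ⌈1 / τ * Real.log (1 / τ / S)⌉ = x) :
    S ∈ Set.Ico (Real.exp (-(τ * x)) / τ) (Real.exp (-(τ * (x - 1))) / τ) := by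
  obtain ⟨h1, h2⟩ := Int.ceil_eq_iff.1 h
  have hlog : Real.log (1 / τ / S) = -Real.log (τ * S) := by
    rw [div_div, one_div, Real.log_inv]
  rw [hlog, one_div_mul_eq_div] at h1 h2
  rw [lt_div_iff₀ hτ] at h1
  rw [div_le_iff₀ hτ] at h2
  have hτS : 0 < τ * S := mul_pos hτ hS
  constructor
  · rw [div_le_iff₀ hτ, mul_comm S, ← Real.le_log_iff_exp_le hτS]
    linarith
  · rw [lt_div_iff₀ hτ, mul_comm S, ← Real.log_lt_iff_lt_exp hτS]
    linarith

/-- The mass left above the last entry of a tuple. -/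
noncomputable def lastMass (τ : ℝ) {k : ℕ} (x : Fin (k + 1) → ℤ) : ℝ :=
  Real.exp (-(τ * x (Fin.last k))) / τ

theorem exp_sub_one_div_le {τ : ℝ} (hτ : 0 < τ) : (Real.exp τ - 1) / τ ≤ Real.exp τ := by
  rw [div_le_iff₀ hτ]
  have h := Real.one_sub_le_exp_neg τ
  have h2 := mul_le_mul_of_nonneg_left h (Real.exp_pos τ).le
  rw [← Real.exp_add, add_neg_cancel, Real.exp_zero] at h2
  linarith

theorem slant_point_le {n k : ℕ} (hn : 0 < n) (x : Fin (k + 1) → ℤ) :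
    (Measure.pi fun _ : Fin (k + 1) => expMeasure 1) {E | slantTuple n E = x} ≤
      ENNReal.ofReal (Real.exp (-(lastMass (rate n) x + rate n * ∑ j, (x j : ℝ)) +
        (k + 1) * rate n)) := by
  have hr := rate_pos hn
  set τ := rate n with hτ
  set α : Fin (k + 1) → ℝ := fun j => Real.exp (-(τ * x j)) / τ with hα
  set β : Fin (k + 1) → ℝ := fun j => Real.exp (-(τ * (x j - 1))) / τ with hβ
  have h1 : (Measure.pi fun _ : Fin (k + 1) => expMeasure 1) {E | slantTuple n E = x} ≤
      (Measure.pi fun _ : Fin (k + 1) => expMeasure 1)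
        {E | ∀ j, partialSum E j ∈ Set.Ico (α j) (β j)} := by
    refine measure_mono_ae ?_
    filter_upwards [ae_pos_pi_expMeasure (k + 1)] with E hE hx j
    refine mem_Ico_of_ceil_log_eq hr (partialSum_pos hE j) ?_
    rw [← slantTuple_apply]
    exact congrFun hx j
  refine (h1.trans (pi_expMeasure_box_le α β)).trans ?_
  rw [← ENNReal.ofReal_prod_of_nonneg, ← ENNReal.ofReal_mul (Real.exp_pos _).le]
  · refine ENNReal.ofReal_le_ofReal ?_
    have h2 : ∏ j, (β j - α j) ≤ ∏ j : Fin (k + 1), Real.exp (-(τ * x j) + τ) := by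
      refine Finset.prod_le_prod (fun j _ => ?_) fun j _ => ?_
      · rw [hα, hβ, sub_nonneg]
        dsimp only
        gcongr
        linarith
      · have e : β j - α j = Real.exp (-(τ * x j)) * ((Real.exp τ - 1) / τ) := by
          rw [hα, hβ]
          dsimp only
          rw [show -(τ * ((x j : ℝ) - 1)) = -(τ * x j) + τ by ring, Real.exp_add]
          ring
        rw [e, Real.exp_add]
        exact mul_le_mul_of_nonneg_left (exp_sub_one_div_le hr) (Real.exp_pos _).le
    refine (mul_le_mul_of_nonneg_left h2 (Real.exp_pos _).le).trans_eq ?_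
    rw [← Real.exp_sum, ← Real.exp_add]
    congr 1
    rw [Finset.sum_add_distrib, Finset.sum_neg_distrib, ← Finset.mul_sum]
    simp [lastMass, hα]
    ring
  · intro j _
    rw [hα, hβ, sub_nonneg]
    dsimp only
    gcongr
    linarith

theorem lastMass_slantTuple_le {n k : ℕ} (hn : 0 < n) {E : Fin (k + 1) → ℝ} (hE : ∀ i, 0 < E i) :
    lastMass (rate n) (slantTuple n E) ≤ ∑ i, E i := by
  rw [← partialSum_last]
  exact (mem_Ico_of_ceil_log_eq (rate_pos hn) (partialSum_pos hE (Fin.last k))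
    (slantTuple_apply n E (Fin.last k)).symm).1

theorem slantTuple_zero_le {n k : ℕ} (hn : 0 < n) {E : Fin (k + 1) → ℝ}
    (h0 : rate n ≤ E 0) : (slantTuple n E 0 : ℝ) ≤ Real.log n / rate n + 1 := by
  have hr := rate_pos hn
  have hn' : (0 : ℝ) < n := by exact_mod_cast hn
  have e : partialSum E 0 = E 0 := by
    rw [partialSum, show Finset.Iic (0 : Fin (k + 1)) = {0} by ext i; simp, Finset.sum_singleton]
  rw [slantTuple_apply, e]
  refine (Int.ceil_lt_add_one _).le.trans ?_
  have hE : 0 < E 0 := hr.trans_le h0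
  have h1 : Real.log (1 / rate n / E 0) ≤ Real.log n := by
    refine Real.log_le_log (by positivity) ?_
    rw [div_div, div_le_iff₀ (by positivity)]
    have h2 := natCast_mul_rate_sq hn
    have h3 : 1 ≤ Real.pi ^ 2 / 6 := by nlinarith [Real.pi_gt_three]
    have h4 : (n : ℝ) * rate n ^ 2 ≤ n * (rate n * E 0) := by
      rw [pow_two]; gcongr
    linarith
  rw [one_div_mul_eq_div]
  gcongr

theorem lintegral_sum_sq_le (k : ℕ) :
    ∫⁻ E, ENNReal.ofReal ((∑ i, E i) ^ 2) ∂(Measure.pi fun _ : Fin k => expMeasure 1) ≤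
      ENNReal.ofReal (2 * (k : ℝ) ^ 2) := by
  have h1 : ∀ E : Fin k → ℝ, ENNReal.ofReal ((∑ i, E i) ^ 2) ≤
      ENNReal.ofReal k * ∑ i, ENNReal.ofReal (E i ^ 2) := by
    intro E
    rw [← ENNReal.ofReal_sum_of_nonneg (fun i _ => sq_nonneg (E i)),
      ← ENNReal.ofReal_mul (Nat.cast_nonneg k)]
    refine ENNReal.ofReal_le_ofReal ?_
    have := sq_sum_le_card_mul_sum_sq (s := (Finset.univ : Finset (Fin k))) (f := E)
    simpa using this
  refine (lintegral_mono h1).trans ?_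
  rw [lintegral_const_mul _ (by fun_prop), lintegral_finsetSum _ (fun i _ => by fun_prop)]
  have h2 : ∀ i : Fin k, ∫⁻ E, ENNReal.ofReal (E i ^ 2)
      ∂(Measure.pi fun _ : Fin k => expMeasure 1) ≤ 2 := fun i => by
    have h := (measurePreserving_eval (fun _ : Fin k => expMeasure 1) i).lintegral_comp
      (f := fun x : ℝ => ENNReal.ofReal (x ^ 2)) (by fun_prop)
    exact h.le.trans lintegral_sq_expMeasure_le
  calc _ ≤ ENNReal.ofReal k * ∑ i : Fin k, (2 : ENNReal) := by
        gcongr with i _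
        exact h2 i
    _ = ENNReal.ofReal (2 * (k : ℝ) ^ 2) := by
        rw [Finset.sum_const, Finset.card_univ, Fintype.card_fin, nsmul_eq_mul,
          ENNReal.ofReal_mul (by norm_num), ENNReal.ofReal_pow (Nat.cast_nonneg _)]
        simp only [ENNReal.ofReal_natCast, ENNReal.ofReal_ofNat]
        ring

theorem pi_expMeasure_first_lt_le (k : ℕ) (t : ℝ) :
    (Measure.pi fun _ : Fin (k + 1) => expMeasure 1) {E | E 0 < t} ≤ ENNReal.ofReal t := by
  have h := (measurePreserving_eval (fun _ : Fin (k + 1) => expMeasure 1) 0).measure_preimage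
    (measurableSet_Iio (a := t)).nullMeasurableSet
  exact h.le.trans (expMeasure_Iio_le t)

instance (n k : ℕ) : IsProbabilityMeasure (slantLaw n k) :=
  Measure.isProbabilityMeasure_map (measurable_slantTuple_pair n k).aemeasurable

theorem measurable_diagramOfArea {n : ℕ} {β : Type*} [MeasurableSpace β]
    (f : DiagramOfArea n → β) : Measurable f := fun _ _ => trivial

instance (n k : ℕ) : IsProbabilityMeasure (diagramLaw n k) :=
  Measure.isProbabilityMeasure_map (measurable_diagramOfArea _).aemeasurable

theorem slantLaw_point_le {n k : ℕ} (hn : 0 < n) (x y : Fin (k + 1) → ℤ) :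
    slantLaw n (k + 1) {(x, y)} ≤
      ENNReal.ofReal (Real.exp (2 * (k + 1) * rate n) *
        Real.exp (-(rate n * (∑ j, (x j : ℝ) + ∑ j, (y j : ℝ)) + lastMass (rate n) x +
          lastMass (rate n) y))) := by
  rw [slantLaw, Measure.map_apply (measurable_slantTuple_pair n (k + 1)) (measurableSet_singleton _)]
  have e : (fun z : (Fin (k + 1) → ℝ) × (Fin (k + 1) → ℝ) =>
      (slantTuple n z.1, slantTuple n z.2)) ⁻¹' {(x, y)} =
      {E | slantTuple n E = x} ×ˢ {E | slantTuple n E = y} := by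
    ext ⟨E, E'⟩
    simp
  rw [e, Measure.prod_prod]
  refine (mul_le_mul' (slant_point_le hn x) (slant_point_le hn y)).trans_eq ?_
  rw [← ENNReal.ofReal_mul (Real.exp_pos _).le, ← Real.exp_add, ← Real.exp_add]
  congr 2
  ring

theorem diagramLaw_point {n k : ℕ} (x y : Fin k → ℤ) :
    diagramLaw n k {(x, y)} = ENNReal.ofReal
      ({D : DiagramOfArea n | topColumns k D = x ∧ topRows k D = y}.ncard /
        Nat.card (DiagramOfArea n)) := by
  have : MeasurableSingletonClass (DiagramOfArea n) := ⟨fun _ => trivial⟩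
  have := Fintype.ofFinite (DiagramOfArea n)
  rw [diagramLaw, Measure.map_apply (measurable_diagramOfArea _) (measurableSet_singleton _),
    uniformDiagram, uniformOn_univ]
  have e : (fun D : DiagramOfArea n => (topColumns k D, topRows k D)) ⁻¹' {(x, y)} =
      {D : DiagramOfArea n | topColumns k D = x ∧ topRows k D = y} := by
    ext D; simp
  have hc : (0 : ℝ) < Fintype.card (DiagramOfArea n) := by exact_mod_cast Fintype.card_pos
  rw [e, Measure.count_apply (Set.toFinite _).measurableSet, ← Set.Finite.cast_ncard_eq (Set.toFinite _),
    Nat.card_eq_fintype_card, ENNReal.ofReal_div_of_pos hc]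
  rw [ENNReal.ofReal_natCast, ENNReal.ofReal_natCast]
  rfl

/-! ### The pointwise lower bound for the law of the diagram -/

/-- Extension of a tuple of integers to a sequence of naturals. -/
def extendTuple {k : ℕ} (x : Fin (k + 1) → ℤ) (j : ℕ) : ℕ :=
  (x ⟨min j k, by omega⟩).toNat

theorem extendTuple_antitone {k : ℕ} {x : Fin (k + 1) → ℤ} (hx : Antitone x) :
    Antitone (extendTuple x) := fun i j hij => by
  refine Int.toNat_le_toNat (hx ?_)
  rw [Fin.mk_le_mk]
  exact min_le_min_right k hij

theorem extendTuple_val {k : ℕ} {x : Fin (k + 1) → ℤ} (h0 : ∀ j, 0 ≤ x j) (j : Fin (k + 1)) :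
    (extendTuple x j : ℤ) = x j := by
  rw [extendTuple, Int.toNat_of_nonneg (h0 _)]
  congr 1
  ext
  have := j.2
  simp only
  omega

theorem sum_extendTuple {k : ℕ} {x : Fin (k + 1) → ℤ} (h0 : ∀ j, 0 ≤ x j) :
    ((∑ j ∈ Finset.range (k + 1), extendTuple x j : ℕ) : ℝ) = ∑ j, (x j : ℝ) := by
  rw [← Fin.sum_univ_eq_sum_range (extendTuple x), Nat.cast_sum]
  refine Finset.sum_congr rfl fun j _ => ?_
  have := extendTuple_val h0 j
  exact_mod_cast congrArg (fun z : ℤ => (z : ℝ)) this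

/-- The error of the approximation at a point. -/
noncomputable def pointError (n k : ℕ) (s s' : ℝ) : ℝ :=
  ((k + 1) + s + s') ^ 2 * Real.log n ^ 2 * rate n

theorem tailRatio_le_of_small {τ : ℝ} (hτ : 0 < τ) {a K : ℕ} {s η : ℝ} (hs0 : 0 ≤ s)
    (hs : expWeight τ a / τ = s * Real.exp (K * τ)) (hK : K * τ ≤ 1 / 4) (hsτ : s * τ ≤ 1 / 8)
    (hη : s * (K + s) * τ ≤ η) : tailRatio τ a ≤ s + 12 * η := by
  have hKτ : 0 ≤ K * τ := by positivity
  have hexp : Real.exp (K * τ) ≤ 1 + 2 * (K * τ) := by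
    have h := Real.exp_bound_div_one_sub_of_interval hKτ (by linarith : K * τ < 1)
    refine h.trans ?_
    rw [div_le_iff₀ (by linarith)]
    nlinarith
  have hq : expWeight τ a = s * τ * Real.exp (K * τ) := by
    rw [div_eq_iff hτ.ne'] at hs
    linarith
  have hsτ0 : 0 ≤ s * τ := by positivity
  have hq2 : expWeight τ a ≤ 2 * (s * τ) := by
    rw [hq]; nlinarith
  have hinv : 1 / (1 - expWeight τ a) ≤ 1 + 4 * (s * τ) := by
    rw [div_le_iff₀ (by linarith)]
    nlinarith
  have h1 := tsum_tail_ratio_le hτ (a := a) (by linarith)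
  refine h1.trans ?_
  rw [hs]
  calc s * Real.exp (K * τ) * (1 / (1 - expWeight τ a))
      ≤ s * (1 + 2 * (K * τ)) * (1 + 4 * (s * τ)) := by
        have h0 : 0 ≤ 1 / (1 - expWeight τ a) := by
          have : 0 < 1 - expWeight τ a := by linarith
          positivity
        gcongr
    _ = s + 2 * (s * K * τ) + 4 * (s * s * τ) + 8 * (K * τ) * (s * s * τ) := by ring
    _ ≤ s + 12 * (s * (K + s) * τ) := by
        have e1 : 0 ≤ s * K * τ := by positivity
        have e2 : 0 ≤ s * s * τ := by positivity
        have e3 : 8 * (K * τ) * (s * s * τ) ≤ 2 * (s * s * τ) := by gcongr; linarith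
        nlinarith
    _ ≤ s + 12 * η := by linarith

theorem exp_neg_quarter_ge : (3 : ℝ) / 4 ≤ Real.exp (-(1 / 4)) := by
  have := Real.one_sub_le_exp_neg (1 / 4)
  linarith

set_option maxHeartbeats 1600000 in
theorem exists_diagramLaw_point_ge : ∃ C > 0, ∀ᶠ n : ℕ in atTop, ∀ (k : ℕ)
    (x y : Fin (k + 1) → ℤ), Antitone x → Antitone y →
    (x 0 : ℝ) ≤ Real.log n / rate n + 1 → (y 0 : ℝ) ≤ Real.log n / rate n + 1 →
    (1 - C * pointError n k (lastMass (rate n) x) (lastMass (rate n) y)) *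
      Real.exp (-(rate n * (∑ j, (x j : ℝ) + ∑ j, (y j : ℝ)) + lastMass (rate n) x +
          lastMass (rate n) y)) ≤
      ({D : DiagramOfArea n | topColumns (k + 1) D = x ∧ topRows (k + 1) D = y}.ncard : ℝ) /
        Nat.card (DiagramOfArea n) := by
  obtain ⟨C₁, hC₁, δ, hδ, τ₀, hτ₀, hcard⟩ := exists_card_boxDiagrams_ge
  have hrate : Tendsto rate atTop (nhds 0) := by
    have h := (Real.tendsto_sqrt_atTop.comp tendsto_natCast_atTop_atTop).inv_tendsto_atTop.const_mul
      cConst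
    rw [mul_zero] at h
    exact h
  refine ⟨100 * C₁ + 24 + 100 / δ + 8, by positivity, ?_⟩
  filter_upwards [hrate.eventually (ge_mem_nhds hτ₀), eventually_ge_atTop 3] with n hnτ hn3
  intro k x y hx hy hx0 hy0
  have hn : 0 < n := by omega
  have hτ := rate_pos hn
  have hnτ2 := natCast_mul_rate_sq hn
  set τ := rate n with hτdef
  set s := lastMass τ x with hs
  set s' := lastMass τ y with hs'
  set C := 100 * C₁ + 24 + 100 / δ + 8 with hC
  set Lg := Real.log n with hLg
  have hLg1 : 1 ≤ Lg := by
    rw [hLg, Real.le_log_iff_exp_le (by exact_mod_cast hn)]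
    have : (3 : ℝ) ≤ n := by exact_mod_cast hn3
    linarith [Real.exp_one_lt_d9]
  have hs0 : 0 < s := div_pos (Real.exp_pos _) hτ
  have hs0' : 0 < s' := div_pos (Real.exp_pos _) hτ
  set K : ℝ := (k : ℝ) + 1 with hK
  have hK1 : 1 ≤ K := by
    have : (0 : ℝ) ≤ k := Nat.cast_nonneg k
    linarith
  set S := K + s + s' with hS
  have hS1 : 1 ≤ S := by linarith
  set η := pointError n k s s' with hηdef
  have hη : η = S ^ 2 * Lg ^ 2 * τ := rfl
  have hη0 : 0 ≤ η := by rw [hη]; positivity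
  have hcardpos : (0 : ℝ) < Nat.card (DiagramOfArea n) := by exact_mod_cast Nat.card_pos
  rcases le_or_gt (1 - C * η) 0 with hneg | hpos
  · refine (mul_nonpos_of_nonpos_of_nonneg hneg (Real.exp_pos _).le).trans ?_
    positivity
  have hδ0 : 0 < 100 / δ := by positivity
  have hC₁η : 0 ≤ C₁ * η := mul_nonneg hC₁.le hη0
  have hδη : 0 ≤ 100 / δ * η := mul_nonneg hδ0.le hη0
  have hCη : C * η = 100 * (C₁ * η) + 24 * η + 100 / δ * η + 8 * η := by rw [hC]; ring
  have hη8 : η ≤ 1 / 8 := by linarith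
  have hηδ : 100 * η ≤ δ := by
    have h1 : 100 / δ * η ≤ 1 := by linarith
    have h2 : 100 / δ * η = 100 * η / δ := by ring
    rw [h2, div_le_one hδ] at h1
    exact h1
  -- consequences of smallness
  have hSL : S * Lg * τ ≤ η := by
    rw [hη, ← mul_pow]
    have h1 : 1 ≤ S * Lg := one_le_mul_of_one_le_of_one_le hS1 hLg1
    have := le_self_pow₀ h1 (two_ne_zero)
    gcongr
  have hS2 : S ^ 2 * τ ≤ η := by
    rw [hη]
    have : (1 : ℝ) ≤ Lg ^ 2 := one_le_pow₀ hLg1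
    have h0 : 0 ≤ S ^ 2 := sq_nonneg _
    gcongr
    exact le_mul_of_one_le_right h0 this
  have hSτ : S * τ ≤ η := by
    refine le_trans ?_ hSL
    gcongr
    exact le_mul_of_one_le_right (by linarith) hLg1
  have hLτ : Lg * τ ≤ 1 / 8 := by
    refine le_trans ?_ (hSL.trans hη8)
    gcongr
    exact le_mul_of_one_le_left (by linarith) hS1
  have hKτ : K * τ ≤ 1 / 8 := le_trans (by gcongr; linarith) (hSτ.trans hη8)
  have hsτ : s * τ ≤ 1 / 8 := le_trans (by gcongr; linarith) (hSτ.trans hη8)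
  have hsτ' : s' * τ ≤ 1 / 8 := le_trans (by gcongr; linarith) (hSτ.trans hη8)
  have hτ8 : τ ≤ 1 / 8 := (le_mul_of_one_le_left hτ.le hK1).trans hKτ
  have hKcast : ((k + 1 : ℕ) : ℝ) = K := by push_cast; rfl
  -- the tuples are large
  have hlarge : ∀ z : Fin (k + 1) → ℤ, lastMass τ z * τ ≤ 1 / 8 → ((k + 1 : ℕ) : ℤ) ≤
      z (Fin.last k) := by
    intro z hz
    by_contra hcon
    have h1 : (z (Fin.last k) : ℝ) ≤ K := by
      rw [← hKcast]
      exact_mod_cast (not_le.1 hcon).le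
    have h2 : Real.exp (-(1 / 4)) ≤ lastMass τ z * τ := by
      rw [lastMass, div_mul_cancel₀ _ hτ.ne']
      refine Real.exp_le_exp.2 (neg_le_neg ?_)
      have := mul_le_mul_of_nonneg_left h1 hτ.le
      linarith
    linarith [exp_neg_quarter_ge]
  have hxl := hlarge x hsτ
  have hyl := hlarge y hsτ'
  have hxk : ∀ j, ((k + 1 : ℕ) : ℤ) ≤ x j := fun j => hxl.trans (hx (Fin.le_last j))
  have hyk : ∀ j, ((k + 1 : ℕ) : ℤ) ≤ y j := fun j => hyl.trans (hy (Fin.le_last j))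
  have hxnn : ∀ j, 0 ≤ x j := fun j => (Int.natCast_nonneg _).trans (hxk j)
  have hynn : ∀ j, 0 ≤ y j := fun j => (Int.natCast_nonneg _).trans (hyk j)
  have hupper : ∀ z : Fin (k + 1) → ℤ, Antitone z → (z 0 : ℝ) ≤ Lg / τ + 1 →
      ∀ j, (z j : ℝ) ≤ 2 * Lg / τ := by
    intro z hz hz0 j
    have h1 : (z j : ℝ) ≤ z 0 := by exact_mod_cast hz (Fin.zero_le j)
    refine h1.trans (hz0.trans ?_)
    rw [mul_div_assoc, two_mul]
    have : 1 ≤ Lg / τ := by rw [le_div_iff₀ hτ]; linarith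
    linarith
  have hxu := hupper x hx hx0
  have hyu := hupper y hy hy0
  have hsumu : ∀ z : Fin (k + 1) → ℤ, (∀ j, (z j : ℝ) ≤ 2 * Lg / τ) →
      ∑ j, (z j : ℝ) ≤ K * (2 * Lg / τ) := by
    intro z hz
    refine (Finset.sum_le_sum fun j _ => hz j).trans_eq ?_
    rw [Finset.sum_const, Finset.card_univ, Fintype.card_fin, nsmul_eq_mul, hKcast]
  -- the remaining box
  set l := extendTuple x with hl
  set m := extendTuple y with hm
  have hlast : ∀ z : Fin (k + 1) → ℤ, extendTuple z k = (z (Fin.last k)).toNat := fun z => by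
    rw [extendTuple]
    congr 2
    ext
    simp
  set a := l k - (k + 1) with ha
  set b := m k - (k + 1) with hb
  have hlk : ((l k : ℕ) : ℤ) = x (Fin.last k) := by
    rw [hl, hlast, Int.toNat_of_nonneg (hxnn _)]
  have hmk : ((m k : ℕ) : ℤ) = y (Fin.last k) := by
    rw [hm, hlast, Int.toNat_of_nonneg (hynn _)]
  have hka : k + 1 ≤ l k := by omega
  have hkb : k + 1 ≤ m k := by omega
  have hlanti : Antitone l := extendTuple_antitone hx
  have hmanti : Antitone m := extendTuple_antitone hy
  have hal : ∀ j < k + 1, a + (k + 1) ≤ l j := fun j hj => by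
    have := hlanti (show j ≤ k by omega)
    omega
  have hbm : ∀ j < k + 1, b + (k + 1) ≤ m j := fun j hj => by
    have := hmanti (show j ≤ k by omega)
    omega
  have hsl := sum_extendTuple hxnn
  have hsm := sum_extendTuple hynn
  set U := ∑ j ∈ Finset.range (k + 1), l j with hU
  set W := ∑ j ∈ Finset.range (k + 1), m j with hW
  have hU2 : (k + 1) * (k + 1) ≤ U := by
    have h1 : ∑ j ∈ Finset.range (k + 1), (k + 1) ≤ U := Finset.sum_le_sum fun j hj => by
      have := hal j (Finset.mem_range.1 hj)
      omega
    simpa using h1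
  have hπ1 : 1 ≤ Real.pi ^ 2 / 6 := by
    have := pow_le_pow_left₀ (by norm_num) Real.pi_gt_three.le 2
    linarith
  have hUR : (U : ℝ) + W ≤ 4 * K * Lg / τ := by
    rw [hsl, hsm]
    have h1 := hsumu x hxu
    have h2 := hsumu y hyu
    have e : 4 * K * Lg / τ = K * (2 * Lg / τ) + K * (2 * Lg / τ) := by ring
    linarith
  have hUn : U + W ≤ n := by
    have h1 : (U : ℝ) + W ≤ n := by
      refine hUR.trans ?_
      rw [div_le_iff₀ hτ]
      have h2 : K * Lg * τ ≤ 1 / 8 := by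
        refine le_trans ?_ (hSL.trans hη8)
        gcongr
        linarith
      have h3 : 4 * K * Lg * τ ≤ n * τ * τ := by
        have : (n : ℝ) * τ * τ = n * τ ^ 2 := by ring
        rw [this, hnτ2]
        linarith
      exact le_of_mul_le_mul_right h3 hτ
    exact_mod_cast h1
  set N := n + (k + 1) * (k + 1) - (U + W) with hN
  have hNn : N ≤ n := by omega
  have hNeq : n + (k + 1) * (k + 1) = U + W + N := by omega
  have hNR : (n : ℝ) - N = U + W - K * K := by
    have : (n : ℝ) + K * K = U + W + N := by
      rw [← hKcast]
      exact_mod_cast hNeq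
    linarith
  -- masses
  have hmass : ∀ (z : Fin (k + 1) → ℤ) (c : ℕ), (c : ℤ) + (k + 1 : ℕ) = z (Fin.last k) →
      expWeight τ c / τ = lastMass τ z * Real.exp ((k + 1 : ℕ) * τ) := by
    intro z c hc
    have h1 : (c : ℝ) + (k + 1 : ℕ) = z (Fin.last k) := by exact_mod_cast hc
    rw [lastMass, ← h1, expWeight, div_mul_eq_mul_div, ← Real.exp_add]
    congr 2
    ring
  have hsa := hmass x a (by omega)
  have hsb := hmass y b (by omega)
  have hexp2 : Real.exp ((k + 1 : ℕ) * τ) ≤ 2 := by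
    rw [hKcast]
    have h := Real.exp_bound_div_one_sub_of_interval (x := K * τ) (by positivity) (by linarith)
    refine h.trans ?_
    rw [div_le_iff₀ (by linarith)]
    linarith
  have hsa2 : expWeight τ a / τ ≤ 2 * s := by
    rw [hsa, mul_comm]; gcongr
  have hsb2 : expWeight τ b / τ ≤ 2 * s' := by
    rw [hsb, mul_comm]; gcongr
  have hsa0 : 0 ≤ expWeight τ a / τ := div_nonneg (expWeight_nonneg _ _) hτ.le
  have hsb0 : 0 ≤ expWeight τ b / τ := div_nonneg (expWeight_nonneg _ _) hτ.le
  have haτ : ∀ (z : Fin (k + 1) → ℤ) (c : ℕ), (c : ℤ) + (k + 1 : ℕ) = z (Fin.last k) →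
      (∀ j, (z j : ℝ) ≤ 2 * Lg / τ) → c * τ ≤ 2 * Lg := by
    intro z c hc hz
    have h1 : (c : ℝ) + (k + 1 : ℕ) = z (Fin.last k) := by exact_mod_cast hc
    have h2 := hz (Fin.last k)
    rw [← h1, le_div_iff₀ hτ] at h2
    have : 0 ≤ ((k + 1 : ℕ) : ℝ) * τ := by positivity
    linarith
  have haτ1 := haτ x a (by omega) hxu
  have hbτ1 := haτ y b (by omega) hyu
  set Z := 1 + ((a : ℝ) + b) * τ with hZ
  have hZ5 : Z ≤ 5 * Lg := by rw [hZ]; linarith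
  have hZ0 : 0 ≤ Z := by rw [hZ]; positivity
  have hmain := hcard τ n hτ hnτ hnτ2 a b N (10 * (S * Lg)) hNn ?_ ?_ ?_ ?_
  rotate_left
  · have : 1 ≤ S * Lg := one_le_mul_of_one_le_of_one_le hS1 hLg1
    linarith
  · have h1 : ((n : ℝ) - N) * τ ≤ 4 * K * Lg := by
      have h2 : (n : ℝ) - N ≤ 4 * K * Lg / τ := by
        rw [hNR]
        have : 0 ≤ K * K := by positivity
        linarith
      rwa [le_div_iff₀ hτ] at h2
    have h2 : (expWeight τ a / τ + expWeight τ b / τ) * Z ≤ (2 * s + 2 * s') * (5 * Lg) := by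
      gcongr
    have h3 : 0 ≤ K * Lg := by positivity
    have h4 : S * Lg = K * Lg + s * Lg + s' * Lg := by rw [hS]; ring
    linarith
  · have h2 : (expWeight τ a / τ + expWeight τ b / τ) * Z ^ 2 ≤
        (2 * s + 2 * s') * (5 * Lg) ^ 2 := by
      gcongr
    refine h2.trans ?_
    have h3 : s + s' ≤ S ^ 2 := by
      have := le_self_pow₀ hS1 two_ne_zero
      linarith
    have h4 := mul_le_mul_of_nonneg_right h3 (sq_nonneg Lg)
    have h5 : 0 ≤ S ^ 2 * Lg ^ 2 := by positivity
    linarith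
  · have e : (10 * (S * Lg)) ^ 2 * τ = 100 * η := by rw [hη]; ring
    rw [e]
    exact hηδ
  have eV : (10 * (S * Lg)) ^ 2 * τ = 100 * η := by rw [hη]; ring
  rw [eV] at hmain
  have hTa : tailRatio τ a ≤ s + 12 * η := by
    refine tailRatio_le_of_small hτ hs0.le hsa (by rw [hKcast]; linarith) hsτ ?_
    rw [hKcast]
    refine le_trans ?_ hS2
    have h1 : s ≤ S := by linarith
    have h2 : K + s ≤ S := by linarith
    rw [pow_two]
    gcongr
  have hTb : tailRatio τ b ≤ s' + 12 * η := by
    refine tailRatio_le_of_small hτ hs0'.le hsb (by rw [hKcast]; linarith) hsτ' ?_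
    rw [hKcast]
    refine le_trans ?_ hS2
    have h1 : s' ≤ S := by linarith
    have h2 : K + s' ≤ S := by linarith
    rw [pow_two]
    gcongr
  set X := τ * (∑ j, (x j : ℝ) + ∑ j, (y j : ℝ)) with hX
  have hXN : ((n : ℝ) - N) * τ ≤ X := by
    rw [hNR, hX, ← hsl, ← hsm, mul_comm]
    gcongr
    have : 0 ≤ K * K := by positivity
    linarith
  -- comparing the counts
  have hcount := ncard_boxDiagrams_le hlanti hmanti hal hbm hNeq
  have hsub : {D : DiagramOfArea n | ∀ j < k + 1, D.1.colLen j = l j ∧ D.1.rowLen j = m j} ⊆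
      {D : DiagramOfArea n | topColumns (k + 1) D = x ∧ topRows (k + 1) D = y} := by
    intro D hD
    constructor
    · funext j
      rw [topColumns, (hD j j.2).1]
      exact extendTuple_val hxnn j
    · funext j
      rw [topRows, (hD j j.2).2]
      exact extendTuple_val hynn j
  have hcount2 := hcount.trans (Set.ncard_le_ncard hsub (Set.toFinite _))
  have hcount3 : ((boxDiagrams a b N).ncard : ℝ) ≤
      ({D : DiagramOfArea n | topColumns (k + 1) D = x ∧ topRows (k + 1) D = y}.ncard : ℝ) := by
    exact_mod_cast hcount2
  rw [le_div_iff₀ hcardpos]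
  refine le_trans ?_ (hmain.trans hcount3)
  refine mul_le_mul_of_nonneg_right ?_ hcardpos.le
  have hfirst : 0 ≤ 1 - C₁ * (100 * η) := by
    linarith
  calc (1 - C * η) * Real.exp (-(X + s + s'))
      ≤ ((1 - C₁ * (100 * η)) * (1 - 24 * η)) * Real.exp (-(X + s + s')) := by
        refine mul_le_mul_of_nonneg_right ?_ (Real.exp_pos _).le
        have h1 : (1 - C₁ * (100 * η)) * (1 - 24 * η) =
          1 - 100 * (C₁ * η) - 24 * η + 2400 * (C₁ * η * η) := by ring
        have h2 := mul_nonneg hC₁η hη0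
        linarith
    _ ≤ ((1 - C₁ * (100 * η)) * Real.exp (-(24 * η))) * Real.exp (-(X + s + s')) := by
        refine mul_le_mul_of_nonneg_right (mul_le_mul_of_nonneg_left ?_ hfirst) (Real.exp_pos _).le
        exact Real.one_sub_le_exp_neg _
    _ = (1 - C₁ * (100 * η)) * Real.exp (-(24 * η) + -(X + s + s')) := by
        rw [mul_assoc, ← Real.exp_add]
    _ ≤ _ := by
        refine mul_le_mul_of_nonneg_left (Real.exp_le_exp.2 ?_) hfirst
        linarith

/-! ### Integrating the pointwise error -/

open Classical in
/-- The relative error allowed at a point; it is trivial away from the typical points. -/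
noncomputable def pointWeight (C : ℝ) (n k : ℕ)
    (p : (Fin (k + 1) → ℤ) × (Fin (k + 1) → ℤ)) : ENNReal :=
  if Antitone p.1 ∧ Antitone p.2 ∧ (p.1 0 : ℝ) ≤ Real.log n / rate n + 1 ∧
      (p.2 0 : ℝ) ≤ Real.log n / rate n + 1 then
    ENNReal.ofReal (C * pointError n k (lastMass (rate n) p.1) (lastMass (rate n) p.2))
  else 1

theorem lastMass_pos {τ : ℝ} (hτ : 0 < τ) {k : ℕ} (x : Fin (k + 1) → ℤ) : 0 < lastMass τ x :=
  div_pos (Real.exp_pos _) hτ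

theorem one_le_log_natCast {n : ℕ} (hn : 3 ≤ n) : 1 ≤ Real.log n := by
  have h : (3 : ℝ) ≤ n := by exact_mod_cast hn
  rw [Real.le_log_iff_exp_le (by linarith)]
  linarith [Real.exp_one_lt_d9]

theorem mul_rate_le_pointError {n : ℕ} (hn : 3 ≤ n) (k : ℕ) {s s' : ℝ} (hs : 0 ≤ s)
    (hs' : 0 ≤ s') : (k + 1) * rate n ≤ pointError n k s s' := by
  have hτ : 0 ≤ rate n := (rate_pos (by omega)).le
  have hk : (0 : ℝ) ≤ k := Nat.cast_nonneg k
  have hL : (1 : ℝ) ≤ Real.log n ^ 2 := one_le_pow₀ (one_le_log_natCast hn)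
  have h1 : (k : ℝ) + 1 ≤ ((k + 1) + s + s') ^ 2 :=
    le_trans (by linarith) (le_self_pow₀ (by linarith : (1 : ℝ) ≤ (k + 1) + s + s') two_ne_zero)
  exact mul_le_mul_of_nonneg_right (h1.trans (le_mul_of_one_le_right (sq_nonneg _) hL)) hτ

theorem exists_slantLaw_point_le : ∃ C > 0, ∀ᶠ n : ℕ in atTop, ∀ (k : ℕ)
    (p : (Fin (k + 1) → ℤ) × (Fin (k + 1) → ℤ)),
    slantLaw n (k + 1) {p} ≤
      diagramLaw n (k + 1) {p} + pointWeight C n k p * slantLaw n (k + 1) {p} := by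
  obtain ⟨C, hC, h⟩ := exists_diagramLaw_point_ge
  refine ⟨C + 2, by positivity, ?_⟩
  filter_upwards [h, eventually_ge_atTop 3] with n hn hn3
  rintro k ⟨x, y⟩
  have hτ := rate_pos (show 0 < n by omega)
  rw [pointWeight]
  split_ifs with hp
  swap
  · rw [one_mul]
    exact le_add_self
  obtain ⟨hx, hy, hx0, hy0⟩ := hp
  have h1 := hn k x y hx hy hx0 hy0
  have h2 := slantLaw_point_le (show 0 < n by omega) x y
  have h3 := mul_rate_le_pointError hn3 k (lastMass_pos hτ x).le (lastMass_pos hτ y).le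
  rw [diagramLaw_point]
  dsimp only at h1 h2 ⊢
  set η := pointError n k (lastMass (rate n) x) (lastMass (rate n) y)
  set p := ({D : DiagramOfArea n | topColumns (k + 1) D = x ∧ topRows (k + 1) D = y}.ncard : ℝ) /
    Nat.card (DiagramOfArea n)
  set X := Real.exp (-(rate n * (∑ j, (x j : ℝ) + ∑ j, (y j : ℝ)) + lastMass (rate n) x +
          lastMass (rate n) y))
  have hp0 : 0 ≤ p := by positivity
  have hX : 0 < X := Real.exp_pos _
  have hη : 0 ≤ η := le_trans (by positivity) h3
  set v := (slantLaw n (k + 1)).real {(x, y)} with hv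
  have hv0 : 0 ≤ v := measureReal_nonneg
  have ev : slantLaw n (k + 1) {(x, y)} = ENNReal.ofReal v := by rw [ofReal_measureReal]
  rw [ev, ENNReal.ofReal_le_ofReal_iff (by positivity)] at h2
  rw [ev, ← ENNReal.ofReal_mul (by positivity), ← ENNReal.ofReal_add hp0 (by positivity)]
  refine ENNReal.ofReal_le_ofReal ?_
  rcases le_or_gt (1 - (C + 2) * η) 0 with hneg | hpos
  · have := mul_nonneg hv0 (sub_nonneg.2 (sub_nonpos.1 hneg))
    linarith
  have hCη : 0 ≤ C * η := by positivity
  have h4 : 0 ≤ 1 - C * η := by linarith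
  have h5 : Real.exp (2 * (k + 1) * rate n) * (1 - (C + 2) * η) ≤ 1 - C * η := by
    calc Real.exp (2 * (k + 1) * rate n) * (1 - (C + 2) * η)
        ≤ Real.exp (2 * η) * ((1 - C * η) * Real.exp (-(2 * η))) := by
          refine mul_le_mul (Real.exp_le_exp.2 (by linarith)) ?_ hpos.le (Real.exp_pos _).le
          have h6 := mul_le_mul_of_nonneg_left (Real.one_sub_le_exp_neg (2 * η)) h4
          have h7 := mul_nonneg hCη hη
          linarith
      _ = 1 - C * η := by
          rw [mul_left_comm, ← Real.exp_add, add_neg_cancel, Real.exp_zero, mul_one]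
  have h6 : v * (1 - (C + 2) * η) ≤ p := by
    calc v * (1 - (C + 2) * η)
        ≤ Real.exp (2 * (k + 1) * rate n) * X * (1 - (C + 2) * η) :=
          mul_le_mul_of_nonneg_right h2 hpos.le
      _ = (Real.exp (2 * (k + 1) * rate n) * (1 - (C + 2) * η)) * X := by ring
      _ ≤ (1 - C * η) * X := mul_le_mul_of_nonneg_right h5 hX.le
      _ ≤ p := h1
  linarith

/-- A bound for the contribution of one of the two sequences of exponential variables to the
relative error. -/
noncomputable def incrementWeight (B t : ℝ) {k : ℕ} (E : Fin (k + 1) → ℝ) : ENNReal :=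
  ENNReal.ofReal B * ENNReal.ofReal ((∑ i, E i) ^ 2) + {E : Fin (k + 1) → ℝ | E 0 < t}.indicator 1 E

theorem measurableSet_first_lt (k : ℕ) (t : ℝ) :
    MeasurableSet {E : Fin (k + 1) → ℝ | E 0 < t} :=
  measurableSet_lt (measurable_pi_apply 0) measurable_const

theorem measurable_incrementWeight (B t : ℝ) (k : ℕ) :
    Measurable (incrementWeight B t (k := k)) := by
  unfold incrementWeight
  have hm : Measurable fun E : Fin (k + 1) → ℝ => ENNReal.ofReal ((∑ i, E i) ^ 2) := by fun_prop
  exact (hm.const_mul _).add (measurable_one.indicator (measurableSet_first_lt k t))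

theorem lintegral_incrementWeight_le {B t : ℝ} (hB : 0 ≤ B) (ht : 0 ≤ t) (k : ℕ) :
    ∫⁻ E, incrementWeight B t E ∂(Measure.pi fun _ : Fin (k + 1) => expMeasure 1) ≤
      ENNReal.ofReal (B * (2 * ((k : ℝ) + 1) ^ 2) + t) := by
  unfold incrementWeight
  have hm : Measurable fun E : Fin (k + 1) → ℝ => ENNReal.ofReal ((∑ i, E i) ^ 2) := by fun_prop
  rw [lintegral_add_left (hm.const_mul _), lintegral_const_mul _ hm,
    lintegral_indicator_one (measurableSet_first_lt k t), ENNReal.ofReal_add (by positivity) ht,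
    ENNReal.ofReal_mul hB]
  have h := lintegral_sum_sq_le (k + 1)
  push_cast at h
  gcongr
  exact pi_expMeasure_first_lt_le k t

theorem pointWeight_slantTuple_le {C : ℝ} (hC : 0 ≤ C) {n k : ℕ} (hn : 0 < n)
    {E E' : Fin (k + 1) → ℝ} (hE : ∀ i, 0 < E i) (hE' : ∀ i, 0 < E' i) :
    pointWeight C n k (slantTuple n E, slantTuple n E') ≤
      ENNReal.ofReal (3 * C * (Real.log n ^ 2 * rate n) * ((k : ℝ) + 1) ^ 2) +
        incrementWeight (3 * C * (Real.log n ^ 2 * rate n)) (rate n) E +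
        incrementWeight (3 * C * (Real.log n ^ 2 * rate n)) (rate n) E' := by
  have hτ := rate_pos hn
  have hB : 0 ≤ Real.log n ^ 2 * rate n := by positivity
  rw [pointWeight]
  split_ifs with hp
  · have h1 := lastMass_slantTuple_le hn hE
    have h2 := lastMass_slantTuple_le hn hE'
    have h1' := (lastMass_pos hτ (slantTuple n E)).le
    have h2' := (lastMass_pos hτ (slantTuple n E')).le
    dsimp only
    set S := ∑ i, E i
    set S' := ∑ i, E' i
    have hk : (0 : ℝ) ≤ k := Nat.cast_nonneg k
    have h3 : C * pointError n k (lastMass (rate n) (slantTuple n E))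
        (lastMass (rate n) (slantTuple n E')) ≤
        3 * C * (Real.log n ^ 2 * rate n) * ((k : ℝ) + 1) ^ 2 +
          3 * C * (Real.log n ^ 2 * rate n) * S ^ 2 +
          3 * C * (Real.log n ^ 2 * rate n) * S' ^ 2 := by
      have h4 : ((k : ℝ) + 1 + lastMass (rate n) (slantTuple n E) +
          lastMass (rate n) (slantTuple n E')) ^ 2 ≤ ((k : ℝ) + 1 + S + S') ^ 2 := by
        gcongr
      have h5 : ((k : ℝ) + 1 + S + S') ^ 2 ≤ 3 * (((k : ℝ) + 1) ^ 2 + S ^ 2 + S' ^ 2) := by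
        linarith [sq_nonneg ((k : ℝ) + 1 - S), sq_nonneg ((k : ℝ) + 1 - S'), sq_nonneg (S - S')]
      have h6 := mul_le_mul_of_nonneg_left (h4.trans h5) (mul_nonneg hC hB)
      rw [pointError]
      linarith
    refine (ENNReal.ofReal_le_ofReal h3).trans ?_
    rw [ENNReal.ofReal_add (by positivity) (by positivity),
      ENNReal.ofReal_add (by positivity) (by positivity),
      ENNReal.ofReal_mul (q := S ^ 2) (by positivity),
      ENNReal.ofReal_mul (q := S' ^ 2) (by positivity), incrementWeight, incrementWeight]
    gcongr
    · exact le_self_add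
    · exact le_self_add
  · by_cases h0 : E 0 < rate n
    · have h1 : (1 : ENNReal) ≤ incrementWeight (3 * C * (Real.log n ^ 2 * rate n)) (rate n) E := by
        rw [incrementWeight, Set.indicator_of_mem (by exact h0)]
        exact le_add_self
      exact h1.trans (le_add_self.trans le_self_add)
    by_cases h0' : E' 0 < rate n
    · have h1 : (1 : ENNReal) ≤ incrementWeight (3 * C * (Real.log n ^ 2 * rate n)) (rate n) E' := by
        rw [incrementWeight, Set.indicator_of_mem (by exact h0')]
        exact le_add_self
      exact h1.trans le_add_self
    exact absurd ⟨slantTuple_antitone hn hE, slantTuple_antitone hn hE',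
      slantTuple_zero_le hn (not_lt.1 h0), slantTuple_zero_le hn (not_lt.1 h0')⟩ hp

theorem lintegral_pointWeight_le {C : ℝ} (hC : 0 ≤ C) {n : ℕ} (hn : 3 ≤ n) (k : ℕ) :
    ∫⁻ p, pointWeight C n k p ∂(slantLaw n (k + 1)) ≤
      ENNReal.ofReal ((15 * C + 2) * (((k : ℝ) + 1) ^ 2 * (Real.log n ^ 2 * rate n))) := by
  have hn0 : 0 < n := by omega
  have hτ := rate_pos hn0
  rw [slantLaw, lintegral_map (measurable_of_countable _) (measurable_slantTuple_pair n (k + 1))]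
  set π := Measure.pi fun _ : Fin (k + 1) => expMeasure 1 with hπ
  set B := 3 * C * (Real.log n ^ 2 * rate n) with hB
  have hB0 : 0 ≤ B := by positivity
  have hfst : ∀ᵐ z ∂(π.prod π), ∀ i, 0 < z.1 i :=
    Measure.quasiMeasurePreserving_fst.ae (ae_pos_pi_expMeasure (k + 1))
  have hsnd : ∀ᵐ z ∂(π.prod π), ∀ i, 0 < z.2 i :=
    Measure.quasiMeasurePreserving_snd.ae (ae_pos_pi_expMeasure (k + 1))
  have h1 : ∫⁻ z, pointWeight C n k (slantTuple n z.1, slantTuple n z.2) ∂(π.prod π) ≤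
      ∫⁻ z, ENNReal.ofReal (B * ((k : ℝ) + 1) ^ 2) + incrementWeight B (rate n) z.1 +
        incrementWeight B (rate n) z.2 ∂(π.prod π) := by
    refine lintegral_mono_ae ?_
    filter_upwards [hfst, hsnd] with z hz hz'
    exact pointWeight_slantTuple_le hC hn0 hz hz'
  have hm := measurable_incrementWeight B (rate n) k
  have hm1 : Measurable fun z : (Fin (k + 1) → ℝ) × (Fin (k + 1) → ℝ) =>
    incrementWeight B (rate n) z.1 := hm.comp measurable_fst
  have hm2 : Measurable fun z : (Fin (k + 1) → ℝ) × (Fin (k + 1) → ℝ) =>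
    incrementWeight B (rate n) z.2 := hm.comp measurable_snd
  have hi := lintegral_incrementWeight_le hB0 hτ.le k
  rw [lintegral_add_right _ hm2, lintegral_add_right _ hm1,
    lintegral_const, measure_univ, mul_one,
    (measurePreserving_fst (μ := π) (ν := π)).lintegral_comp hm,
    (measurePreserving_snd (μ := π) (ν := π)).lintegral_comp hm] at h1
  refine (h1.trans (add_le_add (add_le_add_right hi _) hi)).trans ?_
  rw [← ENNReal.ofReal_add (by positivity) (by positivity),
    ← ENNReal.ofReal_add (by positivity) (by positivity)]
  refine ENNReal.ofReal_le_ofReal ?_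
  have h2 : rate n ≤ ((k : ℝ) + 1) ^ 2 * (Real.log n ^ 2 * rate n) := by
    have hk : (1 : ℝ) ≤ ((k : ℝ) + 1) ^ 2 := one_le_pow₀ (by linarith [Nat.cast_nonneg (α := ℝ) k])
    have hL : (1 : ℝ) ≤ Real.log n ^ 2 := one_le_pow₀ (one_le_log_natCast hn)
    rw [← mul_assoc]
    exact le_mul_of_one_le_left hτ.le (one_le_mul_of_one_le_of_one_le hk hL)
  rw [hB]
  linarith

theorem exists_abs_diagramLaw_sub_slantLaw_le : ∃ C > 0, ∀ᶠ n : ℕ in atTop, ∀ (k : ℕ)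
    (A : Set ((Fin k → ℤ) × (Fin k → ℤ))),
    |(diagramLaw n k).real A - (slantLaw n k).real A| ≤
      C * ((k : ℝ) ^ 2 * (Real.log n ^ 2 * rate n)) := by
  obtain ⟨C, hC, h⟩ := exists_slantLaw_point_le
  refine ⟨15 * C + 2, by positivity, ?_⟩
  filter_upwards [h, eventually_ge_atTop 3] with n hn hn3 k A
  have hτ := rate_pos (show 0 < n by omega)
  rcases k with _ | k
  · rcases Set.eq_empty_or_nonempty A with rfl | hA
    · simp
    · rw [Subsingleton.eq_univ_of_nonempty hA]
      simp
  · push_cast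
    exact abs_real_sub_le (hn k) (by positivity) (lintegral_pointWeight_le hC.le hn3 k) A

/-! ### Consequences for products -/

theorem slantLaw_real_prod (n k : ℕ) (B₁ B₂ : Set (Fin k → ℤ)) :
    (slantLaw n k).real (B₁ ×ˢ B₂) =
      (slantLaw n k).real (B₁ ×ˢ Set.univ) * (slantLaw n k).real (Set.univ ×ˢ B₂) := by
  have h : ∀ A₁ A₂ : Set (Fin k → ℤ), slantLaw n k (A₁ ×ˢ A₂) =
      (Measure.pi fun _ : Fin k => expMeasure 1) {E | slantTuple n E ∈ A₁} *
        (Measure.pi fun _ : Fin k => expMeasure 1) {E | slantTuple n E ∈ A₂} := by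
    intro A₁ A₂
    rw [slantLaw, Measure.map_apply (measurable_slantTuple_pair n k)
      (Set.to_countable _).measurableSet, ← Measure.prod_prod]
    rfl
  simp only [Measure.real, h, Set.mem_univ, Set.ofPred_true, measure_univ, mul_one, one_mul,
    ENNReal.toReal_mul]

theorem diagramLaw_real_prod (n k : ℕ) (B₁ B₂ : Set (Fin k → ℤ)) :
    (diagramLaw n k).real (B₁ ×ˢ B₂) =
      (uniformDiagram n).real {D | topColumns k D ∈ B₁ ∧ topRows k D ∈ B₂} := by
  rw [Measure.real, diagramLaw, Measure.map_apply (measurable_diagramOfArea _)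
    (Set.to_countable _).measurableSet]
  rfl

theorem abs_real_prod_sub_le {α β : Type*} [MeasurableSpace α] [MeasurableSpace β]
    {μ ν : Measure (α × β)} [IsProbabilityMeasure μ] [IsProbabilityMeasure ν] {D : ℝ}
    (h : ∀ A, |μ.real A - ν.real A| ≤ D) {B₁ : Set α} {B₂ : Set β}
    (hν : ν.real (B₁ ×ˢ B₂) = ν.real (B₁ ×ˢ Set.univ) * ν.real (Set.univ ×ˢ B₂)) :
    |μ.real (B₁ ×ˢ B₂) - μ.real (B₁ ×ˢ Set.univ) * μ.real (Set.univ ×ˢ B₂)| ≤ 3 * D := by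
  have h1 := h (B₁ ×ˢ B₂)
  have h2 := h (B₁ ×ˢ Set.univ)
  have h3 := h (Set.univ ×ˢ B₂)
  rw [hν] at h1
  set a := μ.real (B₁ ×ˢ Set.univ)
  set b := μ.real (Set.univ ×ˢ B₂)
  set a' := ν.real (B₁ ×ˢ Set.univ)
  set b' := ν.real (Set.univ ×ˢ B₂)
  have hb : |b| ≤ 1 := by rw [abs_of_nonneg measureReal_nonneg]; exact measureReal_le_one
  have ha' : |a'| ≤ 1 := by rw [abs_of_nonneg measureReal_nonneg]; exact measureReal_le_one
  have hD : 0 ≤ D := (abs_nonneg _).trans h1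
  calc |μ.real (B₁ ×ˢ B₂) - a * b|
      = |(μ.real (B₁ ×ˢ B₂) - a' * b') - a' * (b - b') - (a - a') * b| := by congr 1; ring
    _ ≤ |μ.real (B₁ ×ˢ B₂) - a' * b'| + |a' * (b - b')| + |(a - a') * b| :=
        (abs_sub _ _).trans (add_le_add_left (abs_sub _ _) _)
    _ ≤ D + 1 * D + D * 1 := by
        rw [abs_mul, abs_mul]
        gcongr
    _ = 3 * D := by ring

theorem sq_floor_mul_rate_le (γ : ℝ) {n : ℕ} (hn : 3 ≤ n) :
    (⌊(n : ℝ) ^ γ⌋₊ : ℝ) ^ 2 * (Real.log n ^ 2 * rate n) ≤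
      cConst * ((n : ℝ) ^ (2 * γ - 1 / 2) * Real.log n ^ 3) := by
  have hn0 : (0 : ℝ) < n := by exact_mod_cast (show 0 < n by omega)
  have hL := one_le_log_natCast hn
  have h1 : (⌊(n : ℝ) ^ γ⌋₊ : ℝ) ^ 2 ≤ (n : ℝ) ^ (2 * γ) := by
    have := Nat.floor_le (Real.rpow_nonneg hn0.le γ)
    refine (pow_le_pow_left₀ (Nat.cast_nonneg _) this 2).trans_eq ?_
    rw [← Real.rpow_natCast, ← Real.rpow_mul hn0.le]
    congr 1
    push_cast
    ring
  have h2 : Real.log n ^ 2 ≤ Real.log n ^ 3 := pow_le_pow_right₀ hL (by norm_num)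
  have h3 : (n : ℝ) ^ (2 * γ - 1 / 2) = (n : ℝ) ^ (2 * γ) / Real.sqrt n := by
    rw [Real.rpow_sub hn0, Real.sqrt_eq_rpow]
  have hτ := (rate_pos (show 0 < n by omega)).le
  calc (⌊(n : ℝ) ^ γ⌋₊ : ℝ) ^ 2 * (Real.log n ^ 2 * rate n)
      ≤ (n : ℝ) ^ (2 * γ) * (Real.log n ^ 3 * rate n) := by gcongr
    _ = cConst * ((n : ℝ) ^ (2 * γ - 1 / 2) * Real.log n ^ 3) := by
        rw [h3, rate]
        ring

theorem theorem2p1 (γ : ℝ) (hγ : γ < 1 / 4) :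
    (∃ C : ℝ, ∀ᶠ n : ℕ in atTop,
      tvDist (diagramLaw n ⌊(n : ℝ) ^ γ⌋₊) (slantLaw n ⌊(n : ℝ) ^ γ⌋₊) ≤
        C * ((n : ℝ) ^ (2 * γ - 1 / 2) * Real.log n ^ 3)) ∧
    (∃ C : ℝ, ∀ᶠ n : ℕ in atTop, ∀ B₁ B₂ : Set (Fin ⌊(n : ℝ) ^ γ⌋₊ → ℤ),
      |(uniformDiagram n).real {D | topColumns _ D ∈ B₁ ∧ topRows _ D ∈ B₂} -
          (uniformDiagram n).real {D | topColumns _ D ∈ B₁} *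
            (uniformDiagram n).real {D | topRows _ D ∈ B₂}| ≤
        C * ((n : ℝ) ^ (2 * γ - 1 / 2) * Real.log n ^ 3)) := by
  obtain ⟨C, hC, h⟩ := exists_abs_diagramLaw_sub_slantLaw_le
  have h' : ∀ᶠ n : ℕ in atTop, ∀ A, |(diagramLaw n ⌊(n : ℝ) ^ γ⌋₊).real A -
      (slantLaw n ⌊(n : ℝ) ^ γ⌋₊).real A| ≤
        C * (cConst * ((n : ℝ) ^ (2 * γ - 1 / 2) * Real.log n ^ 3)) := by
    filter_upwards [h, eventually_ge_atTop 3] with n hn hn3 A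
    exact (hn _ A).trans (mul_le_mul_of_nonneg_left (sq_floor_mul_rate_le γ hn3) hC.le)
  refine ⟨⟨C * cConst, ?_⟩, ⟨3 * (C * cConst), ?_⟩⟩
  · filter_upwards [h'] with n hn
    have : Nonempty {A : Set ((Fin ⌊(n : ℝ) ^ γ⌋₊ → ℤ) × (Fin ⌊(n : ℝ) ^ γ⌋₊ → ℤ)) //
      MeasurableSet A} := ⟨⟨∅, MeasurableSet.empty⟩⟩
    rw [mul_assoc]
    exact ciSup_le fun A => hn A.1
  · filter_upwards [h'] with n hn B₁ B₂
    have h1 := abs_real_prod_sub_le hn (slantLaw_real_prod n _ B₁ B₂)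
    simp only [diagramLaw_real_prod, Set.mem_univ, and_true, true_and] at h1
    rw [mul_assoc, mul_assoc]
    exact h1
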